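/- Let $d\ge 3$ be an integer and $m>\frac d2$ a real number. Let $g(x)=C_d|x|^{-(d-2)}$ be the Coulomb potential on $\mathbb{R}^d$, where $C_d=\frac{\Gamma(d/2)}{2(d-2)\pi^{d/2}}$ is the constant for which $-\Delta g=\delta_0$. Consider the equation $$\partial_t\rho=\Delta\rho+\nabla\cdot(\rho\,\nabla(g*\rho)),\qquad \rho|_{t=0}=\rho_0, \tag{1}$$ for a real-valued $\rho_0\in L^1(\mathbb{R}^d)\cap H^m(\mathbb{R}^d)$. Here $H^m(\mathbb{R}^d)$ carries the norm $\|f\|_{H^m}=\|(1+|\xi|^2)^{m/2}\hat f\|_{L^2}$. For $T>0$, a mild solution of (1) on $[0,T]$ is a function $\rho\in C([0,T];L^1(\mathbb{R}^d))\cap C([0,T];H^m(\mathbb{R}^d))$ such that for every $t\in[0,T]$ and almost every $x$ $$\rho(x,t)=e^{t\Delta}\rho_0(x)+\int_0^t e^{(t-s)\Delta}\nabla\cdot\Big(\rho(s,\cdot)\nabla(g*\rho(s,\cdot))\Big)(x)\,ds ,$$ where $e^{t\Delta}f=P(\cdot,t)*f$ and $e^{t\Delta}\nabla\cdot w(x)=\int_{\mathbb{R}^d}\nabla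 P(x-y,t)\cdot w(y)\,dy$ for $t>0$, with the heat kernel $P(x,t)=(4\pi t)^{-d/2}e^{-|x|^2/(4t)}$, $e^{0\Delta}f=f$, and the integrand in $s$ is required to be integrable. Then: 1. (Existence.) There is $T>0$ such that (1) has a mild solution on $[0,T]$. 2. (Uniqueness.) For every $T>0$, any two mild solutions of (1) on $[0,T]$ coincide. In particular the mild solution in 1 is unique. 3. (Blow-up criterion.) Let $T_b=\sup\{T>0 : \text{(1) has a mild solution on } [0,T]\}\in(0,\infty]$. There is a (by 2, unique) function $\rho$ on $[0,T_b)$ whose restriction to $[0,T]$ is a mild solution on $[0,T]$ for each $0<T<T_b$, and if $T_b<\infty$ then $$\limsup_{t\to T_b^-}\big(\|\rho_t\|_{H^m}+\|\rho_t\|_{L^1}\big)=+\infty .$$ 4. (Conservation of mass.) For every $T>0$ and every mild solution $\rho$ of (1) on $[0,T]$, $\int_{\mathbb{R}^d}\rho(x,t)\,dx=\int_{\mathbb{R}^d}\rho_0(x)\,dx$ for all $t\in[0,T]$. -/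

import Mathlib

open MeasureTheory Filter Topology Set
open scoped ENNReal

noncomputable section

namespace CoulombFP

/-- The Euclidean space `ℝ^d`. -/
abbrev Space (d : ℕ) : Type := EuclideanSpace ℝ (Fin d)

/-- The space `L¹(ℝ^d)` of (classes of) real-valued Lebesgue integrable functions. -/
abbrev L1 (d : ℕ) : Type := Lp ℝ 1 (volume : Measure (Space d))

/-- The Coulomb potential `g(x) = C_d |x|^{-(d-2)}` (for `d ≥ 3`), where
`C_d = 1 / ((d-2) |S^{d-1}|) = Γ(d/2) / (2 (d-2) π^{d/2})` is the constant for which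
`-Δ g = δ₀` in the sense of distributions. -/
def coulomb (d : ℕ) (x : Space d) : ℝ :=
  Real.Gamma (d / 2) / (2 * (d - 2) * Real.pi ^ ((d : ℝ) / 2)) * ‖x‖ ^ (-((d : ℝ) - 2))

/-- The potential `g * f`. -/
def potential {d : ℕ} (f : Space d → ℝ) (x : Space d) : ℝ :=
  ∫ y, coulomb d (x - y) * f y

/-- The vector field `f ∇(g * f)`. -/
def flux {d : ℕ} (f : Space d → ℝ) (x : Space d) : Space d :=
  f x • gradient (potential f) x

/-- The heat kernel `P(x,t) = (4πt)^{-d/2} exp(-|x|²/(4t))`, used for `t > 0`. -/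
def heatKernel {d : ℕ} (t : ℝ) (x : Space d) : ℝ :=
  (4 * Real.pi * t) ^ (-((d : ℝ) / 2)) * Real.exp (-(‖x‖ ^ 2 / (4 * t)))

/-- The heat semigroup `e^{tΔ} f = P(·,t) * f` for `t > 0`, and `e^{0Δ} f = f`. -/
def heat {d : ℕ} (t : ℝ) (f : Space d → ℝ) (x : Space d) : ℝ :=
  if t = 0 then f x else ∫ y, heatKernel t (x - y) * f y

/-- The function `e^{tΔ} ∇·w` for `t > 0` and an integrable vector field `w`:
the derivative falls on the kernel, `e^{tΔ} ∇·w (x) = ∫ ∇P(x-y,t) · w(y) dy`. -/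
def heatDiv {d : ℕ} (t : ℝ) (w : Space d → Space d) (x : Space d) : ℝ :=
  ∫ y, inner ℝ (gradient (heatKernel t) (x - y)) (w y)

/-- The `H^m` norm `‖(1 + |ξ|²)^{m/2} 𝓕f‖_{L²}` of an integrable function `f`, with value `∞` if
`f` is not in `H^m`. The Fourier transform is `𝓕f(ξ) = ∫ e^{-2πi x·ξ} f(x) dx`, the convention of
Mathlib's Bessel potential; other conventions give equivalent norms. -/
def sobolevNorm {d : ℕ} (m : ℝ) (f : Space d → ℝ) : ℝ≥0∞ :=
  eLpNorm (fun ξ => (((1 + ‖ξ‖ ^ 2) ^ (m / 2) : ℝ) : ℂ) *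
    FourierTransform.fourier (fun x => (f x : ℂ)) ξ) 2 volume

open scoped FourierTransform SchwartzMap in
/-- Finiteness of `sobolevNorm` is membership in the Sobolev space `H^m = H^{m,2}` of Mathlib. -/
theorem sobolevNorm_lt_top_iff {d : ℕ} (m : ℝ) (f : L1 d) :
    sobolevNorm m f < ∞ ↔ TemperedDistribution.MemSobolev m 2
      (Lp.toTemperedDistribution (Complex.ofRealCLM.compLp f : Lp ℂ 1 (volume : Measure (Space d)))) := by
  set F : Lp ℂ 1 (volume : Measure (Space d)) := Complex.ofRealCLM.compLp f with hF
  have hFf : (F : Space d → ℂ) =ᵐ[volume] fun x => (f x : ℂ) :=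
    Complex.ofRealCLM.coeFn_compLp' f
  have hfour : 𝓕 (F : Space d → ℂ) = 𝓕 (fun x => (f x : ℂ)) := by
    funext ξ
    rw [Real.fourier_eq, Real.fourier_eq]
    apply integral_congr_ae
    filter_upwards [hFf] with x hx
    rw [hx]
  have hFi : Integrable (F : Space d → ℂ) := L1.integrable_coeFn F
  have hcont : Continuous (𝓕 (F : Space d → ℂ)) :=
    VectorFourier.fourierIntegral_continuous Real.continuous_fourierChar
      (by simpa using (continuous_inner (𝕜 := ℝ) (E := Space d))) hFi
  set w : Space d → ℂ := fun ξ => (((1 + ‖ξ‖ ^ 2) ^ (m / 2) : ℝ) : ℂ) with hw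
  have hwt : w.HasTemperateGrowth := by rw [hw]; fun_prop
  set G : Space d → ℂ := fun ξ => w ξ * 𝓕 (F : Space d → ℂ) ξ with hG
  have hGc : Continuous G := hwt.1.continuous.mul hcont
  have hs : sobolevNorm m f = eLpNorm G 2 volume := by
    rw [sobolevNorm, hG, hfour]
  have key : ∀ φ : 𝓢(Space d, ℂ), TemperedDistribution.smulLeftCLM ℂ w
      (𝓕 (Lp.toTemperedDistribution F)) φ = ∫ ξ, φ ξ • G ξ := by
    intro φ
    rw [TemperedDistribution.smulLeftCLM_apply_apply, TemperedDistribution.fourier_apply,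
      Lp.toTemperedDistribution_apply, SchwartzMap.fourier_coe]
    have hflip := VectorFourier.integral_fourierIntegral_smul_eq_flip (e := Real.fourierChar)
      (L := innerₗ (Space d)) (μ := volume) (ν := volume) Real.continuous_fourierChar
      (by simpa using (continuous_inner (𝕜 := ℝ) (E := Space d)))
      (SchwartzMap.integrable (SchwartzMap.smulLeftCLM ℂ w φ)) hFi
    rw [flip_innerₗ] at hflip
    refine hflip.trans ?_
    apply integral_congr_ae
    filter_upwards with ξ
    rw [SchwartzMap.smulLeftCLM_apply_apply hwt, hG]
    simp only [smul_eq_mul]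
    change w ξ * φ ξ * 𝓕 (F : Space d → ℂ) ξ = φ ξ * (w ξ * 𝓕 (F : Space d → ℂ) ξ)
    ring
  rw [TemperedDistribution.memSobolev_iff_exists_smulLeftCLM_fourier, hs]
  constructor
  · intro h
    have hm : MemLp G 2 volume := ⟨hGc.aestronglyMeasurable, h⟩
    refine ⟨hm.toLp G, ?_⟩
    ext φ
    rw [key φ, Lp.toTemperedDistribution_apply]
    apply integral_congr_ae
    filter_upwards [hm.coeFn_toLp] with x hx
    rw [hx]
  · rintro ⟨u, hu⟩
    have hae : G =ᵐ[volume] u := by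
      apply ae_eq_of_integral_contDiff_smul_eq hGc.locallyIntegrable
        ((Lp.memLp u).locallyIntegrable (by norm_num))
      intro g g_smooth g_cpt
      have hg₁ : HasCompactSupport (Complex.ofRealCLM ∘ g) := g_cpt.comp_left rfl
      have hg₂ : ContDiff ℝ ((⊤ : ℕ∞) : WithTop ℕ∞) (Complex.ofRealCLM ∘ g) :=
        Complex.ofRealCLM.contDiff.comp g_smooth
      have := key (hg₁.toSchwartzMap hg₂)
      rw [hu, Lp.toTemperedDistribution_apply] at this
      simpa using this.symm
    rw [eLpNorm_congr_ae hae]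
    exact Lp.eLpNorm_lt_top u

/-- `ρ` is a mild solution on `[0,T]`, with initial value `ρ₀`, of
`∂ₜρ = Δρ + ∇·(ρ∇(g*ρ))` in the space `C([0,T]; L¹) ∩ C([0,T]; H^m)`.
Values of `ρ` outside `[0,T]` are irrelevant. -/
structure IsMildSolution {d : ℕ} (m : ℝ) (ρ₀ : L1 d) (T : ℝ) (ρ : ℝ → L1 d) : Prop where
  continuousOn_L1 : ContinuousOn ρ (Icc 0 T)
  mem_sobolev : ∀ t ∈ Icc 0 T, sobolevNorm m (ρ t) < ∞
  continuousOn_sobolev : ∀ t ∈ Icc 0 T,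
    Tendsto (fun s => sobolevNorm m (ρ s - ρ t : L1 d)) (𝓝[Icc 0 T] t) (𝓝 0)
  integrable_duhamel : ∀ t ∈ Icc 0 T, ∀ᵐ x,
    IntervalIntegrable (fun s => heatDiv (t - s) (flux (ρ s)) x) volume 0 t
  duhamel : ∀ t ∈ Icc 0 T, ∀ᵐ x,
    ρ t x = heat t ρ₀ x + ∫ s in (0 : ℝ)..t, heatDiv (t - s) (flux (ρ s)) x

/-- The largest time of existence `T_b ∈ [-∞, ∞]` of mild solutions. -/
def maximalTime {d : ℕ} (m : ℝ) (ρ₀ : L1 d) : EReal :=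
  sSup ((fun T : ℝ => (T : EReal)) '' {T | 0 < T ∧ ∃ ρ, IsMildSolution m ρ₀ T ρ})

end CoulombFP

end

noncomputable section

namespace CoulombFP

/-! ### Volterra equations with a weakly singular quadratic kernel -/

section Volterra

set_option linter.unusedSectionVars false

variable {X : Type*} [NormedAddCommGroup X] [NormedSpace ℝ X]

/-! The mild formulation is a Volterra equation `u t = h t + ∫₀ᵗ N (t - s) (u s) ds` in the Banach
space X of integrable functions with finite `H^m` norm, where `h` is the heat flow of the datum and
`N τ u` is `e^{τΔ} ∇·(u ∇(g * u))`. Two facts make it solvable. The derivative on the heat kernel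
costs only `τ^{-1/2}`, which is integrable at 0, and the flux `u ∇(g * u)` is a bounded quadratic
map of X into itself. Hence the fixed-point map contracts on intervals whose length depends only on
a bound for the solution. This yields existence, uniqueness (`IsVolterraSolution.eqOn`) and
continuation (`IsVolterraSolution.exists_extension`); a solution bounded up to a finite maximal time
could be continued past it, which is the blow-up criterion. Mass is conserved because the heat
kernel has integral 1 and its derivatives have integral 0.

The flux bound (`exists_norm_fluxProd_le`) is proved on the Fourier side. The symbol of `∂_j (g *
f)` has size at most `|ξ|⁻¹ |f̂|`. On the unit ball `|ξ|⁻¹` is integrable and square integrable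
since `d ≥ 3`, and `f̂` is bounded by the `L¹` norm; off the ball the symbol is dominated by `f̂`,
which is integrable because `m > d/2`. A product becomes a convolution, the weight `(1 +
|ξ|²)^{m/2}` is shared between the two factors, and Young's inequality concludes.

The rest is identification of pointwise integrals with these abstract objects. The symbol comes from
writing `g` as the time integral of the heat kernel (`ofReal_potential`,
`ofReal_gradient_potential`). The Bochner integral in X is matched almost everywhere with the
Duhamel integral in `toL1_integral_drift_ae`, so that mild solutions and Volterra solutions are the
same thing. -/

/-- A family of locally Lipschitz maps `N τ`, `τ > 0`, of quadratic growth, with singularity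
`τ^{-1/2}` at the origin. -/
structure IsVolterraKernel (C : ℝ) (N : ℝ → X → X) : Prop where
  nonneg : 0 ≤ C
  map_zero : ∀ τ, N τ 0 = 0
  lipschitz : ∀ τ, 0 < τ → ∀ u v,
    ‖N τ u - N τ v‖ ≤ C * τ ^ (-(1 / 2) : ℝ) * (‖u‖ + ‖v‖) * ‖u - v‖
  continuousOn : ContinuousOn (fun p : ℝ × X => N p.1 p.2) (Ioi 0 ×ˢ univ)

/-- `u` is continuous on `[0,T]` and `u t = h t + ∫₀ᵗ N (t - s) (u s) ds` there. -/
structure IsVolterraSolution (h : ℝ → X) (N : ℝ → X → X) (T : ℝ) (u : ℝ → X) : Prop where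
  continuousOn : ContinuousOn u (Icc 0 T)
  eq : ∀ t ∈ Icc 0 T, u t = h t + ∫ s in (0 : ℝ)..t, N (t - s) (u s)

lemma intervalIntegrable_sub_rpow (t a b : ℝ) :
    IntervalIntegrable (fun s : ℝ => (t - s) ^ (-(1 / 2) : ℝ)) volume a b := by
  have := (intervalIntegral.intervalIntegrable_rpow' (a := t - a) (b := t - b)
    (r := (-(1 / 2) : ℝ)) (by norm_num)).comp_sub_left t
  simpa using this

lemma integral_sub_rpow_le (t a b : ℝ) :
    ∫ s in a..b, (t - s) ^ (-(1 / 2) : ℝ) ≤ 2 * √(t - a) := by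
  rw [intervalIntegral.integral_comp_sub_left (fun s : ℝ => s ^ (-(1 / 2) : ℝ)),
    integral_rpow (Or.inl (by norm_num))]
  have h1 : (-(1 / 2) : ℝ) + 1 = 1 / 2 := by norm_num
  rw [h1, ← Real.sqrt_eq_rpow, ← Real.sqrt_eq_rpow]
  have := Real.sqrt_nonneg (t - b)
  linarith

namespace IsVolterraKernel

variable {C : ℝ} {N : ℝ → X → X}

lemma norm_le (hN : IsVolterraKernel C N) {τ : ℝ} (hτ : 0 < τ) (u : X) :
    ‖N τ u‖ ≤ C * τ ^ (-(1 / 2) : ℝ) * ‖u‖ ^ 2 := by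
  have := hN.lipschitz τ hτ u 0
  simp only [hN.map_zero, sub_zero, norm_zero, add_zero] at this
  nlinarith

lemma continuousOn_comp (hN : IsVolterraKernel C N) {u : ℝ → X} {T t : ℝ}
    (hu : ContinuousOn u (Icc 0 T)) (ht : t ≤ T) :
    ContinuousOn (fun s => N (t - s) (u s)) (Ico 0 t) := by
  refine hN.continuousOn.comp (f := fun s => (t - s, u s)) ?_ ?_
  · exact (continuous_const.sub continuous_id).continuousOn.prodMk
      (hu.mono fun s hs => ⟨hs.1, hs.2.le.trans ht⟩)
  · intro s hs
    simp only [mem_prod, mem_Ioi, mem_univ, and_true]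
    linarith [hs.2]

lemma intervalIntegrable (hN : IsVolterraKernel C N) {u : ℝ → X} {T t a b : ℝ}
    (hu : ContinuousOn u (Icc 0 T)) (ht : t ≤ T) (ha : 0 ≤ a) (hab : a ≤ b) (hb : b ≤ t) :
    IntervalIntegrable (fun s => N (t - s) (u s)) volume a b := by
  obtain ⟨M, hM⟩ := isCompact_Icc.exists_bound_of_continuousOn hu
  have hmem : ∀ᵐ s ∂volume.restrict (Ioo a b), s ∈ Ioo a b := ae_restrict_mem measurableSet_Ioo
  -- The open interval keeps `s` away from `t`, since neither continuity nor a bound for `N` is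
  -- assumed at time 0.
  rw [intervalIntegrable_iff_integrableOn_Ioo_of_le hab]
  have h1 := (intervalIntegrable_sub_rpow t a b).const_mul (C * M ^ 2)
  rw [intervalIntegrable_iff_integrableOn_Ioo_of_le hab] at h1
  refine h1.mono' ?_ ?_
  · exact ((hN.continuousOn_comp hu ht).mono
      fun s hs => ⟨ha.trans hs.1.le, hs.2.trans_le hb⟩).aestronglyMeasurable measurableSet_Ioo
  · filter_upwards [hmem] with s hs
    refine (hN.norm_le (by linarith [hs.2]) _).trans ?_
    have h2 := hM s ⟨ha.trans hs.1.le, (hs.2.le.trans hb).trans ht⟩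
    have h3 : ‖u s‖ ^ 2 ≤ M ^ 2 := by gcongr
    have h4 : 0 ≤ C * (t - s) ^ (-(1 / 2) : ℝ) :=
      mul_nonneg hN.nonneg (Real.rpow_nonneg (by linarith [hs.2]) _)
    nlinarith [mul_le_mul_of_nonneg_left h3 h4]

/-- The basic estimate behind contraction. One factor 2 comes from `‖u‖ + ‖v‖ ≤ 2M`, the other from
integrating `(t - s)^{-1/2}`. -/
lemma norm_integral_sub_le (hN : IsVolterraKernel C N) {u v : ℝ → X} {t a b M D : ℝ}
    (hab : a ≤ b) (hb : b ≤ t) (hM : 0 ≤ M) (hD : 0 ≤ D)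
    (hu : ∀ s ∈ Icc a b, ‖u s‖ ≤ M) (hv : ∀ s ∈ Icc a b, ‖v s‖ ≤ M)
    (hD' : ∀ s ∈ Icc a b, ‖u s - v s‖ ≤ D) :
    ‖∫ s in a..b, (N (t - s) (u s) - N (t - s) (v s))‖ ≤ 4 * C * M * D * √(t - a) := by
  have h1 := (intervalIntegrable_sub_rpow t a b).const_mul (2 * C * M * D)
  have h2 : ‖∫ s in a..b, (N (t - s) (u s) - N (t - s) (v s))‖ ≤
      ∫ s in a..b, 2 * C * M * D * (t - s) ^ (-(1 / 2) : ℝ) := by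
    rw [intervalIntegral.integral_of_le hab, intervalIntegral.integral_of_le hab,
      integral_Ioc_eq_integral_Ioo, integral_Ioc_eq_integral_Ioo]
    rw [intervalIntegrable_iff_integrableOn_Ioo_of_le hab] at h1
    refine norm_integral_le_of_norm_le h1 ?_
    filter_upwards [ae_restrict_mem measurableSet_Ioo] with s hs
    have hs' : s ∈ Icc a b := ⟨hs.1.le, hs.2.le⟩
    refine (hN.lipschitz _ (by linarith [hs.2]) _ _).trans ?_
    have h4 : 0 ≤ C * (t - s) ^ (-(1 / 2) : ℝ) :=
      mul_nonneg hN.nonneg (Real.rpow_nonneg (by linarith [hs.2]) _)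
    have h5 : (‖u s‖ + ‖v s‖) * ‖u s - v s‖ ≤ (M + M) * D :=
      mul_le_mul (add_le_add (hu s hs') (hv s hs')) (hD' s hs') (norm_nonneg _) (by linarith)
    nlinarith [mul_le_mul_of_nonneg_left h5 h4]
  refine h2.trans ?_
  rw [intervalIntegral.integral_const_mul]
  have h3 := integral_sub_rpow_le t a b
  have h4 : 0 ≤ 2 * C * M * D := by have := hN.nonneg; positivity
  nlinarith [mul_le_mul_of_nonneg_left h3 h4]

lemma norm_integral_le (hN : IsVolterraKernel C N) {u : ℝ → X} {t a b M : ℝ}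
    (hab : a ≤ b) (hb : b ≤ t) (hM : 0 ≤ M) (hu : ∀ s ∈ Icc a b, ‖u s‖ ≤ M) :
    ‖∫ s in a..b, N (t - s) (u s)‖ ≤ 4 * C * M * M * √(t - a) := by
  have := hN.norm_integral_sub_le (t := t) (v := fun _ => 0) hab hb hM hM hu (by simpa using fun _ _ _ => hM)
    (by simpa using fun s h1 h2 => hu s ⟨h1, h2⟩)
  simpa [hN.map_zero] using this

/-- Substituting `τ = t - s` pins the singularity at `τ = 0`, where `C M² τ^{-1/2}` dominates
uniformly in `t`. The remaining dependence on `t` is continuous except through the cutoff `τ < t`,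
which jumps only on the null set `τ = t₀`. -/
lemma continuousOn_integral (hN : IsVolterraKernel C N) {u : ℝ → X} {T : ℝ}
    (hu : Continuous u) : ContinuousOn (fun t => ∫ s in (0 : ℝ)..t, N (t - s) (u s)) (Icc 0 T) := by
  obtain ⟨M, hM⟩ := (isCompact_Icc (a := (0 : ℝ)) (b := T)).exists_bound_of_continuousOn
    hu.continuousOn
  have key : ∀ t ∈ Icc 0 T, ∫ s in (0 : ℝ)..t, N (t - s) (u s) =
      ∫ τ in Ioo 0 T, (Iio t).indicator (fun τ => N τ (u (t - τ))) τ := by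
    intro t ht
    have h1 := intervalIntegral.integral_comp_sub_left (a := (0 : ℝ)) (b := t)
      (fun τ => N τ (u (t - τ))) t
    simp only [sub_sub_cancel, sub_self, sub_zero] at h1
    rw [h1, intervalIntegral.integral_of_le ht.1, integral_Ioc_eq_integral_Ioo,
      setIntegral_indicator measurableSet_Iio]
    congr 2
    ext τ
    simp only [mem_Ioo, mem_inter_iff, mem_Iio]
    constructor
    · rintro ⟨h1, h2⟩; exact ⟨⟨h1, h2.trans_le ht.2⟩, h2⟩
    · rintro ⟨⟨h1, _⟩, h2⟩; exact ⟨h1, h2⟩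
  refine ContinuousOn.congr ?_ key
  intro t₀ ht₀
  refine tendsto_integral_filter_of_dominated_convergence
    (fun τ => C * M ^ 2 * τ ^ (-(1 / 2) : ℝ)) ?_ ?_ ?_ ?_
  · refine Eventually.of_forall fun t => ?_
    refine (aestronglyMeasurable_indicator_iff measurableSet_Iio).2 ?_
    rw [Measure.restrict_restrict measurableSet_Iio]
    refine ContinuousOn.aestronglyMeasurable ?_ (measurableSet_Iio.inter measurableSet_Ioo)
    refine hN.continuousOn.comp (f := fun τ => (τ, u (t - τ))) ?_ ?_
    · exact (continuous_id.prodMk (hu.comp (continuous_const.sub continuous_id))).continuousOn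
    · intro s hs
      simpa using hs.2.1
  · filter_upwards [self_mem_nhdsWithin] with t ht
    filter_upwards [ae_restrict_mem measurableSet_Ioo] with τ hτ
    have h4 : 0 ≤ C * τ ^ (-(1 / 2) : ℝ) :=
      mul_nonneg hN.nonneg (Real.rpow_nonneg hτ.1.le _)
    by_cases hτt : τ ∈ Iio t
    · rw [indicator_of_mem hτt]
      refine (hN.norm_le hτ.1 _).trans ?_
      have hτt' : τ < t := hτt
      have h3 : ‖u (t - τ)‖ ^ 2 ≤ M ^ 2 := by
        gcongr
        exact hM _ ⟨by linarith, by linarith [ht.2, hτ.1]⟩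
      nlinarith [mul_le_mul_of_nonneg_left h3 h4]
    · rw [indicator_of_notMem hτt, norm_zero]
      nlinarith [mul_nonneg h4 (sq_nonneg M)]
  · have h1 := (intervalIntegral.intervalIntegrable_rpow' (a := 0) (b := T)
      (r := (-(1 / 2) : ℝ)) (by norm_num)).const_mul (C * M ^ 2)
    rwa [intervalIntegrable_iff_integrableOn_Ioo_of_le (ht₀.1.trans ht₀.2)] at h1
  · have hne : ∀ᵐ τ ∂(volume.restrict (Ioo 0 T)), τ ≠ t₀ :=
      ae_restrict_of_ae (by simp [ae_iff, measure_singleton])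
    filter_upwards [hne, ae_restrict_mem measurableSet_Ioo] with τ hτ hτ0
    have hc : Tendsto (fun t => N τ (u (t - τ))) (𝓝[Icc 0 T] t₀) (𝓝 (N τ (u (t₀ - τ)))) := by
      have h1 : ContinuousAt (fun p : ℝ × X => N p.1 p.2) (τ, u (t₀ - τ)) :=
        hN.continuousOn.continuousAt (prod_mem_nhds (Ioi_mem_nhds hτ0.1) univ_mem)
      have h2 : ContinuousAt (fun t => (τ, u (t - τ))) t₀ := by fun_prop
      exact (ContinuousAt.comp (f := fun t => (τ, u (t - τ))) h1 h2).tendsto.mono_left nhdsWithin_le_nhds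
    rcases lt_or_gt_of_ne hτ with hlt | hgt
    · rw [indicator_of_mem (mem_Iio.2 hlt)]
      refine hc.congr' ?_
      filter_upwards [nhdsWithin_le_nhds (Ioi_mem_nhds hlt)] with t ht
      rw [indicator_of_mem (mem_Iio.2 ht)]
    · rw [indicator_of_notMem (by simpa using hgt.le)]
      refine tendsto_const_nhds.congr' ?_
      filter_upwards [nhdsWithin_le_nhds (Iio_mem_nhds hgt)] with t ht
      rw [indicator_of_notMem (by simpa using (mem_Iio.1 ht).le)]

/-- Supplies the step length: the last bound gives the contraction factor, and `δ ≤ 1` lets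
constants be chosen before `δ`. -/
lemma exists_step (K : ℝ) : ∃ δ : ℝ, 0 < δ ∧ δ ≤ 1 ∧ K * √δ ≤ 1 / 2 := by
  refine ⟨min 1 ((2 * (|K| + 1))⁻¹ ^ 2), by positivity, min_le_left _ _, ?_⟩
  have h1 : √(min 1 ((2 * (|K| + 1))⁻¹ ^ 2)) ≤ (2 * (|K| + 1))⁻¹ := by
    rw [Real.sqrt_le_left (by positivity)]
    exact min_le_right _ _
  calc K * √(min 1 ((2 * (|K| + 1))⁻¹ ^ 2)) ≤ |K| * (2 * (|K| + 1))⁻¹ := by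
        refine (mul_le_mul_of_nonneg_right (le_abs_self K) (Real.sqrt_nonneg _)).trans ?_
        gcongr
    _ ≤ 1 / 2 := by
        rw [← div_eq_mul_inv, div_le_div_iff₀ (by positivity) (by norm_num)]
        linarith

end IsVolterraKernel

/-! ### Uniqueness, gluing and continuation of Volterra solutions. -/

namespace IsVolterraSolution

variable {C : ℝ} {N : ℝ → X → X} {h : ℝ → X} {T : ℝ} {u v : ℝ → X}

lemma mono (hu : IsVolterraSolution h N T u) {T' : ℝ} (hT : T' ≤ T) :
    IsVolterraSolution h N T' u :=
  ⟨hu.continuousOn.mono (Icc_subset_Icc_right hT), fun t ht => hu.eq t ⟨ht.1, ht.2.trans hT⟩⟩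

/-- Agreement propagates in steps of length `δ`. At a point where `‖u - v‖` is maximal on `[0,t]`,
only the integral over the last step survives, so the maximum is at most half of itself. -/
theorem eqOn (hN : IsVolterraKernel C N) (hu : IsVolterraSolution h N T u)
    (hv : IsVolterraSolution h N T v) : EqOn u v (Icc 0 T) := by
  obtain ⟨M₁, hM₁⟩ := isCompact_Icc.exists_bound_of_continuousOn hu.continuousOn
  obtain ⟨M₂, hM₂⟩ := isCompact_Icc.exists_bound_of_continuousOn hv.continuousOn
  set M := max (max M₁ M₂) 0
  have hM : 0 ≤ M := le_max_right _ _
  obtain ⟨δ, hδ, -, hδ'⟩ := IsVolterraKernel.exists_step (4 * C * M)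
  have step : ∀ n : ℕ, ∀ t ∈ Icc 0 T, t ≤ n * δ → u t = v t := by
    intro n
    induction n with
    | zero =>
      intro t ht htn
      have : t = 0 := le_antisymm (by simpa using htn) ht.1
      rw [hu.eq t ht, hv.eq t ht, this]
      simp
    | succ n ih =>
      intro t ht htn
      have hcont : ContinuousOn (fun s => ‖u s - v s‖) (Icc 0 t) :=
        ((hu.continuousOn.sub hv.continuousOn).mono (Icc_subset_Icc_right ht.2)).norm
      obtain ⟨s, hs, hmax⟩ := isCompact_Icc.exists_isMaxOn ⟨0, left_mem_Icc.2 ht.1⟩ hcont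
      have hle : ∀ r ∈ Icc 0 t, ‖u r - v r‖ ≤ ‖u s - v s‖ := fun r hr => hmax hr
      have hs' : s ∈ Icc 0 T := ⟨hs.1, hs.2.trans ht.2⟩
      suffices h0 : ‖u s - v s‖ ≤ 0 by
        have := (hle t (right_mem_Icc.2 ht.1)).trans h0
        exact sub_eq_zero.1 (norm_le_zero_iff.1 this)
      rcases le_or_gt s (n * δ) with hsn | hsn
      · rw [ih s hs' hsn]; simp
      · have hnδ : 0 ≤ n * δ := by positivity
        have i1 := hN.intervalIntegrable hu.continuousOn hs'.2 le_rfl hs'.1 le_rfl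
        have i2 := hN.intervalIntegrable hv.continuousOn hs'.2 le_rfl hs'.1 le_rfl
        have i3 := (hN.intervalIntegrable hu.continuousOn hs'.2 le_rfl hnδ hsn.le).sub
          (hN.intervalIntegrable hv.continuousOn hs'.2 le_rfl hnδ hsn.le)
        have i4 := (hN.intervalIntegrable hu.continuousOn hs'.2 hnδ hsn.le le_rfl).sub
          (hN.intervalIntegrable hv.continuousOn hs'.2 hnδ hsn.le le_rfl)
        have e1 : u s - v s = ∫ r in (n * δ)..s, (N (s - r) (u r) - N (s - r) (v r)) := by
          rw [hu.eq s hs', hv.eq s hs', add_sub_add_left_eq_sub,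
            ← intervalIntegral.integral_sub i1 i2,
            ← intervalIntegral.integral_add_adjacent_intervals i3 i4, add_eq_right]
          rw [intervalIntegral.integral_congr (g := fun _ => 0)]
          · simp
          · intro r hr
            rw [uIcc_of_le hnδ] at hr
            simp only
            rw [ih r ⟨hr.1, (hr.2.trans hsn.le).trans hs'.2⟩ hr.2, sub_self]
        have hb := hN.norm_integral_sub_le (u := u) (v := v) (t := s) hsn.le le_rfl hM
          (norm_nonneg (u s - v s))
          (fun r hr => (hM₁ r ⟨hnδ.trans hr.1, hr.2.trans hs'.2⟩).trans
            ((le_max_left _ _).trans (le_max_left _ _)))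
          (fun r hr => (hM₂ r ⟨hnδ.trans hr.1, hr.2.trans hs'.2⟩).trans
            ((le_max_right _ _).trans (le_max_left _ _)))
          (fun r hr => hle r ⟨hnδ.trans hr.1, hr.2.trans hs.2⟩)
        rw [← e1] at hb
        have hsq : √(s - n * δ) ≤ √δ := by
          apply Real.sqrt_le_sqrt
          push_cast at htn
          linarith [hs.2]
        have h0 : 0 ≤ 4 * C * M := by have := hN.nonneg; positivity
        have h1 : 4 * C * M * √(s - n * δ) ≤ 1 / 2 :=
          (mul_le_mul_of_nonneg_left hsq h0).trans hδ'
        nlinarith [mul_le_mul_of_nonneg_right h1 (norm_nonneg (u s - v s))]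
  intro t ht
  obtain ⟨n, hn⟩ := exists_nat_ge (t / δ)
  exact step n t ht ((div_le_iff₀ hδ).1 hn)

lemma congr (hu : IsVolterraSolution h N T u) (huv : EqOn v u (Icc 0 T)) :
    IsVolterraSolution h N T v := by
  refine ⟨hu.continuousOn.congr huv, fun t ht => ?_⟩
  rw [huv ht, hu.eq t ht]
  congr 1
  refine intervalIntegral.integral_congr fun s hs => ?_
  rw [uIcc_of_le ht.1] at hs
  exact congrArg (N (t - s)) (huv ⟨hs.1, hs.2.trans ht.2⟩).symm

/-- All solutions are restrictions of one function. -/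
theorem exists_maximal (hN : IsVolterraKernel C N) :
    ∃ U : ℝ → X, ∀ T u, IsVolterraSolution h N T u → IsVolterraSolution h N T U := by
  classical
  -- The value at `t` is read off from some solution on `[0,t]`, chosen separately for each `t`;
  -- uniqueness makes the choices cohere.
  refine ⟨fun t => if ht : ∃ u, IsVolterraSolution h N t u then ht.choose t else 0,
    fun T u hu => hu.congr fun t ht => ?_⟩
  have hex : ∃ u, IsVolterraSolution h N t u := ⟨u, hu.mono ht.2⟩
  simp only [dif_pos hex]
  exact hex.choose_spec.eqOn hN (hu.mono ht.2) ⟨ht.1, le_rfl⟩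

/-- Solutions bounded by `M` on `[0,t₀]`, `t₀ ≤ T₁`, extend by a time `δ` that depends only on
`M` and `T₁`. -/
theorem exists_extension [CompleteSpace X] (hN : IsVolterraKernel C N)
    (hc : ContinuousOn h (Ici 0)) {R : ℝ} (hR : ∀ t, 0 ≤ t → ‖h t‖ ≤ R) (M T₁ : ℝ) (hM : 0 ≤ M) :
    ∃ δ : ℝ, 0 < δ ∧ ∀ t₀ ∈ Icc 0 T₁, ∀ u, IsVolterraSolution h N t₀ u →
      (∀ t ∈ Icc 0 t₀, ‖u t‖ ≤ M) → ∃ v, IsVolterraSolution h N (t₀ + δ) v := by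
  have hR0 : 0 ≤ R := (norm_nonneg _).trans (hR 0 le_rfl)
  have hC := hN.nonneg
  -- The terms bound, in order, the old solution, the forcing `h`, the memory integral over
  -- `[0,t₀]`, and the new integral over `[t₀,t]`.
  set R' : ℝ := M + R + 4 * C * M * M * √(T₁ + 1) + 1 with hR'
  have hR'1 : 1 ≤ R' := by
    have : 0 ≤ 4 * C * M * M * √(T₁ + 1) := by positivity
    linarith
  have hR'0 : 0 ≤ R' := zero_le_one.trans hR'1
  obtain ⟨δ, hδ, hδ1, hδ'⟩ := IsVolterraKernel.exists_step (4 * C * R' * R')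
  -- As `R' ≥ 1`, the choice of `δ` that keeps the ball invariant also gives contraction.
  have hδ'' : 4 * C * R' * √δ ≤ 1 / 2 := by
    refine le_trans ?_ hδ'
    have : 0 ≤ 4 * C * R' * √δ := by positivity
    nlinarith
  refine ⟨δ, hδ, fun t₀ ht₀ u hu huM => ?_⟩
  set T' := t₀ + δ with hT'
  have hT'0 : 0 ≤ T' := by linarith [ht₀.1]
  have htT' : t₀ ≤ T' := by linarith
  let E : C(Icc (0 : ℝ) T', X) → ℝ → X := fun v => IccExtend hT'0 v
  have hEc : ∀ v, Continuous (E v) := fun v => v.continuous.Icc_extend'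
  have hE : ∀ v (t : ℝ) (ht : t ∈ Icc 0 T'), E v t = v ⟨t, ht⟩ := fun v t ht =>
    IccExtend_of_mem hT'0 v ht
  let Φ : C(Icc (0 : ℝ) T', X) → C(Icc (0 : ℝ) T', X) := fun v =>
    ⟨(Icc 0 T').domRestrict fun t => h t + ∫ s in (0 : ℝ)..t, N (t - s) (E v s),
      ((hc.mono Icc_subset_Ici_self).add (hN.continuousOn_integral (hEc v))).domRestrict⟩
  have hΦ : ∀ v t, Φ v t = h t + ∫ s in (0 : ℝ)..t, N (t - s) (E v s) := fun v t => rfl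
  -- Freezing the values on `[0,t₀]` leaves only the integral over `[t₀,t]` to vary, so the
  -- contraction constant sees `δ` and not the whole length `T'`.
  let K : Set C(Icc (0 : ℝ) T', X) :=
    {v | ∀ t, ‖v t‖ ≤ R' ∧ ((t : ℝ) ≤ t₀ → v t = u t)}
  have hK : IsClosed K := by
    have : K = (⋂ t, {v | ‖v t‖ ≤ R'}) ∩ ⋂ t : Icc (0 : ℝ) T', ⋂ _ : (t : ℝ) ≤ t₀, {v | v t = u t} := by
      ext v
      simp only [K, mem_ofPred_eq, mem_inter_iff, mem_iInter, forall_and]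
    rw [this]
    refine (isClosed_iInter fun t => ?_).inter (isClosed_iInter fun t => isClosed_iInter fun _ => ?_)
    · exact isClosed_le (continuous_eval_const t).norm continuous_const
    · exact isClosed_eq (continuous_eval_const t) continuous_const
  have hbd : ∀ v ∈ K, ∀ s ∈ Icc 0 T', ‖E v s‖ ≤ R' := fun v hv s hs => by
    rw [hE v s hs]; exact (hv ⟨s, hs⟩).1
  have heq : ∀ v ∈ K, ∀ s ∈ Icc 0 t₀, E v s = u s := fun v hv s hs => by
    rw [hE v s ⟨hs.1, hs.2.trans htT'⟩]; exact (hv ⟨s, hs.1, hs.2.trans htT'⟩).2 hs.2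
  have hint : ∀ v, ∀ t ≤ T', ∀ a b, 0 ≤ a → a ≤ b → b ≤ t →
      IntervalIntegrable (fun s => N (t - s) (E v s)) volume a b := fun v t ht a b h1 h2 h3 =>
    hN.intervalIntegrable (hEc v).continuousOn ht h1 h2 h3
  have hagree : ∀ v ∈ K, ∀ t, ∀ b ∈ Icc 0 t₀,
      ∫ s in (0 : ℝ)..b, N (t - s) (E v s) = ∫ s in (0 : ℝ)..b, N (t - s) (u s) := by
    intro v hv t b hb
    refine intervalIntegral.integral_congr fun s hs => ?_
    rw [uIcc_of_le hb.1] at hs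
    rw [heq v hv s ⟨hs.1, hs.2.trans hb.2⟩]
  have hΦK : MapsTo Φ K K := by
    intro v hv t
    have hold : (t : ℝ) ≤ t₀ → Φ v t = u t := fun ht => by
      rw [hΦ, hagree v hv t t ⟨t.2.1, ht⟩, ← hu.eq t ⟨t.2.1, ht⟩]
    refine ⟨?_, hold⟩
    rcases le_or_gt (t : ℝ) t₀ with ht | ht
    · rw [hold ht]
      refine (huM t ⟨t.2.1, ht⟩).trans ?_
      have : 0 ≤ 4 * C * M * M * √(T₁ + 1) := by positivity
      linarith
    · rw [hΦ, ← intervalIntegral.integral_add_adjacent_intervals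
        (hint v t t.2.2 0 t₀ le_rfl ht₀.1 ht.le) (hint v t t.2.2 t₀ t ht₀.1 ht.le le_rfl)]
      have b1 : ‖∫ s in (0 : ℝ)..t₀, N (t - s) (E v s)‖ ≤ 4 * C * M * M * √(T₁ + 1) := by
        refine (hN.norm_integral_le ht₀.1 ht.le hM fun s hs => ?_).trans ?_
        · rw [heq v hv s hs]; exact huM s hs
        · gcongr
          have := t.2.2
          linarith [ht₀.2]
      have b2 : ‖∫ s in t₀..t, N (t - s) (E v s)‖ ≤ 1 / 2 := by
        refine (hN.norm_integral_le ht.le le_rfl hR'0 fun s hs =>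
          hbd v hv s ⟨ht₀.1.trans hs.1, hs.2.trans t.2.2⟩).trans (le_trans ?_ hδ')
        gcongr
        have := t.2.2
        linarith
      refine (norm_add_le _ _).trans ?_
      have b3 := norm_add_le (∫ s in (0 : ℝ)..t₀, N (t - s) (E v s)) (∫ s in t₀..t, N (t - s) (E v s))
      have := hR t t.2.1
      linarith
  have hcontr : ∀ v ∈ K, ∀ w ∈ K, dist (Φ v) (Φ w) ≤ 1 / 2 * dist v w := by
    intro v hv w hw
    rw [ContinuousMap.dist_le (by positivity)]
    intro t
    rw [hΦ, hΦ, dist_add_left]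
    rcases le_or_gt (t : ℝ) t₀ with ht | ht
    · rw [hagree v hv t t ⟨t.2.1, ht⟩, hagree w hw t t ⟨t.2.1, ht⟩, dist_self]
      positivity
    · rw [← intervalIntegral.integral_add_adjacent_intervals
        (hint v t t.2.2 0 t₀ le_rfl ht₀.1 ht.le) (hint v t t.2.2 t₀ t ht₀.1 ht.le le_rfl),
        ← intervalIntegral.integral_add_adjacent_intervals
        (hint w t t.2.2 0 t₀ le_rfl ht₀.1 ht.le) (hint w t t.2.2 t₀ t ht₀.1 ht.le le_rfl),
        hagree v hv t t₀ ⟨ht₀.1, le_rfl⟩, hagree w hw t t₀ ⟨ht₀.1, le_rfl⟩, dist_add_left,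
        dist_eq_norm, ← intervalIntegral.integral_sub (hint v t t.2.2 t₀ t ht₀.1 ht.le le_rfl)
          (hint w t t.2.2 t₀ t ht₀.1 ht.le le_rfl)]
      refine (hN.norm_integral_sub_le (D := dist v w) ht.le le_rfl hR'0 dist_nonneg
        (fun s hs => hbd v hv s ⟨ht₀.1.trans hs.1, hs.2.trans t.2.2⟩)
        (fun s hs => hbd w hw s ⟨ht₀.1.trans hs.1, hs.2.trans t.2.2⟩) fun s hs => ?_).trans ?_
      · have hs' : s ∈ Icc 0 T' := ⟨ht₀.1.trans hs.1, hs.2.trans t.2.2⟩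
        rw [hE v s hs', hE w s hs', ← dist_eq_norm]
        exact ContinuousMap.dist_apply_le_dist _
      · have h1 : √(t - t₀) ≤ √δ := Real.sqrt_le_sqrt (by have := t.2.2; linarith)
        calc 4 * C * R' * dist v w * √(t - t₀) ≤ 4 * C * R' * dist v w * √δ := by gcongr
          _ = 4 * C * R' * √δ * dist v w := by ring
          _ ≤ 1 / 2 * dist v w := by gcongr
  -- The starting point of the iteration continues `u` by its final value.
  have hne : (⟨fun t => u (min t t₀), by
      have : ContinuousOn (fun t : ℝ => u (min t t₀)) (Icc 0 T') :=
        hu.continuousOn.comp (f := fun t : ℝ => min t t₀) (by fun_prop)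
          fun t ht => ⟨le_min ht.1 ht₀.1, min_le_right _ _⟩
      exact this.domRestrict⟩ : C(Icc (0 : ℝ) T', X)) ∈ K := by
    intro t
    refine ⟨?_, fun ht => congrArg u (min_eq_left ht)⟩
    refine (huM _ ⟨le_min t.2.1 ht₀.1, min_le_right _ _⟩).trans ?_
    have : 0 ≤ 4 * C * M * M * √(T₁ + 1) := by positivity
    linarith
  have hctr : ContractingWith (1 / 2) (hΦK.restrict Φ K K) := by
    refine ⟨by norm_num, LipschitzWith.of_dist_le_mul fun v w => ?_⟩
    have := hcontr v v.2 w w.2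
    rw [Subtype.dist_eq, Subtype.dist_eq]
    exact_mod_cast this
  obtain ⟨v, hv, hfix, -⟩ := hctr.exists_fixedPoint' hK.isComplete hΦK hne (edist_ne_top _ _)
  refine ⟨E v, (hEc v).continuousOn, fun t ht => ?_⟩
  rw [hE v t ht]
  conv_lhs => rw [← hfix]
  rw [hΦ]

end IsVolterraSolution

end Volterra

/-! ### Bochner integrals in `L¹` and Young's inequality -/

section BochnerL1

variable {α Ω : Type*} [MeasurableSpace α] [MeasurableSpace Ω] {μ : Measure Ω} {ν : Measure α}

/-- The integral over a measurable set as a continuous functional on `L¹`. -/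
def setIntegralL1 (ν : Measure α) (s : Set α) : Lp ℝ 1 ν →L[ℝ] ℝ :=
  LinearMap.mkContinuous
    { toFun := fun f => ∫ x in s, f x ∂ν
      map_add' := fun f g => by
        rw [← integral_add (L1.integrable_coeFn f).integrableOn (L1.integrable_coeFn g).integrableOn]
        exact integral_congr_ae (ae_restrict_of_ae (Lp.coeFn_add f g))
      map_smul' := fun c f => by
        simp only [RingHom.id_apply]
        rw [← integral_smul]
        exact integral_congr_ae (ae_restrict_of_ae (Lp.coeFn_smul c f)) } 1 (by
    intro f
    simp only [LinearMap.coe_mk, AddHom.coe_mk, one_mul]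
    refine (norm_integral_le_integral_norm _).trans ?_
    rw [L1.norm_eq_integral_norm]
    exact setIntegral_le_integral (L1.integrable_coeFn f).norm
      (Eventually.of_forall fun _ => norm_nonneg _))

lemma setIntegralL1_apply (s : Set α) (f : Lp ℝ 1 ν) :
    setIntegralL1 ν s f = ∫ x in s, f x ∂ν := rfl

/-- Set integrals determine an integrable function. Integration over a set is a continuous
functional on `L¹`, so it commutes with the Bochner integral, and Fubini does the same for the
pointwise integral. -/
theorem integral_L1_apply_ae [SFinite μ] [SigmaFinite ν] {F : Ω → Lp ℝ 1 ν}
    (hF : Integrable F μ) {f : Ω × α → ℝ} (hf : AEStronglyMeasurable f (μ.prod ν))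
    (hFf : ∀ᵐ ω ∂μ, F ω =ᵐ[ν] fun x => f (ω, x)) :
    ∀ᵐ x ∂ν, Integrable (fun ω => f (ω, x)) μ ∧ (∫ ω, F ω ∂μ) x = ∫ ω, f (ω, x) ∂μ := by
  have hint : Integrable f (μ.prod ν) := by
    rw [integrable_prod_iff hf]
    refine ⟨?_, ?_⟩
    · filter_upwards [hFf] with ω hω using (integrable_congr hω).1 (L1.integrable_coeFn (F ω))
    · refine hF.norm.congr ?_
      filter_upwards [hFf] with ω hω
      rw [L1.norm_eq_integral_norm]
      refine integral_congr_ae ?_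
      filter_upwards [hω] with x hx
      rw [hx]
  have heq : (∫ ω, F ω ∂μ : Lp ℝ 1 ν) =ᵐ[ν] fun x => ∫ ω, f (ω, x) ∂μ := by
    refine ae_eq_of_forall_setIntegral_eq_of_sigmaFinite
      (fun s _ _ => (L1.integrable_coeFn _).integrableOn)
      (fun s _ _ => hint.integral_prod_right.integrableOn) fun s hs _ => ?_
    rw [← setIntegralL1_apply, ← ContinuousLinearMap.integral_comp_comm _ hF]
    have hint' : Integrable f (μ.prod (ν.restrict s)) := by
      refine hint.mono_measure ?_
      exact Measure.prod_mono le_rfl Measure.restrict_le_self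
    rw [← integral_integral_swap (f := fun ω x => f (ω, x)) hint']
    refine integral_congr_ae ?_
    filter_upwards [hFf] with ω hω
    rw [setIntegralL1_apply]
    exact integral_congr_ae (ae_restrict_of_ae hω)
  filter_upwards [hint.prod_left_ae, heq] with x h1 h2 using ⟨h1, h2⟩

end BochnerL1

section Young

variable {d : ℕ}

/-- Cauchy–Schwarz for the splitting `a b = (a b^{1/2}) b^{1/2}`. -/
lemma sq_lintegral_mul_le {α : Type*} [MeasurableSpace α] {μ : Measure α} {a b : α → ℝ≥0∞}
    (ha : AEMeasurable a μ) (hb : AEMeasurable b μ) :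
    (∫⁻ x, a x * b x ∂μ) ^ (2 : ℝ) ≤ (∫⁻ x, a x ^ (2 : ℝ) * b x ∂μ) * ∫⁻ x, b x ∂μ := by
  have h2 : ∀ t : ℝ≥0∞, t ^ (1 / 2 : ℝ) * t ^ (1 / 2 : ℝ) = t := fun t => by
    rw [← ENNReal.rpow_add_of_nonneg _ _ (by norm_num) (by norm_num)]; norm_num
  have h3 : ∀ t : ℝ≥0∞, (t ^ (1 / 2 : ℝ)) ^ (2 : ℝ) = t := fun t => by
    rw [← ENNReal.rpow_mul]; norm_num
  have h1 := ENNReal.lintegral_mul_le_Lp_mul_Lq μ Real.HolderConjugate.two_two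
    (ha.mul (hb.pow_const (1 / 2 : ℝ))) (hb.pow_const (1 / 2 : ℝ))
  simp only [Pi.mul_apply, mul_assoc, h2, ENNReal.mul_rpow_of_nonneg _ _ (zero_le_two (α := ℝ)), h3] at h1
  calc _ ≤ ((∫⁻ x, a x ^ (2 : ℝ) * b x ∂μ) ^ (1 / 2 : ℝ) * (∫⁻ x, b x ∂μ) ^ (1 / 2 : ℝ)) ^ (2 : ℝ) := by
        gcongr
    _ = _ := by rw [ENNReal.mul_rpow_of_nonneg _ _ zero_le_two, h3, h3]

/-- Young's inequality: Cauchy–Schwarz with `b` as a weight, then Tonelli and translation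
invariance. -/
theorem eLpNorm_lconvolution_le {a b : Space d → ℝ≥0∞} (ha : Measurable a) (hb : Measurable b) :
    eLpNorm (fun ξ => ∫⁻ η, a (ξ - η) * b η) 2 volume ≤
      eLpNorm a 2 volume * eLpNorm b 1 volume := by
  have e2 : ∀ f : Space d → ℝ≥0∞, eLpNorm f 2 volume = (∫⁻ x, f x ^ (2 : ℝ)) ^ (1 / 2 : ℝ) := by
    intro f
    rw [eLpNorm_eq_lintegral_rpow_enorm_toReal (by norm_num) (by norm_num)]
    simp
  rw [e2, e2, eLpNorm_one_eq_lintegral_enorm]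
  simp only [enorm_eq_self]
  have hm : Measurable (fun p : Space d × Space d => a (p.1 - p.2) ^ (2 : ℝ) * b p.2) := by fun_prop
  have key : ∫⁻ ξ, (∫⁻ η, a (ξ - η) * b η) ^ (2 : ℝ) ≤
      (∫⁻ x, a x ^ (2 : ℝ)) * (∫⁻ x, b x) ^ (2 : ℝ) := by
    calc ∫⁻ ξ, (∫⁻ η, a (ξ - η) * b η) ^ (2 : ℝ)
        ≤ ∫⁻ ξ, (∫⁻ η, a (ξ - η) ^ (2 : ℝ) * b η) * ∫⁻ x, b x :=
          lintegral_mono fun ξ => sq_lintegral_mul_le (by fun_prop) (by fun_prop)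
      _ = (∫⁻ ξ, ∫⁻ η, a (ξ - η) ^ (2 : ℝ) * b η) * ∫⁻ x, b x := by
          rw [lintegral_mul_const _ hm.lintegral_prod_right']
      _ = (∫⁻ η, ∫⁻ ξ, a (ξ - η) ^ (2 : ℝ) * b η) * ∫⁻ x, b x := by
          rw [lintegral_lintegral_swap hm.aemeasurable]
      _ = (∫⁻ η, (∫⁻ ξ, a ξ ^ (2 : ℝ)) * b η) * ∫⁻ x, b x := by
          congr 1
          refine lintegral_congr fun η => ?_
          rw [lintegral_mul_const _ (by fun_prop),
            lintegral_sub_right_eq_self (fun ξ => a ξ ^ (2 : ℝ)) η]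
      _ = _ := by
          rw [lintegral_const_mul _ hb, mul_assoc, ENNReal.rpow_two, sq]
  calc _ ≤ ((∫⁻ x, a x ^ (2 : ℝ)) * (∫⁻ x, b x) ^ (2 : ℝ)) ^ (1 / 2 : ℝ) := by gcongr
    _ = _ := by
      rw [ENNReal.mul_rpow_of_nonneg _ _ (by norm_num), ← ENNReal.rpow_mul]
      norm_num

end Young

/-! ### The Banach space `L¹ ∩ H^m` -/

section Fourier

variable {d : ℕ}

/-- The Fourier transform of an integrable function. -/
def fhat (f : L1 d) : Space d → ℂ := FourierTransform.fourier (fun x => (f x : ℂ))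

/-- The weight `(1 + |ξ|²)^{m/2}`. -/
def bracket (m : ℝ) (ξ : Space d) : ℝ := (1 + ‖ξ‖ ^ 2) ^ (m / 2)

lemma bracket_pos (m : ℝ) (ξ : Space d) : 0 < bracket m ξ := by
  unfold bracket; positivity

lemma continuous_bracket (m : ℝ) : Continuous (bracket m : Space d → ℝ) := by
  unfold bracket
  exact Continuous.rpow_const (by fun_prop) fun ξ => Or.inl (by positivity)

lemma fhat_apply (f : L1 d) (ξ : Space d) :
    fhat f ξ = ∫ x, (Real.fourierChar (-inner ℝ x ξ) : ℂ) * (f x : ℂ) := by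
  rw [fhat, Real.fourier_eq]
  rfl

lemma integrable_ofReal (f : L1 d) : Integrable (fun x => (f x : ℂ)) :=
  (L1.integrable_coeFn f).ofReal

lemma integrable_char_mul {f : Space d → ℂ} (hf : Integrable f) (ξ : Space d) :
    Integrable (fun x => (Real.fourierChar (-inner ℝ x ξ) : ℂ) * f x) :=
  (Real.fourierIntegral_convergent_iff ξ).2 hf

lemma fhat_add (f g : L1 d) (ξ : Space d) : fhat (f + g) ξ = fhat f ξ + fhat g ξ := by
  rw [fhat_apply, fhat_apply, fhat_apply,
    ← integral_add (integrable_char_mul (integrable_ofReal f) ξ)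
      (integrable_char_mul (integrable_ofReal g) ξ)]
  refine integral_congr_ae ?_
  filter_upwards [Lp.coeFn_add f g] with x hx
  rw [hx, Pi.add_apply, Complex.ofReal_add, mul_add]

lemma fhat_smul (c : ℝ) (f : L1 d) (ξ : Space d) : fhat (c • f) ξ = (c : ℂ) * fhat f ξ := by
  rw [fhat_apply, fhat_apply, ← integral_const_mul]
  refine integral_congr_ae ?_
  filter_upwards [Lp.coeFn_smul c f] with x hx
  rw [hx, Pi.smul_apply, smul_eq_mul, Complex.ofReal_mul]
  ring

lemma fhat_sub (f g : L1 d) (ξ : Space d) : fhat (f - g) ξ = fhat f ξ - fhat g ξ := by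
  have := fhat_add f ((-1 : ℝ) • g) ξ
  rw [fhat_smul, neg_smul, one_smul, ← sub_eq_add_neg] at this
  rw [this]
  push_cast
  ring

lemma norm_fhat_le (f : L1 d) (ξ : Space d) : ‖fhat f ξ‖ ≤ ‖f‖ := by
  refine (VectorFourier.norm_fourierIntegral_le_integral_norm _ _ _ _ _).trans ?_
  rw [L1.norm_eq_integral_norm]
  simp

lemma continuous_fhat (f : L1 d) : Continuous (fhat f) :=
  VectorFourier.fourierIntegral_continuous Real.continuous_fourierChar
    (by simpa using (continuous_inner (𝕜 := ℝ) (E := Space d))) (integrable_ofReal f)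

lemma sobolevNorm_eq (m : ℝ) (f : L1 d) :
    sobolevNorm m f = eLpNorm (fun ξ => (bracket m ξ : ℂ) * fhat f ξ) 2 volume := rfl

lemma continuous_bracket_mul_fhat (m : ℝ) (f : L1 d) :
    Continuous fun ξ => (bracket m ξ : ℂ) * fhat f ξ :=
  (Complex.continuous_ofReal.comp (continuous_bracket m)).mul (continuous_fhat f)

end Fourier

/-- The space `L¹ ∩ H^m`, as the graph of `f ↦ (1 + |ξ|²)^{m/2} 𝓕f` in `L¹ × L²`. -/
def sobolevGraph (d : ℕ) (m : ℝ) : Submodule ℝ (L1 d × Lp ℂ 2 (volume : Measure (Space d))) where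
  carrier := {p | p.2 =ᵐ[volume] fun ξ => (bracket m ξ : ℂ) * fhat p.1 ξ}
  add_mem' := by
    intro p q hp hq
    have hp' : p.2 =ᵐ[volume] fun ξ => (bracket m ξ : ℂ) * fhat p.1 ξ := hp
    have hq' : q.2 =ᵐ[volume] fun ξ => (bracket m ξ : ℂ) * fhat q.1 ξ := hq
    change (p.2 + q.2 : Lp ℂ 2 (volume : Measure (Space d))) =ᵐ[volume]
      fun ξ => (bracket m ξ : ℂ) * fhat (p.1 + q.1) ξ
    filter_upwards [hp', hq', Lp.coeFn_add p.2 q.2] with ξ h1 h2 h3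
    rw [h3, Pi.add_apply, h1, h2, fhat_add, mul_add]
  zero_mem' := by
    change ((0 : Lp ℂ 2 (volume : Measure (Space d))) : Space d → ℂ) =ᵐ[volume]
      fun ξ => (bracket m ξ : ℂ) * fhat 0 ξ
    filter_upwards [Lp.coeFn_zero ℂ 2 (volume : Measure (Space d))] with ξ h1
    have := fhat_smul 0 (0 : L1 d) ξ
    rw [zero_smul] at this
    rw [h1, this]
    simp
  smul_mem' := by
    intro c p hp
    have hp' : p.2 =ᵐ[volume] fun ξ => (bracket m ξ : ℂ) * fhat p.1 ξ := hp
    change (c • p.2 : Lp ℂ 2 (volume : Measure (Space d))) =ᵐ[volume]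
      fun ξ => (bracket m ξ : ℂ) * fhat (c • p.1) ξ
    filter_upwards [hp', Lp.coeFn_smul c p.2] with ξ h1 h3
    rw [h3, Pi.smul_apply, h1, fhat_smul, Complex.real_smul]
    ring

namespace SobolevL1

variable {d : ℕ} {m : ℝ}

/-- `L²` convergence gives convergence almost everywhere along a subsequence, and `L¹` convergence
gives convergence of the Fourier transforms at every point, so the two limits are compatible.
Completeness of the space follows. -/
lemma isClosed : IsClosed (sobolevGraph d m : Set (L1 d × Lp ℂ 2 (volume : Measure (Space d)))) := by
  refine isClosed_of_closure_subset fun p hp => ?_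
  obtain ⟨x, hx, hlim⟩ := mem_closure_iff_seq_limit.1 hp
  have h1 : Tendsto (fun n => (x n).1) atTop (𝓝 p.1) := (continuous_fst.tendsto p).comp hlim
  have h2 : Tendsto (fun n => (x n).2) atTop (𝓝 p.2) := (continuous_snd.tendsto p).comp hlim
  obtain ⟨φ, hφ, hae⟩ := (tendstoInMeasure_of_tendsto_Lp h2).exists_seq_tendsto_ae
  have hall : ∀ᵐ ξ, ∀ n, (x n).2 ξ = (bracket m ξ : ℂ) * fhat (x n).1 ξ :=
    ae_all_iff.2 fun n => hx n
  change p.2 =ᵐ[volume] fun ξ => (bracket m ξ : ℂ) * fhat p.1 ξ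
  filter_upwards [hae, hall] with ξ h3 h4
  have h5 : Tendsto (fun n => fhat (x n).1 ξ) atTop (𝓝 (fhat p.1 ξ)) := by
    rw [tendsto_iff_norm_sub_tendsto_zero] at h1 ⊢
    refine squeeze_zero (fun _ => norm_nonneg _) (fun n => ?_) h1
    rw [← fhat_sub]
    exact norm_fhat_le _ _
  have h6 := (h5.const_mul (bracket m ξ : ℂ)).comp hφ.tendsto_atTop
  refine tendsto_nhds_unique h3 (h6.congr fun n => ?_)
  exact (h4 (φ n)).symm

end SobolevL1

/-- The Banach space `L¹ ∩ H^m`. -/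
def SobolevL1 (d : ℕ) (m : ℝ) : Type := sobolevGraph d m

namespace SobolevL1

variable {d : ℕ} {m : ℝ}

instance : NormedAddCommGroup (SobolevL1 d m) := (sobolevGraph d m).normedAddCommGroup

instance : NormedSpace ℝ (SobolevL1 d m) := (sobolevGraph d m).normedSpace

instance : CompleteSpace (SobolevL1 d m) :=
  (isClosed.completeSpace_coe : CompleteSpace (sobolevGraph d m))

instance : SecondCountableTopologyEither (Space d) (SobolevL1 d m) :=
  secondCountableTopologyEither_of_left _ _

/-- The underlying integrable function. -/
def toL1 : SobolevL1 d m →L[ℝ] L1 d :=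
  ((ContinuousLinearMap.fst ℝ _ _).comp (sobolevGraph d m).subtypeL : sobolevGraph d m →L[ℝ] L1 d)

lemma snd_ae (u : SobolevL1 d m) : u.1.2 =ᵐ[volume] fun ξ => (bracket m ξ : ℂ) * fhat (toL1 u) ξ :=
  u.2

lemma enorm_snd (u : SobolevL1 d m) : ‖u.1.2‖ₑ = sobolevNorm m (toL1 u) := by
  rw [sobolevNorm_eq, Lp.enorm_def, eLpNorm_congr_ae (snd_ae u)]

lemma sobolevNorm_toL1_lt_top (u : SobolevL1 d m) : sobolevNorm m (toL1 u) < ∞ := by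
  rw [← enorm_snd]; exact enorm_lt_top

lemma enorm_eq (u : SobolevL1 d m) : ‖u‖ₑ = max ‖toL1 u‖ₑ (sobolevNorm m (toL1 u)) := by
  rw [← enorm_snd]
  change ‖u.1‖ₑ = _
  rw [← ofReal_norm, Prod.norm_def, ENNReal.ofReal_max, ofReal_norm,
    ofReal_norm]
  rfl

lemma toL1_injective : Function.Injective (toL1 : SobolevL1 d m → L1 d) := by
  intro u v h
  refine Subtype.ext (Prod.ext h (Lp.ext ?_))
  refine (snd_ae u).trans (EventuallyEq.trans ?_ (snd_ae v).symm)
  rw [h]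

lemma memLp_bracket_mul_fhat {f : L1 d} (hf : sobolevNorm m f < ∞) :
    MemLp (fun ξ => (bracket m ξ : ℂ) * fhat f ξ) 2 volume :=
  ⟨(continuous_bracket_mul_fhat m f).aestronglyMeasurable, hf⟩

/-- The element of `L¹ ∩ H^m` given by an integrable function with finite Sobolev norm. -/
def ofL1 (f : L1 d) (hf : sobolevNorm m f < ∞) : SobolevL1 d m :=
  ⟨(f, (memLp_bracket_mul_fhat hf).toLp), MemLp.coeFn_toLp (memLp_bracket_mul_fhat hf)⟩

@[simp] lemma toL1_ofL1 (f : L1 d) (hf : sobolevNorm m f < ∞) : toL1 (ofL1 f hf) = f := rfl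

/-- Translates continuity into the space into the two continuity conditions of a mild solution. -/
lemma tendsto_iff {ι : Type*} {l : Filter ι} {u : ι → SobolevL1 d m} {v : SobolevL1 d m} :
    Tendsto u l (𝓝 v) ↔ Tendsto (fun i => toL1 (u i)) l (𝓝 (toL1 v)) ∧
      Tendsto (fun i => sobolevNorm m (toL1 (u i) - toL1 v : L1 d)) l (𝓝 0) := by
  have key : Tendsto u l (𝓝 v) ↔ Tendsto (fun i => ‖u i - v‖ₑ) l (𝓝 0) := by
    rw [tendsto_iff_edist_tendsto_0]
    simp only [edist_eq_enorm_sub]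
  have key' : Tendsto (fun i => toL1 (u i)) l (𝓝 (toL1 v)) ↔
      Tendsto (fun i => ‖toL1 (u i) - toL1 v‖ₑ) l (𝓝 0) := by
    rw [tendsto_iff_edist_tendsto_0]
    simp only [edist_eq_enorm_sub]
  rw [key, key']
  simp only [enorm_eq, map_sub]
  constructor
  · intro h
    exact ⟨tendsto_of_tendsto_of_tendsto_of_le_of_le tendsto_const_nhds h (fun _ => zero_le)
      fun i => le_max_left _ _, tendsto_of_tendsto_of_tendsto_of_le_of_le tendsto_const_nhds h
      (fun _ => zero_le) fun i => le_max_right _ _⟩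
  · rintro ⟨h1, h2⟩
    simpa using h1.max h2

/-! #### Translations and convolutions -/

/-- Translation on `L¹`. -/
def translate (y : Space d) (f : L1 d) : L1 d :=
  Lp.compMeasurePreserving (fun x => x - y) (measurePreserving_sub_right volume y) f

lemma translate_ae (y : Space d) (f : L1 d) : translate y f =ᵐ[volume] fun x => f (x - y) :=
  Lp.coeFn_compMeasurePreserving _ _

lemma norm_translate (y : Space d) (f : L1 d) : ‖translate y f‖ = ‖f‖ :=
  Lp.norm_compMeasurePreserving _ _

lemma translate_add (y : Space d) (f g : L1 d) :
    translate y (f + g) = translate y f + translate y g :=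
  map_add (Lp.compMeasurePreserving _ (measurePreserving_sub_right volume y)) f g

lemma translate_smul (y : Space d) (c : ℝ) (f : L1 d) : translate y (c • f) = c • translate y f :=
  (Lp.compMeasurePreservingₗ ℝ _ (measurePreserving_sub_right volume y)).map_smul c f

lemma continuous_translate (f : L1 d) : Continuous fun y => translate y f := by
  have : Continuous fun y : Space d => (⟨fun x => x - y, by fun_prop⟩ : C(Space d, Space d)) :=
    ContinuousMap.continuous_of_continuous_uncurry _ (by
      change Continuous fun p : Space d × Space d => p.2 - p.1
      fun_prop)
  exact (continuous_const (y := f)).compMeasurePreservingLp this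
    (fun y => measurePreserving_sub_right volume y) (by norm_num)

lemma fhat_translate (y : Space d) (f : L1 d) (ξ : Space d) :
    fhat (translate y f) ξ = (Real.fourierChar (-inner ℝ y ξ) : ℂ) * fhat f ξ := by
  rw [fhat_apply, fhat_apply, ← integral_const_mul,
    ← integral_sub_right_eq_self (fun x => (Real.fourierChar (-inner ℝ y ξ) : ℂ) *
      ((Real.fourierChar (-inner ℝ x ξ) : ℂ) * (f x : ℂ))) y]
  refine integral_congr_ae ?_
  filter_upwards [translate_ae y f] with x hx
  rw [hx, ← mul_assoc, ← Circle.coe_mul, ← AddChar.map_add_eq_mul, inner_sub_left,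
    show -inner ℝ y ξ + -(inner ℝ x ξ - inner ℝ y ξ) = -inner ℝ x ξ by ring]

lemma sobolevNorm_translate (y : Space d) (f : L1 d) :
    sobolevNorm m (translate y f) = sobolevNorm m f := by
  rw [sobolevNorm_eq, sobolevNorm_eq]
  refine eLpNorm_congr_norm_ae (Eventually.of_forall fun ξ => ?_)
  rw [fhat_translate, norm_mul, norm_mul, norm_mul, Circle.norm_coe, one_mul]

/-- Translation multiplies the Fourier transform by a unimodular character that depends continuously
on the shift; dominated convergence applies with twice the weighted transform as majorant. -/
lemma tendsto_sobolevNorm_translate_sub (f : L1 d) (hf : sobolevNorm m f < ∞) (y : Space d) :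
    Tendsto (fun z => sobolevNorm m (translate z f - translate y f : L1 d)) (𝓝 y) (𝓝 0) := by
  have e2 : ∀ g : Space d → ℂ, eLpNorm g 2 volume = (∫⁻ x, ‖g x‖ₑ ^ (2 : ℝ)) ^ (1 / 2 : ℝ) := by
    intro g
    rw [eLpNorm_eq_lintegral_rpow_enorm_toReal (by norm_num) (by norm_num)]
    simp
  set G : Space d → ℂ := fun ξ => (bracket m ξ : ℂ) * fhat f ξ with hG
  have hGc : Continuous G := continuous_bracket_mul_fhat m f
  set c : Space d → Space d → ℂ := fun z ξ => (Real.fourierChar (-inner ℝ z ξ) : ℂ) -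
    (Real.fourierChar (-inner ℝ y ξ) : ℂ) with hc
  have hcc : Continuous fun p : Space d × Space d => c p.1 p.2 := by
    have : Continuous fun s : ℝ => (Real.fourierChar s : ℂ) :=
      continuous_subtype_val.comp Real.continuous_fourierChar
    exact (this.comp (by fun_prop)).sub (this.comp (by fun_prop))
  have heq : ∀ z, sobolevNorm m (translate z f - translate y f : L1 d) =
      (∫⁻ ξ, ‖c z ξ * G ξ‖ₑ ^ (2 : ℝ)) ^ (1 / 2 : ℝ) := by
    intro z
    rw [sobolevNorm_eq, e2]
    congr 1
    refine lintegral_congr fun ξ => ?_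
    rw [fhat_sub, fhat_translate, fhat_translate]
    congr 2
    simp only [hc, hG]
    ring
  simp only [heq]
  have hb : ∀ z ξ, ‖c z ξ * G ξ‖ₑ ^ (2 : ℝ) ≤ (2 : ℝ≥0∞) ^ (2 : ℝ) * ‖G ξ‖ₑ ^ (2 : ℝ) := by
    intro z ξ
    rw [← ENNReal.mul_rpow_of_nonneg _ _ zero_le_two]
    gcongr
    rw [enorm_mul]
    gcongr
    refine enorm_sub_le.trans ?_
    simp only [← ofReal_norm, Circle.norm_coe, ENNReal.ofReal_one]
    norm_num
  have hfin : ∫⁻ ξ, (2 : ℝ≥0∞) ^ (2 : ℝ) * ‖G ξ‖ₑ ^ (2 : ℝ) ≠ ∞ := by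
    rw [lintegral_const_mul' _ _ (by norm_num)]
    refine ENNReal.mul_ne_top (by norm_num) ?_
    have : eLpNorm G 2 volume < ∞ := hf
    rw [e2] at this
    intro h
    rw [h] at this
    norm_num at this
  have hlim : Tendsto (fun z => ∫⁻ ξ, ‖c z ξ * G ξ‖ₑ ^ (2 : ℝ)) (𝓝 y) (𝓝 0) := by
    have h0 : (0 : ℝ≥0∞) = ∫⁻ ξ : Space d, (0 : ℝ≥0∞) := by simp
    rw [h0]
    refine tendsto_lintegral_filter_of_dominated_convergence _
      (Eventually.of_forall fun z => ?_) (Eventually.of_forall fun z =>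
        Eventually.of_forall (hb z)) hfin (Eventually.of_forall fun ξ => ?_)
    · have : Continuous fun ξ => c z ξ * G ξ := (hcc.comp (by fun_prop : Continuous fun ξ => (z, ξ))).mul hGc
      exact (this.measurable.enorm.pow_const _)
    · have h1 : Continuous fun z => ‖c z ξ * G ξ‖ₑ ^ (2 : ℝ) := by
        have : Continuous fun z => c z ξ * G ξ :=
          (hcc.comp (by fun_prop : Continuous fun z : Space d => (z, ξ))).mul continuous_const
        exact ENNReal.continuous_rpow_const.comp this.enorm
      have := h1.tendsto y
      simpa [hc] using this
  have := (ENNReal.continuous_rpow_const (y := (1 / 2 : ℝ))).tendsto 0 |>.comp hlim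
  rw [ENNReal.zero_rpow_of_pos (by norm_num)] at this
  exact this

lemma norm_ofL1_translate (y : Space d) (u : SobolevL1 d m)
    (h : sobolevNorm m (translate y (toL1 u)) < ∞) : ‖ofL1 (translate y (toL1 u)) h‖ = ‖u‖ := by
  have : ‖ofL1 (translate y (toL1 u)) h‖ₑ = ‖u‖ₑ := by
    rw [enorm_eq, enorm_eq u, toL1_ofL1, sobolevNorm_translate, ← ofReal_norm,
      norm_translate, ofReal_norm]
  rw [← toReal_enorm, this, toReal_enorm]

/-- Translation on `L¹ ∩ H^m`. -/
def shift (y : Space d) : SobolevL1 d m →ₗᵢ[ℝ] SobolevL1 d m where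
  toFun u := ofL1 (translate y (toL1 u))
    ((sobolevNorm_translate y (toL1 u)).trans_lt (sobolevNorm_toL1_lt_top u))
  map_add' u v := toL1_injective (translate_add y (toL1 u) (toL1 v))
  map_smul' c u := toL1_injective (translate_smul y c (toL1 u))
  norm_map' u := norm_ofL1_translate y u
    ((sobolevNorm_translate y (toL1 u)).trans_lt (sobolevNorm_toL1_lt_top u))

lemma toL1_shift (y : Space d) (u : SobolevL1 d m) : toL1 (shift y u) = translate y (toL1 u) := rfl

/-- Shifts are isometries, so continuity in the shift for fixed `u` upgrades to joint continuity. -/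
lemma continuous_shift : Continuous fun p : Space d × SobolevL1 d m => shift p.1 p.2 := by
  rw [continuous_iff_continuousAt]
  rintro ⟨y, u⟩
  have h1 : Tendsto (fun p : Space d × SobolevL1 d m => shift p.1 u) (𝓝 (y, u)) (𝓝 (shift y u)) := by
    have : Tendsto (fun z => shift z u) (𝓝 y) (𝓝 (shift y u)) := by
      rw [tendsto_iff]
      exact ⟨(continuous_translate (toL1 u)).tendsto y,
        tendsto_sobolevNorm_translate_sub _ (sobolevNorm_toL1_lt_top u) y⟩
    exact this.comp (continuous_fst.tendsto _)
  have h2 : Tendsto (fun p : Space d × SobolevL1 d m => shift p.1 (p.2 - u)) (𝓝 (y, u)) (𝓝 0) := by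
    rw [tendsto_zero_iff_norm_tendsto_zero]
    simp only [LinearIsometry.norm_map]
    have : Continuous fun p : Space d × SobolevL1 d m => ‖p.2 - u‖ := by fun_prop
    simpa using this.tendsto (y, u)
  have := h1.add h2
  simp only [← map_add, add_sub_cancel, add_zero] at this
  exact this

lemma _root_.Continuous.shift {Y : Type*} [TopologicalSpace Y] {a : Y → Space d}
    {b : Y → SobolevL1 d m} (ha : Continuous a) (hb : Continuous b) :
    Continuous fun y => shift (a y) (b y) :=
  continuous_shift.comp (ha.prodMk hb)

/-- `∫ k(z) u(· - r z) dz`. -/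
def conv (k : Space d → ℝ) (r : ℝ) (u : SobolevL1 d m) : SobolevL1 d m :=
  ∫ z, k z • shift (r • z) u

section conv

variable {k : Space d → ℝ}

lemma norm_smul_shift (c : ℝ) (y : Space d) (u : SobolevL1 d m) :
    ‖c • shift y u‖ = ‖c‖ * ‖u‖ :=
  (norm_smul c (shift y u)).trans (congrArg _ ((shift y).norm_map u))

lemma integrable_conv (hk : Integrable k) (r : ℝ) (u : SobolevL1 d m) :
    Integrable (fun z => k z • shift (r • z) u) := by
  have hc : Continuous fun z : Space d => shift (r • z) u :=
    (continuous_const_smul r).shift continuous_const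
  have hm : AEStronglyMeasurable (fun z => k z • shift (r • z) u) :=
    AEStronglyMeasurable.smul (f := k) (g := fun z => shift (r • z) u) hk.1 hc.aestronglyMeasurable
  refine Integrable.mono' (g := fun z => ‖k z‖ * ‖u‖) (hk.norm.mul_const ‖u‖) hm ?_
  exact Eventually.of_forall fun z => (norm_smul_shift _ _ _).le

end conv
end SobolevL1

variable {d : ℕ} {m : ℝ}

namespace SobolevL1

variable {k : Space d → ℝ}

lemma conv_sub (hk : Integrable k) (r : ℝ) (u v : SobolevL1 d m) :
    conv k r (u - v) = conv k r u - conv k r v := by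
  rw [conv, conv, conv, ← integral_sub (integrable_conv hk r u) (integrable_conv hk r v)]
  simp only [map_sub, smul_sub]

lemma norm_conv_le (r : ℝ) (u : SobolevL1 d m) : ‖conv k r u‖ ≤ (∫ z, ‖k z‖) * ‖u‖ := by
  refine (norm_integral_le_integral_norm _).trans ?_
  rw [← integral_mul_const]
  exact (integral_congr_ae (Eventually.of_forall fun z => norm_smul_shift _ _ _)).le

/-- Scaling the translations instead of the kernel keeps the majorant `‖k z‖ ‖u‖` independent of
`r`, so continuity includes `r = 0`, that is, the initial time of the heat flow. -/
lemma continuous_conv (hk : Integrable k) :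
    Continuous fun p : ℝ × SobolevL1 d m => conv k p.1 p.2 := by
  have h0 : ∀ u : SobolevL1 d m, Continuous fun r : ℝ => conv k r u := by
    intro u
    refine continuous_of_dominated (F := fun (r : ℝ) z => k z • shift (r • z) u)
      (bound := fun z => ‖k z‖ * ‖u‖) (fun r => (integrable_conv hk r u).1)
      (fun r => Eventually.of_forall fun z => (norm_smul_shift _ _ _).le) (hk.norm.mul_const _)
      (Eventually.of_forall fun z => ?_)
    have : Continuous fun r : ℝ => shift (r • z) u :=
      (continuous_id.smul continuous_const).shift continuous_const
    exact this.const_smul (k z)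
  rw [continuous_iff_continuousAt]
  rintro ⟨r, u⟩
  have h1 : Tendsto (fun p : ℝ × SobolevL1 d m => conv k p.1 u) (𝓝 (r, u)) (𝓝 (conv k r u)) :=
    ((h0 u).tendsto r).comp (continuous_fst.tendsto _)
  have h2 : Tendsto (fun p : ℝ × SobolevL1 d m => conv k p.1 (p.2 - u)) (𝓝 (r, u)) (𝓝 0) := by
    refine squeeze_zero_norm (fun p => norm_conv_le p.1 (p.2 - u)) ?_
    have : Continuous fun p : ℝ × SobolevL1 d m => (∫ z, ‖k z‖) * ‖p.2 - u‖ :=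
      continuous_const.mul (continuous_snd.sub continuous_const).norm
    have h3 := this.tendsto (r, u)
    simp only [sub_self, norm_zero, mul_zero] at h3
    exact h3
  have h3 := h1.add h2
  rw [add_zero] at h3
  refine h3.congr fun p => ?_
  rw [conv_sub hk, add_sub_cancel]

lemma toL1_conv (hk : Integrable k) (r : ℝ) (u : SobolevL1 d m) :
    toL1 (conv k r u) = ∫ z, k z • translate (r • z) (toL1 u) := by
  rw [conv, ← ContinuousLinearMap.integral_comp_comm _ (integrable_conv hk r u)]
  refine integral_congr_ae (Eventually.of_forall fun z => ?_)
  exact (toL1.map_smul (k z) (shift (r • z) u)).trans (congrArg _ (toL1_shift _ _))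

lemma integrable_smul_translate (hk : Integrable k) (r : ℝ) (f : L1 d) :
    Integrable fun z => k z • translate (r • z) f := by
  have hc : Continuous fun z : Space d => translate (r • z) f :=
    (continuous_translate f).comp (continuous_const_smul r)
  refine Integrable.mono' (g := fun z => ‖k z‖ * ‖f‖) (hk.norm.mul_const ‖f‖)
    (hk.1.smul hc.aestronglyMeasurable) ?_
  exact Eventually.of_forall fun z => by rw [norm_smul, norm_translate]

lemma toL1_conv_ae (hk : Integrable k) (hkm : Measurable k) (r : ℝ) (u : SobolevL1 d m) :
    toL1 (conv k r u) =ᵐ[volume] fun x => ∫ z, k z * toL1 u (x - r • z) := by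
  rw [toL1_conv hk]
  have hm : Measurable fun p : Space d × Space d => k p.1 * toL1 u (p.2 - r • p.1) :=
    (hkm.comp measurable_fst).mul
      ((Lp.stronglyMeasurable (toL1 u)).measurable.comp (by fun_prop))
  filter_upwards [integral_L1_apply_ae (integrable_smul_translate hk r (toL1 u))
    hm.aestronglyMeasurable (Eventually.of_forall fun z => by
      filter_upwards [Lp.coeFn_smul (k z) (translate (r • z) (toL1 u)),
        translate_ae (r • z) (toL1 u)] with x h1 h2
      rw [h1, Pi.smul_apply, h2, smul_eq_mul])] with x hx using hx.2

lemma integral_translate (y : Space d) (f : L1 d) : ∫ x, translate y f x = ∫ x, f x := by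
  rw [integral_congr_ae (translate_ae y f), integral_sub_right_eq_self (fun x => f x)]

lemma integral_toL1_conv (hk : Integrable k) (r : ℝ) (u : SobolevL1 d m) :
    ∫ x, toL1 (conv k r u) x = (∫ z, k z) * ∫ x, toL1 u x := by
  have h : ∀ f : L1 d, setIntegralL1 volume univ f = ∫ x, f x := fun f => by
    rw [setIntegralL1_apply, Measure.restrict_univ]
  rw [← h, toL1_conv hk, ← ContinuousLinearMap.integral_comp_comm _
    (integrable_smul_translate hk r _), ← integral_mul_const]
  refine integral_congr_ae (Eventually.of_forall fun z => ?_)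
  simp only [map_smul, smul_eq_mul]
  rw [h, integral_translate]

lemma conv_zero_right (u : SobolevL1 d m) : conv k 0 u = (∫ z, k z) • u := by
  have h : shift (0 : Space d) u = u := by
    refine toL1_injective (Lp.ext ?_)
    rw [toL1_shift]
    filter_upwards [translate_ae 0 (toL1 u)] with x hx
    rw [hx, sub_zero]
  rw [conv, ← integral_smul_const]
  simp only [zero_smul, h]

end SobolevL1

/-- The substitution `y = x - r z` returns from scaled translations to convolution with the kernel
`r^{-d} k(·/r)`. -/
lemma integral_mul_comp_sub_smul {r : ℝ} (hr : 0 < r) (k f : Space d → ℝ) (x : Space d) :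
    ∫ z, k z * f (x - r • z) = ∫ y, ((r ^ d)⁻¹ * k (r⁻¹ • (x - y))) * f y := by
  have h1 := Measure.integral_comp_smul (volume : Measure (Space d))
    (fun y => k (r⁻¹ • y) * f (x - y)) r
  simp only [smul_smul, inv_mul_cancel₀ hr.ne', one_smul, finrank_euclideanSpace,
    Fintype.card_fin, smul_eq_mul] at h1
  rw [h1, ← integral_sub_left_eq_self (fun y => k (r⁻¹ • y) * f (x - y)) _ x,
    ← integral_const_mul, abs_of_pos (by positivity)]
  simp only [sub_sub_cancel, mul_assoc]

/-! ### The heat kernel -/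

lemma continuous_heatKernel (t : ℝ) : Continuous (heatKernel t : Space d → ℝ) := by
  unfold heatKernel; fun_prop

lemma heatKernel_nonneg {t : ℝ} (ht : 0 ≤ t) (x : Space d) : 0 ≤ heatKernel t x := by
  unfold heatKernel; positivity

lemma integrable_exp_neg_mul_sq {b : ℝ} (hb : 0 < b) :
    Integrable fun x : Space d => Real.exp (-b * ‖x‖ ^ 2) := by
  have h := (GaussianFourier.integrable_cexp_neg_mul_sq_norm_add (b := (b : ℂ)) (by simpa using hb)
    0 (0 : Space d)).norm
  refine h.congr (Eventually.of_forall fun x => ?_)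
  simp only [inner_zero_left, Complex.ofReal_zero, mul_zero, add_zero, Complex.norm_exp]
  congr 1
  norm_cast

lemma heatKernel_eq_exp (t : ℝ) (x : Space d) :
    heatKernel t x = (4 * Real.pi * t) ^ (-((d : ℝ) / 2)) * Real.exp (-(1 / (4 * t)) * ‖x‖ ^ 2) := by
  unfold heatKernel; congr 2; ring

lemma integrable_heatKernel {t : ℝ} (ht : 0 < t) : Integrable (heatKernel t : Space d → ℝ) := by
  have := (integrable_exp_neg_mul_sq (d := d) (b := 1 / (4 * t)) (by positivity)).const_mul
    ((4 * Real.pi * t) ^ (-((d : ℝ) / 2)))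
  exact this.congr (Eventually.of_forall fun x => (heatKernel_eq_exp t x).symm)

lemma integral_heatKernel {t : ℝ} (ht : 0 < t) : ∫ x : Space d, heatKernel t x = 1 := by
  simp only [heatKernel_eq_exp]
  rw [integral_const_mul, GaussianFourier.integral_rexp_neg_mul_sq_norm (by positivity),
    finrank_euclideanSpace, Fintype.card_fin]
  rw [show Real.pi / (1 / (4 * t)) = 4 * Real.pi * t by field_simp,
    ← Real.rpow_add (by positivity)]
  simp

lemma heatKernel_scale {t : ℝ} (ht : 0 < t) (x : Space d) :
    heatKernel t x = (√t ^ d)⁻¹ * heatKernel 1 ((√t)⁻¹ • x) := by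
  have h1 : (√t ^ d)⁻¹ = t ^ (-((d : ℝ) / 2)) := by
    rw [Real.sqrt_eq_rpow, ← Real.rpow_natCast, ← Real.rpow_mul ht.le, ← Real.rpow_neg ht.le]
    congr 1; ring
  unfold heatKernel
  rw [h1, norm_smul, mul_pow, norm_inv, Real.norm_of_nonneg (Real.sqrt_nonneg t), inv_pow,
    Real.sq_sqrt ht.le, Real.mul_rpow (by positivity) ht.le]
  rw [show t⁻¹ * ‖x‖ ^ 2 / (4 * 1) = ‖x‖ ^ 2 / (4 * t) by field_simp]
  rw [mul_one]
  ring

lemma gradient_heatKernel (t : ℝ) (x : Space d) :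
    gradient (heatKernel t) x = -(heatKernel t x / (2 * t)) • x := by
  have h1 : HasFDerivAt (fun x : Space d => ‖x‖ ^ 2) (2 • innerSL ℝ x) x := by
    simpa using (hasStrictFDerivAt_norm_sq x).hasFDerivAt
  have h2 := ((h1.const_mul (-(1 / (4 * t)))).exp).const_mul ((4 * Real.pi * t) ^ (-((d : ℝ) / 2)))
  have h3 : HasGradientAt (heatKernel t) (-(heatKernel t x / (2 * t)) • x) x := by
    rw [hasGradientAt_iff_hasFDerivAt]
    have : (heatKernel t : Space d → ℝ) = fun x => (4 * Real.pi * t) ^ (-((d : ℝ) / 2)) *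
        Real.exp (-(1 / (4 * t)) * ‖x‖ ^ 2) := funext fun x => heatKernel_eq_exp t x
    rw [this]
    refine h2.congr_fderiv (ContinuousLinearMap.ext fun v => ?_)
    simp
    ring
  exact h3.gradient

/-- The `j`-th partial derivative of the heat kernel at time `1`. -/
def dKernel (j : Fin d) (z : Space d) : ℝ := -(z j / 2) * heatKernel 1 z

lemma continuous_dKernel (j : Fin d) : Continuous (dKernel j) := by
  have := continuous_heatKernel (d := d) 1
  unfold dKernel
  fun_prop

/-- Parabolic scaling; the extra factor `(√t)⁻¹` is the singularity of the Volterra kernel. -/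
lemma gradient_heatKernel_apply {t : ℝ} (ht : 0 < t) (x : Space d) (j : Fin d) :
    gradient (heatKernel t) x j = (√t)⁻¹ * ((√t ^ d)⁻¹ * dKernel j ((√t)⁻¹ • x)) := by
  rw [gradient_heatKernel, PiLp.smul_apply, heatKernel_scale ht, dKernel, PiLp.smul_apply]
  have : t = √t * √t := (Real.mul_self_sqrt ht.le).symm
  have h0 : √t ≠ 0 := (Real.sqrt_pos.2 ht).ne'
  simp only [smul_eq_mul]
  generalize heatKernel 1 ((√t)⁻¹ • x) = P
  conv_lhs => rw [show (2 * t) = 2 * (√t * √t) by rw [← this]]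
  field_simp

/-- The linear factor is absorbed by giving up half of the Gaussian exponent, from `1/4` to `1/8`.
-/
lemma abs_dKernel_le (j : Fin d) (z : Space d) :
    |dKernel j z| ≤ (4 * Real.pi) ^ (-((d : ℝ) / 2)) * Real.exp (-(1 / 8) * ‖z‖ ^ 2) * 2 := by
  have h1 : |z j| ≤ ‖z‖ := by simpa using PiLp.norm_apply_le z j
  have h2 : ‖z‖ ≤ 4 * Real.exp (1 / 8 * ‖z‖ ^ 2) := by
    have := Real.add_one_le_exp (1 / 8 * ‖z‖ ^ 2)
    nlinarith [sq_nonneg (‖z‖ - 4), sq_nonneg ‖z‖]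
  rw [dKernel, abs_mul, abs_neg, abs_div, abs_two, abs_of_nonneg (heatKernel_nonneg zero_le_one z),
    heatKernel_eq_exp]
  have h3 : Real.exp (-(1 / 8) * ‖z‖ ^ 2) =
      Real.exp (1 / 8 * ‖z‖ ^ 2) * Real.exp (-(1 / (4 * 1)) * ‖z‖ ^ 2) := by
    rw [← Real.exp_add]; congr 1; ring
  rw [h3, mul_one (4 * Real.pi)]
  have h4 : |z j| / 2 ≤ 2 * Real.exp (1 / 8 * ‖z‖ ^ 2) := by linarith
  calc _ ≤ 2 * Real.exp (1 / 8 * ‖z‖ ^ 2) * ((4 * Real.pi) ^ (-((d : ℝ) / 2)) *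
        Real.exp (-(1 / (4 * 1)) * ‖z‖ ^ 2)) := by gcongr
    _ = _ := by ring

lemma integrable_dKernel (j : Fin d) : Integrable (dKernel j) := by
  refine (((integrable_exp_neg_mul_sq (d := d) (b := 1 / 8) (by norm_num)).const_mul
    ((4 * Real.pi) ^ (-((d : ℝ) / 2)))).mul_const 2).mono'
    (continuous_dKernel j).aestronglyMeasurable (Eventually.of_forall fun z => abs_dKernel_le j z)

lemma integral_dKernel (j : Fin d) : ∫ z, dKernel j z = 0 := by
  have h := integral_neg_eq_self (dKernel j) volume
  have h2 : ∀ z, dKernel j (-z) = -dKernel j z := fun z => by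
    simp only [dKernel, heatKernel, PiLp.neg_apply, norm_neg]
    ring
  simp only [h2, integral_neg] at h
  linarith

/-! ### The heat semigroup on `L¹ ∩ H^m` -/

/-- The operator `e^{tΔ}` on `L¹ ∩ H^m`. -/
def heatOp (t : ℝ) (u : SobolevL1 d m) : SobolevL1 d m := SobolevL1.conv (heatKernel 1) (√t) u

/-- The operator `e^{tΔ} ∂_j` on `L¹ ∩ H^m`. -/
def heatDerivOp (j : Fin d) (t : ℝ) (u : SobolevL1 d m) : SobolevL1 d m :=
  (√t)⁻¹ • SobolevL1.conv (dKernel j) (√t) u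

open SobolevL1

lemma continuous_heatOp (u : SobolevL1 d m) : Continuous fun t => heatOp t u :=
  Continuous.comp (g := fun p : ℝ × SobolevL1 d m => conv (heatKernel 1) p.1 p.2)
    (f := fun t => (√t, u)) (continuous_conv (integrable_heatKernel one_pos))
    (Real.continuous_sqrt.prodMk continuous_const)

lemma norm_heatOp_le (t : ℝ) (u : SobolevL1 d m) : ‖heatOp t u‖ ≤ ‖u‖ := by
  refine (norm_conv_le _ u).trans ?_
  have : ∫ z : Space d, ‖heatKernel 1 z‖ = 1 := by
    refine Eq.trans ?_ (integral_heatKernel (d := d) one_pos)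
    exact integral_congr_ae (Eventually.of_forall fun z =>
      Real.norm_of_nonneg (heatKernel_nonneg zero_le_one z))
  rw [this, one_mul]

lemma toL1_heatOp_ae {t : ℝ} (ht : 0 ≤ t) (u : SobolevL1 d m) :
    toL1 (heatOp t u) =ᵐ[volume] heat t (toL1 u) := by
  rcases ht.eq_or_lt with rfl | ht
  · rw [heatOp, Real.sqrt_zero, conv_zero_right, integral_heatKernel one_pos, one_smul]
    exact Eventually.of_forall fun x => by simp [heat]
  · filter_upwards [toL1_conv_ae (integrable_heatKernel one_pos)
      (continuous_heatKernel 1).measurable (√t) u] with x hx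
    rw [heatOp, hx, integral_mul_comp_sub_smul (Real.sqrt_pos.2 ht), heat, if_neg ht.ne']
    simp only [← heatKernel_scale ht]

lemma integral_toL1_heatOp (t : ℝ) (u : SobolevL1 d m) :
    ∫ x, toL1 (heatOp t u) x = ∫ x, toL1 u x := by
  rw [heatOp, integral_toL1_conv (integrable_heatKernel one_pos), integral_heatKernel one_pos,
    one_mul]

lemma heatDerivOp_sub (j : Fin d) (t : ℝ) (u v : SobolevL1 d m) :
    heatDerivOp j t (u - v) = heatDerivOp j t u - heatDerivOp j t v := by
  rw [heatDerivOp, conv_sub (integrable_dKernel j), smul_sub, heatDerivOp, heatDerivOp]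

lemma norm_heatDerivOp_le (j : Fin d) (t : ℝ) (u : SobolevL1 d m) :
    ‖heatDerivOp j t u‖ ≤ (√t)⁻¹ * ((∫ z, ‖dKernel j z‖) * ‖u‖) := by
  rw [heatDerivOp, norm_smul, norm_inv, Real.norm_of_nonneg (Real.sqrt_nonneg t)]
  gcongr
  exact norm_conv_le _ _

lemma continuousOn_heatDerivOp (j : Fin d) :
    ContinuousOn (fun p : ℝ × SobolevL1 d m => heatDerivOp j p.1 p.2) (Ioi 0 ×ˢ univ) := by
  have h1 : ContinuousOn (fun p : ℝ × SobolevL1 d m => (√p.1)⁻¹) (Ioi 0 ×ˢ univ) := by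
    refine ContinuousOn.inv₀ (Real.continuous_sqrt.comp continuous_fst).continuousOn ?_
    exact fun p hp => (Real.sqrt_pos.2 hp.1).ne'
  exact h1.smul ((continuous_conv (integrable_dKernel j)).comp
    ((Real.continuous_sqrt.comp continuous_fst).prodMk continuous_snd)).continuousOn

lemma integral_toL1_heatDerivOp (j : Fin d) (t : ℝ) (u : SobolevL1 d m) :
    ∫ x, toL1 (heatDerivOp j t u) x = 0 := by
  rw [heatDerivOp, map_smul, integral_congr_ae (Lp.coeFn_smul _ _)]
  simp only [Pi.smul_apply]
  rw [integral_smul, integral_toL1_conv (integrable_dKernel j), integral_dKernel, zero_mul,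
    smul_zero]

lemma toL1_heatDerivOp_ae (j : Fin d) {t : ℝ} (ht : 0 < t) (u : SobolevL1 d m) :
    toL1 (heatDerivOp j t u) =ᵐ[volume] fun x =>
      ∫ y, gradient (heatKernel t) (x - y) j * toL1 u y := by
  rw [heatDerivOp, map_smul]
  filter_upwards [Lp.coeFn_smul (√t)⁻¹ (toL1 (conv (dKernel j) (√t) u)),
    toL1_conv_ae (integrable_dKernel j) (continuous_dKernel j).measurable (√t) u] with x h1 h2
  rw [h1, Pi.smul_apply, h2, integral_mul_comp_sub_smul (Real.sqrt_pos.2 ht), smul_eq_mul,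
    ← integral_const_mul]
  simp only [gradient_heatKernel_apply ht, mul_assoc]

/-! ### Fourier-side bounds -/

/-- Controls low frequencies. The exponents needed are `s = 1` with `p = 1, 2` and `s = 2` with `p =
1`, so `s p ≤ 2 < d`. -/
lemma memLp_indicator_rpow (hd : 1 ≤ d) {s : ℝ} {p : ℝ≥0∞} (hp : p ≠ 0) (hp' : p ≠ ∞)
    (hs : s * p.toReal < d) :
    MemLp ((Metric.ball (0 : Space d) 1).indicator fun ξ => ‖ξ‖ ^ (-s)) p volume := by
  have hm : Measurable ((Metric.ball (0 : Space d) 1).indicator fun ξ => ‖ξ‖ ^ (-s)) :=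
    Measurable.indicator (by fun_prop) measurableSet_ball
  rw [← integrable_norm_rpow_iff hm.aestronglyMeasurable hp hp']
  have h1 : IntegrableOn (fun ξ : Space d => ‖ξ‖ ^ (-(s * p.toReal))) (Metric.ball 0 1) := by
    refine integrableOn_ball_of_norm_le_rpow (C := 1) (α := s * p.toReal) (by simpa using hd)
      (by simpa using hs) (Eventually.of_forall fun x => ?_)
      (Measurable.aestronglyMeasurable (by fun_prop))
    rw [one_mul, Real.norm_of_nonneg (by positivity)]
  rw [← integrable_indicator_iff measurableSet_ball] at h1
  refine h1.congr (Eventually.of_forall fun ξ => ?_)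
  have hp0 : p.toReal ≠ 0 := (ENNReal.toReal_pos hp hp').ne'
  by_cases hξ : ξ ∈ Metric.ball (0 : Space d) 1
  · simp only [indicator_of_mem hξ]
    rw [Real.norm_of_nonneg (by positivity), ← Real.rpow_mul (norm_nonneg _), neg_mul]
  · simp only [indicator_of_notMem hξ, norm_zero, Real.zero_rpow hp0]

lemma bracket_mul_neg (ξ : Space d) : bracket m ξ * bracket (-m) ξ = 1 := by
  rw [bracket, bracket, ← Real.rpow_add (by positivity)]
  simp [neg_div]

lemma memLp_bracket_neg (hm : (d : ℝ) / 2 < m) : MemLp (bracket (-m) : Space d → ℝ) 2 volume := by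
  rw [memLp_two_iff_integrable_sq (continuous_bracket _).aestronglyMeasurable]
  have := integrable_rpow_neg_one_add_norm_sq (E := Space d) (μ := volume) (r := 2 * m)
    (by rw [finrank_euclideanSpace, Fintype.card_fin]; linarith)
  refine this.congr (Eventually.of_forall fun ξ => ?_)
  simp only [bracket]
  rw [← Real.rpow_natCast ((1 + ‖ξ‖ ^ 2) ^ (-m / 2)) 2, ← Real.rpow_mul (by positivity)]
  congr 1
  push_cast
  ring

/-- Cauchy–Schwarz after inserting `bracket (-m) * bracket m = 1`; the first factor is finite
exactly when it is fed `m > d/2`. -/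
lemma eLpNorm_fhat_le (f : L1 d) :
    eLpNorm (fhat f) 1 volume ≤ eLpNorm (bracket (-m) : Space d → ℝ) 2 volume * sobolevNorm m f := by
  have h := eLpNorm_smul_le_mul_eLpNorm (p := 2) (q := 2) (r := 1)
    (continuous_bracket_mul_fhat m f).aestronglyMeasurable
    (continuous_bracket (d := d) (-m)).aestronglyMeasurable (μ := volume)
  refine le_trans (le_of_eq ?_) h
  congr 1
  funext ξ
  change _ = bracket (-m) ξ • ((bracket m ξ : ℂ) * fhat f ξ)
  rw [Complex.real_smul, ← mul_assoc, ← Complex.ofReal_mul, mul_comm (bracket (-m) ξ),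
    bracket_mul_neg, Complex.ofReal_one, one_mul]

lemma integrable_fhat (hm : (d : ℝ) / 2 < m) {f : L1 d} (hf : sobolevNorm m f < ∞) :
    Integrable (fhat f) := by
  rw [← memLp_one_iff_integrable]
  exact ⟨(continuous_fhat f).aestronglyMeasurable, (eLpNorm_fhat_le f).trans_lt
    (ENNReal.mul_lt_top (memLp_bracket_neg hm).2 hf)⟩

/-- Split at `|ξ| = 1`: inside, `f̂` is bounded by the `L¹` norm and `w` by `K`; outside, `|ξ|^{-s}
≤ 1`. The weights of interest are `1` and `bracket m`. -/
lemma eLpNorm_mul_rpow_mul_fhat_le {w : Space d → ℝ} (hw : Continuous w) {K : ℝ}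
    (hK : ∀ ξ ∈ Metric.ball (0 : Space d) 1, |w ξ| ≤ K) {s : ℝ} (hs : 0 ≤ s) {p : ℝ≥0∞}
    (hp : 1 ≤ p) (f : L1 d) :
    eLpNorm (fun ξ => w ξ * (‖ξ‖ ^ (-s) * ‖fhat f ξ‖)) p volume ≤
      ENNReal.ofReal K * eLpNorm ((Metric.ball (0 : Space d) 1).indicator fun ξ => ‖ξ‖ ^ (-s)) p volume
        * ‖f‖ₑ + eLpNorm (fun ξ => w ξ * ‖fhat f ξ‖) p volume := by
  set I : Space d → ℝ := (Metric.ball (0 : Space d) 1).indicator fun ξ => ‖ξ‖ ^ (-s)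
  have hIm : Measurable I := Measurable.indicator (by fun_prop) measurableSet_ball
  have hK0 : 0 ≤ K := (abs_nonneg _).trans (hK 0 (by simp))
  have hI0 : ∀ ξ, 0 ≤ I ξ := fun ξ => indicator_nonneg (fun _ _ => by positivity) ξ
  have h1 : eLpNorm (fun ξ => w ξ * (‖ξ‖ ^ (-s) * ‖fhat f ξ‖)) p volume ≤
      eLpNorm ((fun ξ => (K * ‖f‖) • I ξ) + fun ξ => ‖w ξ * ‖fhat f ξ‖‖) p volume := by
    refine eLpNorm_mono_real fun ξ => ?_
    simp only [Pi.add_apply, smul_eq_mul, norm_mul, norm_norm, Real.norm_eq_abs (w ξ)]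
    rw [Real.norm_of_nonneg (show 0 ≤ ‖ξ‖ ^ (-s) by positivity)]
    by_cases hξ : ξ ∈ Metric.ball (0 : Space d) 1
    · have h2 : I ξ = ‖ξ‖ ^ (-s) := indicator_of_mem hξ _
      have h3 := hK ξ hξ
      have h4 := norm_fhat_le f ξ
      have h5 : |w ξ| * (‖ξ‖ ^ (-s) * ‖fhat f ξ‖) ≤ K * (‖ξ‖ ^ (-s) * ‖f‖) := by gcongr
      have h6 : 0 ≤ |w ξ| * ‖fhat f ξ‖ := by positivity
      rw [h2]
      linarith
    · have h2 : ‖ξ‖ ^ (-s) ≤ 1 := by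
        have : 1 ≤ ‖ξ‖ := by simpa using hξ
        exact Real.rpow_le_one_of_one_le_of_nonpos this (by linarith)
      have h3 : 0 ≤ K * ‖f‖ * I ξ := mul_nonneg (by positivity) (hI0 ξ)
      have h4 : |w ξ| * (‖ξ‖ ^ (-s) * ‖fhat f ξ‖) ≤ |w ξ| * (1 * ‖fhat f ξ‖) := by gcongr
      linarith
  refine h1.trans ((eLpNorm_add_le ?_ ?_ hp).trans (le_of_eq ?_))
  · exact (hIm.const_smul (K * ‖f‖)).aestronglyMeasurable
  · exact (hw.mul (continuous_fhat f).norm).norm.aestronglyMeasurable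
  · rw [eLpNorm_norm, show (fun ξ => (K * ‖f‖) • I ξ) = (K * ‖f‖) • I from rfl,
      eLpNorm_const_smul, enorm_mul, ← ofReal_norm (K : ℝ), Real.norm_of_nonneg hK0, enorm_norm]
    ring

lemma integrable_rpow_mul_fhat (hd : 1 ≤ d) (hm : (d : ℝ) / 2 < m) {f : L1 d}
    (hf : sobolevNorm m f < ∞) {s : ℝ} (hs : 0 ≤ s) (hsd : s < d) :
    Integrable fun ξ : Space d => ‖ξ‖ ^ (-s) * ‖fhat f ξ‖ := by
  have hmeas : Measurable fun ξ : Space d => ‖ξ‖ ^ (-s) * ‖fhat f ξ‖ :=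
    Measurable.mul (by fun_prop) (continuous_fhat f).norm.measurable
  rw [← memLp_one_iff_integrable]
  refine ⟨hmeas.aestronglyMeasurable, ?_⟩
  have h := eLpNorm_mul_rpow_mul_fhat_le (w := fun _ => 1) continuous_const (K := 1)
    (fun _ _ => by simp) hs (p := 1) le_rfl f
  simp only [one_mul, eLpNorm_norm] at h
  refine h.trans_lt (ENNReal.add_lt_top.2 ⟨ENNReal.mul_lt_top (ENNReal.mul_lt_top (by simp)
    (memLp_indicator_rpow hd (by simp) (by simp) (by simpa using hsd)).2) enorm_lt_top, ?_⟩)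
  exact (memLp_one_iff_integrable.2 (integrable_fhat hm hf)).2

/-! ### Fourier representation of the heat flow and of the potential -/

/-- As a function of `y`, the kernel `P(x - y, t)` is the Fourier transform of a modulated Gaussian,
and the transform can be moved from that Gaussian onto `f`. -/
lemma ofReal_heat {t : ℝ} (ht : 0 < t) (f : L1 d) (x : Space d) :
    ((heat t f x : ℝ) : ℂ) = ∫ ξ, (Real.fourierChar (inner ℝ x ξ) : ℂ) *
      ((Real.exp (-(4 * Real.pi ^ 2 * t) * ‖ξ‖ ^ 2) : ℝ) * fhat f ξ) := by
  set φ : Space d → ℂ := fun v => Complex.exp (-((4 * Real.pi ^ 2 * t : ℝ) : ℂ) * ‖v‖ ^ 2 +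
    2 * Real.pi * Complex.I * (inner ℝ x v : ℝ)) with hφ
  have hb : 0 < (((4 * Real.pi ^ 2 * t : ℝ) : ℂ)).re := by
    rw [Complex.ofReal_re]; positivity
  have hφi : Integrable φ :=
    GaussianFourier.integrable_cexp_neg_mul_sq_norm_add hb (2 * Real.pi * Complex.I) x
  have hF : ∀ y, FourierTransform.fourier φ y = ((heatKernel t (x - y) : ℝ) : ℂ) := by
    intro y
    have := fourier_gaussian_innerProductSpace' hb x y
    refine this.trans ?_
    have h1 : (4 * Real.pi * t) ^ (-((d : ℝ) / 2)) =
        (Real.pi / (4 * Real.pi ^ 2 * t)) ^ ((d : ℝ) / 2) := by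
      rw [Real.rpow_neg (by positivity), ← Real.inv_rpow (by positivity)]
      congr 1
      have := Real.pi_pos.ne'
      field_simp
    have h2 : -(‖x - y‖ ^ 2 / (4 * t)) = -Real.pi ^ 2 * ‖x - y‖ ^ 2 / (4 * Real.pi ^ 2 * t) := by
      have := Real.pi_pos.ne'
      field_simp
    have h3 : ∀ a b c : ℝ, 0 ≤ a → ((a ^ b * Real.exp c : ℝ) : ℂ) = (a : ℂ) ^ (b : ℂ) *
        Complex.exp c := fun a b c ha => by
      rw [Complex.ofReal_mul, Complex.ofReal_cpow ha, Complex.ofReal_exp]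
    rw [heatKernel, finrank_euclideanSpace, Fintype.card_fin, h1, h2, h3 _ _ _ (by positivity)]
    push_cast
    rfl
  have hflip := VectorFourier.integral_fourierIntegral_smul_eq_flip (e := Real.fourierChar)
      (L := innerₗ (Space d)) (μ := volume) (ν := volume) Real.continuous_fourierChar
      (by simpa using (continuous_inner (𝕜 := ℝ) (E := Space d))) hφi (integrable_ofReal f)
  rw [flip_innerₗ] at hflip
  rw [heat, if_neg ht.ne', ← integral_complex_ofReal]
  refine Eq.trans (integral_congr_ae (Eventually.of_forall fun y => ?_)) (hflip.trans
    (integral_congr_ae (Eventually.of_forall fun ξ => ?_)))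
  · change _ = FourierTransform.fourier φ y • (f y : ℂ)
    rw [hF]; push_cast; rfl
  · change φ ξ * fhat f ξ = _
    beta_reduce
    rw [← mul_assoc]
    congr 1
    rw [hφ]
    beta_reduce
    rw [Complex.exp_add, mul_comm, Real.fourierChar_apply]
    congr 1
    · congr 1; push_cast; ring
    · push_cast; rfl

lemma abs_heat_le (hm : (d : ℝ) / 2 < m) {f : L1 d} (hf : sobolevNorm m f < ∞) {t : ℝ} (ht : 0 < t)
    (x : Space d) : |heat t f x| ≤ ∫ ξ, ‖fhat f ξ‖ := by
  rw [← Real.norm_eq_abs, ← Complex.norm_real, ofReal_heat ht]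
  refine norm_integral_le_of_norm_le (integrable_fhat hm hf).norm (Eventually.of_forall fun ξ => ?_)
  rw [norm_mul, norm_mul, Circle.norm_coe, one_mul, Complex.norm_real,
    Real.norm_of_nonneg (Real.exp_nonneg _)]
  refine mul_le_of_le_one_left (norm_nonneg _) (Real.exp_le_one_iff.2 ?_)
  have : 0 ≤ 4 * Real.pi ^ 2 * t * ‖ξ‖ ^ 2 := by positivity
  linarith

/-- The heat flow obeys this bound uniformly in time and tends to `f` in `L¹` as the time tends to
0, hence almost everywhere along a subsequence. -/
lemma ae_abs_le (hm : (d : ℝ) / 2 < m) {f : L1 d} (hf : sobolevNorm m f < ∞) :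
    ∀ᵐ x, |f x| ≤ ∫ ξ, ‖fhat f ξ‖ := by
  set u : SobolevL1 d m := ofL1 f hf
  have h0 : heatOp 0 u = u := by
    rw [heatOp, Real.sqrt_zero, conv_zero_right, integral_heatKernel one_pos, one_smul]
  have hlim : Tendsto (fun n : ℕ => toL1 (heatOp (1 / ((n : ℝ) + 1)) u)) atTop (𝓝 f) := by
    have h1 := (toL1.continuous.tendsto _).comp (((continuous_heatOp u).tendsto 0).comp
      tendsto_one_div_add_atTop_nhds_zero_nat)
    rw [h0] at h1
    exact h1
  obtain ⟨φ, -, hae⟩ := (tendstoInMeasure_of_tendsto_Lp hlim).exists_seq_tendsto_ae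
  have hall : ∀ᵐ x, ∀ n : ℕ, toL1 (heatOp (1 / ((n : ℝ) + 1)) u) x = heat (1 / ((n : ℝ) + 1)) f x :=
    ae_all_iff.2 fun n => toL1_heatOp_ae (by positivity) u
  filter_upwards [hae, hall] with x h1 h2
  refine le_of_tendsto h1.abs (Eventually.of_forall fun n => ?_)
  rw [h2]
  exact abs_heat_le hm hf (by positivity) x

/-! ### The Coulomb potential -/

/-- The Coulomb potential is the time integral of the heat kernel. -/
lemma integral_heatKernel_time (hd : 3 ≤ d) {z : Space d} (hz : z ≠ 0) :
    ∫ t in Ioi (0 : ℝ), heatKernel t z = coulomb d z := by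
  have hd' : (3 : ℝ) ≤ d := by exact_mod_cast hd
  have hr : 0 < ‖z‖ := norm_pos_iff.2 hz
  have hpi := Real.pi_pos
  -- The substitution `t = 1/s` produces a Gamma integral with parameter `d/2 - 1`.
  rw [← integral_comp_rpow_Ioi (fun t => heatKernel t z) (p := -1) (by norm_num)]
  have h1 : ∀ s ∈ Ioi (0 : ℝ), (|(-1 : ℝ)| * s ^ ((-1 : ℝ) - 1)) • heatKernel (s ^ (-1 : ℝ)) z =
      (4 * Real.pi) ^ (-((d : ℝ) / 2)) *
        (s ^ (((d : ℝ) / 2 - 1) - 1) * Real.exp (-(‖z‖ ^ 2 / 4 * s))) := by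
    intro s hs
    have hs : 0 < s := hs
    rw [heatKernel, Real.mul_rpow (by positivity) (by positivity), ← Real.rpow_mul hs.le,
      abs_neg, abs_one, one_mul, smul_eq_mul]
    have e1 : s ^ (((d : ℝ) / 2 - 1) - 1) = s ^ ((-1 : ℝ) - 1) * s ^ (-1 * -((d : ℝ) / 2)) := by
      rw [← Real.rpow_add hs]; congr 1; ring
    have e2 : -(‖z‖ ^ 2 / (4 * s ^ (-1 : ℝ))) = -(‖z‖ ^ 2 / 4 * s) := by
      rw [Real.rpow_neg_one]; field_simp
    rw [e1, e2]
    ring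
  rw [setIntegral_congr_fun measurableSet_Ioi h1, integral_const_mul,
    Real.integral_rpow_mul_exp_neg_mul_Ioi (by linarith) (by positivity), coulomb]
  have hG : Real.Gamma ((d : ℝ) / 2) = ((d : ℝ) / 2 - 1) * Real.Gamma ((d : ℝ) / 2 - 1) := by
    have := Real.Gamma_add_one (s := (d : ℝ) / 2 - 1) (by linarith)
    rw [← this]; congr 1; ring
  have e3 : (1 / (‖z‖ ^ 2 / 4)) ^ ((d : ℝ) / 2 - 1) =
      4 ^ ((d : ℝ) / 2) / 4 * ‖z‖ ^ (-((d : ℝ) - 2)) := by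
    rw [one_div_div, Real.div_rpow (by norm_num) (by positivity), Real.rpow_sub_one (by norm_num),
      ← Real.rpow_natCast, ← Real.rpow_mul hr.le, Real.rpow_neg hr.le, div_eq_mul_inv _ (‖z‖ ^ _)]
    congr 3
    push_cast; ring
  have e4 : (4 * Real.pi) ^ (-((d : ℝ) / 2)) = (4 ^ ((d : ℝ) / 2))⁻¹ * (Real.pi ^ ((d : ℝ) / 2))⁻¹ := by
    rw [Real.mul_rpow (by norm_num) hpi.le, Real.rpow_neg (by norm_num), Real.rpow_neg hpi.le]
  rw [e3, e4, hG]
  have h2 : (d : ℝ) - 2 ≠ 0 := by linarith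
  have h3 : (4 : ℝ) ^ ((d : ℝ) / 2) ≠ 0 := by positivity
  have h4 : Real.pi ^ ((d : ℝ) / 2) ≠ 0 := by positivity
  field_simp
  norm_num

lemma heatKernel_le {t : ℝ} (ht : 0 ≤ t) (z : Space d) :
    heatKernel t z ≤ (4 * Real.pi * t) ^ (-((d : ℝ) / 2)) := by
  rw [heatKernel]
  refine mul_le_of_le_one_right (by positivity) (Real.exp_le_one_iff.2 ?_)
  have : 0 ≤ ‖z‖ ^ 2 / (4 * t) := by positivity
  linarith

lemma measurable_heatKernel : Measurable fun p : ℝ × Space d => heatKernel p.1 p.2 := by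
  unfold heatKernel; fun_prop

lemma integrable_heatKernel_mul {t : ℝ} (ht : 0 < t) (f : L1 d) (x : Space d) :
    Integrable fun y => heatKernel t (x - y) * f y := by
  refine (L1.integrable_coeFn f).bdd_mul (c := (4 * Real.pi * t) ^ (-((d : ℝ) / 2)))
    ((continuous_heatKernel t).comp (by fun_prop)).aestronglyMeasurable
    (Eventually.of_forall fun y => ?_)
  rw [Real.norm_of_nonneg (heatKernel_nonneg ht.le _)]
  exact heatKernel_le ht.le _

/-- For `t ≤ 1` the essential bound on `f` is used with unit mass of the kernel; for `t > 1` the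
kernel is at most a constant times `t^{-d/2}`, which is integrable at infinity since `d > 2`. -/
lemma integrable_prod_heatKernel_mul (hd : 3 ≤ d) (hm : (d : ℝ) / 2 < m) {f : L1 d}
    (hf : sobolevNorm m f < ∞) (x : Space d) :
    Integrable (fun p : ℝ × Space d => heatKernel p.1 (x - p.2) * f p.2)
      ((volume.restrict (Ioi (0 : ℝ))).prod volume) := by
  have hd' : (3 : ℝ) ≤ d := by exact_mod_cast hd
  have hmeas : Measurable (fun p : ℝ × Space d => heatKernel p.1 (x - p.2) * f p.2) :=
    (measurable_heatKernel.comp (by fun_prop : Measurable fun p : ℝ × Space d => (p.1, x - p.2))).mul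
      ((Lp.stronglyMeasurable f).measurable.comp measurable_snd)
  rw [integrable_prod_iff hmeas.aestronglyMeasurable]
  have hint : ∀ t : ℝ, 0 < t → Integrable fun y => heatKernel t (x - y) * f y := fun t ht =>
    integrable_heatKernel_mul ht f x
  refine ⟨(ae_restrict_mem measurableSet_Ioi).mono fun t ht => hint t ht, ?_⟩
  have hm' : StronglyMeasurable fun t => ∫ y, ‖heatKernel t (x - y) * f y‖ :=
    hmeas.norm.stronglyMeasurable.integral_prod_right'
  have hnorm : ∀ t, 0 < t → ∀ y, ‖heatKernel t (x - y) * f y‖ = heatKernel t (x - y) * |f y| :=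
    fun t ht y => by
      rw [norm_mul, Real.norm_of_nonneg (heatKernel_nonneg ht.le _), Real.norm_eq_abs]
  have hnn : ∀ t, ‖∫ y, ‖heatKernel t (x - y) * f y‖‖ = ∫ y, ‖heatKernel t (x - y) * f y‖ :=
    fun t => Real.norm_of_nonneg (integral_nonneg fun _ => norm_nonneg _)
  change IntegrableOn (fun t => ∫ y, ‖heatKernel t (x - y) * f y‖) (Ioi 0)
  rw [← Ioc_union_Ioi_eq_Ioi (zero_le_one (α := ℝ))]
  refine IntegrableOn.union ?_ ?_
  · refine Integrable.mono' (g := fun _ => ∫ ξ, ‖fhat f ξ‖) (integrable_const _)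
      hm'.aestronglyMeasurable ?_
    filter_upwards [ae_restrict_mem measurableSet_Ioc] with t ht
    rw [hnn]
    have h1 : ∫ y, heatKernel t (x - y) * ∫ ξ, ‖fhat f ξ‖ = ∫ ξ, ‖fhat f ξ‖ := by
      rw [integral_mul_const, integral_sub_left_eq_self (fun y => heatKernel t y),
        integral_heatKernel ht.1, one_mul]
    rw [← h1]
    refine integral_mono_ae (hint t ht.1).norm (((integrable_heatKernel ht.1).comp_sub_left x).mul_const _) ?_
    filter_upwards [ae_abs_le hm hf] with y hy
    simp only [hnorm t ht.1]
    exact mul_le_mul_of_nonneg_left hy (heatKernel_nonneg ht.1.le _)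
  · refine Integrable.mono' (g := fun t => (4 * Real.pi) ^ (-((d : ℝ) / 2)) * ‖f‖ * t ^ (-((d : ℝ) / 2)))
      ((integrableOn_Ioi_rpow_of_lt (by linarith) one_pos).const_mul _)
      hm'.aestronglyMeasurable ?_
    filter_upwards [ae_restrict_mem measurableSet_Ioi] with t ht
    have ht0 : 0 < t := one_pos.trans ht
    rw [hnn]
    have h1 : ∫ y, (4 * Real.pi * t) ^ (-((d : ℝ) / 2)) * ‖f y‖ =
        (4 * Real.pi) ^ (-((d : ℝ) / 2)) * ‖f‖ * t ^ (-((d : ℝ) / 2)) := by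
      rw [integral_const_mul, ← L1.norm_eq_integral_norm, Real.mul_rpow (by positivity) ht0.le]
      ring
    rw [← h1]
    refine integral_mono_ae (hint t ht0).norm ((L1.integrable_coeFn f).norm.const_mul _)
      (Eventually.of_forall fun y => ?_)
    simp only [hnorm t ht0, Real.norm_eq_abs]
    exact mul_le_mul_of_nonneg_right (heatKernel_le ht0.le _) (abs_nonneg _)

lemma potential_eq_integral_heat (hd : 3 ≤ d) (hm : (d : ℝ) / 2 < m) {f : L1 d}
    (hf : sobolevNorm m f < ∞) (x : Space d) :
    potential f x = ∫ t in Ioi (0 : ℝ), heat t f x := by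
  have : Nontrivial (Space d) :=
    Module.nontrivial_of_finrank_pos (R := ℝ) (by rw [finrank_euclideanSpace, Fintype.card_fin]; omega)
  have h1 : ∫ t in Ioi (0 : ℝ), heat t f x =
      ∫ t in Ioi (0 : ℝ), ∫ y, heatKernel t (x - y) * f y :=
    setIntegral_congr_fun measurableSet_Ioi fun t ht => by
      rw [heat, if_neg (ne_of_gt ht)]
  rw [h1, integral_integral_swap (integrable_prod_heatKernel_mul hd hm hf x), potential]
  refine integral_congr_ae ?_
  have hne : ∀ᵐ y : Space d, y ≠ x := by simp [ae_iff, measure_singleton]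
  filter_upwards [hne] with y hy
  rw [integral_mul_const, integral_heatKernel_time hd (sub_ne_zero.2 hy.symm)]

/-- The Fourier transform of the potential. -/
def potSymbol (f : L1 d) (ξ : Space d) : ℂ := ((4 * Real.pi ^ 2 * ‖ξ‖ ^ 2)⁻¹ : ℝ) * fhat f ξ

lemma measurable_potSymbol (f : L1 d) : Measurable (potSymbol f) := by
  have := (continuous_fhat f).measurable
  unfold potSymbol
  fun_prop

lemma norm_potSymbol (f : L1 d) (ξ : Space d) :
    ‖potSymbol f ξ‖ = (4 * Real.pi ^ 2)⁻¹ * (‖ξ‖ ^ (-2 : ℝ) * ‖fhat f ξ‖) := by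
  rw [potSymbol, norm_mul, Complex.norm_real, Real.norm_of_nonneg (by positivity), mul_inv,
    Real.rpow_neg (norm_nonneg _), Real.rpow_two, mul_assoc]

lemma integrable_potSymbol (hd : 3 ≤ d) (hm : (d : ℝ) / 2 < m) {f : L1 d}
    (hf : sobolevNorm m f < ∞) : Integrable (potSymbol f) := by
  have hd' : (3 : ℝ) ≤ d := by exact_mod_cast hd
  have h := (integrable_rpow_mul_fhat (by omega) hm hf (s := 2) (by norm_num)
    (by linarith)).const_mul (4 * Real.pi ^ 2)⁻¹
  rw [← integrable_norm_iff (measurable_potSymbol f).aestronglyMeasurable]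
  exact h.congr (Eventually.of_forall fun ξ => (norm_potSymbol f ξ).symm)

/-- Integrating the multiplier `exp(-4π²|ξ|² t)` over all times gives `(4π²|ξ|²)⁻¹`. Fubini is
justified by integrability of the resulting symbol; the argument `-x` turns the transform into its
inverse. -/
lemma ofReal_potential (hd : 3 ≤ d) (hm : (d : ℝ) / 2 < m) {f : L1 d}
    (hf : sobolevNorm m f < ∞) (x : Space d) :
    ((potential f x : ℝ) : ℂ) = FourierTransform.fourier (potSymbol f) (-x) := by
  have : Nontrivial (Space d) :=
    Module.nontrivial_of_finrank_pos (R := ℝ) (by rw [finrank_euclideanSpace, Fintype.card_fin]; omega)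
  set H : ℝ × Space d → ℂ := fun p => (Real.fourierChar (inner ℝ x p.2) : ℂ) *
    ((Real.exp (-(4 * Real.pi ^ 2 * p.1) * ‖p.2‖ ^ 2) : ℝ) * fhat f p.2) with hH
  have hne : ∀ᵐ ξ : Space d, ξ ≠ 0 := by simp [ae_iff, measure_singleton]
  have hexp : ∀ (t : ℝ) (ξ : Space d), -(4 * Real.pi ^ 2 * t) * ‖ξ‖ ^ 2 =
      -(4 * Real.pi ^ 2 * ‖ξ‖ ^ 2) * t := fun t ξ => by ring
  have hHn : ∀ t ξ, ‖H (t, ξ)‖ = Real.exp (-(4 * Real.pi ^ 2 * ‖ξ‖ ^ 2) * t) * ‖fhat f ξ‖ := by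
    intro t ξ
    simp only [hH]
    rw [norm_mul, norm_mul, Circle.norm_coe, one_mul, Complex.norm_real,
      Real.norm_of_nonneg (Real.exp_nonneg _), hexp]
  have hneg : ∀ ξ : Space d, ξ ≠ 0 → -(4 * Real.pi ^ 2 * ‖ξ‖ ^ 2) < 0 := fun ξ hξ => by
    have := norm_pos_iff.2 hξ
    have := Real.pi_pos
    have : 0 < 4 * Real.pi ^ 2 * ‖ξ‖ ^ 2 := by positivity
    linarith
  have htime : ∀ ξ : Space d, ξ ≠ 0 →
      ∫ t in Ioi (0 : ℝ), Real.exp (-(4 * Real.pi ^ 2 * ‖ξ‖ ^ 2) * t) =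
        (4 * Real.pi ^ 2 * ‖ξ‖ ^ 2)⁻¹ := fun ξ hξ => by
    rw [integral_exp_mul_Ioi (hneg ξ hξ), mul_zero, Real.exp_zero, neg_div_neg_eq, one_div]
  have hHm : Measurable H := by
    have h1 := (continuous_fhat f).measurable
    have h2 : Continuous fun s : ℝ => (Real.fourierChar s : ℂ) :=
      continuous_subtype_val.comp Real.continuous_fourierChar
    refine ((h2.comp (continuous_const.inner continuous_snd)).measurable).mul
      (Measurable.mul (by fun_prop) (h1.comp measurable_snd))
  have hHi : Integrable H ((volume.restrict (Ioi (0 : ℝ))).prod volume) := by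
    rw [integrable_prod_iff' hHm.aestronglyMeasurable]
    refine ⟨?_, ?_⟩
    · filter_upwards [hne] with ξ hξ
      have hs : Measurable fun t => H (t, ξ) := hHm.comp (measurable_id.prodMk measurable_const)
      rw [← integrable_norm_iff hs.aestronglyMeasurable]
      simp only [hHn]
      exact (integrableOn_exp_mul_Ioi (hneg ξ hξ) 0).mul_const _
    · refine (integrable_potSymbol hd hm hf).norm.congr ?_
      filter_upwards [hne] with ξ hξ
      simp only [hHn]
      rw [integral_mul_const, htime ξ hξ, potSymbol, norm_mul, Complex.norm_real,
        Real.norm_of_nonneg (by positivity)]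
  rw [potential_eq_integral_heat hd hm hf, ← integral_complex_ofReal]
  rw [setIntegral_congr_fun (g := fun t => ∫ ξ, H (t, ξ)) measurableSet_Ioi
    fun t ht => ofReal_heat ht f x]
  rw [integral_integral_swap hHi, Real.fourier_eq]
  refine integral_congr_ae ?_
  filter_upwards [hne] with ξ hξ
  simp only [hH, hexp]
  rw [integral_const_mul, integral_mul_const, integral_complex_ofReal, htime ξ hξ, inner_neg_right,
    neg_neg, real_inner_comm]
  rfl

/-! ### The gradient of the potential -/

/-- The Fourier transform of `∂_j (g * f)`. -/
def gradSymbol (j : Fin d) (f : L1 d) (ξ : Space d) : ℂ :=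
  2 * Real.pi * Complex.I * ((ξ j : ℝ) : ℂ) * potSymbol f ξ

lemma measurable_gradSymbol (j : Fin d) (f : L1 d) : Measurable (gradSymbol j f) := by
  have := measurable_potSymbol f
  unfold gradSymbol
  fun_prop

lemma gradSymbol_sub (j : Fin d) (f g : L1 d) (ξ : Space d) :
    gradSymbol j (f - g) ξ = gradSymbol j f ξ - gradSymbol j g ξ := by
  rw [gradSymbol, gradSymbol, gradSymbol, potSymbol, fhat_sub, potSymbol, potSymbol]
  ring

lemma norm_gradSymbol_le (j : Fin d) (f : L1 d) (ξ : Space d) :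
    ‖gradSymbol j f ξ‖ ≤ ‖ξ‖ ^ (-1 : ℝ) * ‖fhat f ξ‖ := by
  have h1 : |ξ j| ≤ ‖ξ‖ := by simpa using PiLp.norm_apply_le ξ j
  rw [gradSymbol, norm_mul, norm_potSymbol]
  have h2 : ‖2 * (Real.pi : ℂ) * Complex.I * ((ξ j : ℝ) : ℂ)‖ = 2 * Real.pi * |ξ j| := by
    simp [abs_of_pos Real.pi_pos]
  rw [h2]
  have hpi := Real.pi_pos
  have hpi3 := Real.pi_gt_three
  rcases eq_or_ne ξ 0 with rfl | hξ
  · simp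
  have hr : 0 < ‖ξ‖ := norm_pos_iff.2 hξ
  have h3 : ‖ξ‖ ^ (-1 : ℝ) = ‖ξ‖ * ‖ξ‖ ^ (-2 : ℝ) := by
    conv_rhs => rw [← Real.rpow_one ‖ξ‖, Real.rpow_one ‖ξ‖]
    rw [Real.rpow_neg hr.le, Real.rpow_neg hr.le, Real.rpow_one, Real.rpow_two]
    field_simp
  rw [h3]
  have h4 : 2 * Real.pi * |ξ j| * (4 * Real.pi ^ 2)⁻¹ ≤ ‖ξ‖ := by
    have : 2 * Real.pi * |ξ j| * (4 * Real.pi ^ 2)⁻¹ = |ξ j| * (2 * Real.pi)⁻¹ := by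
      field_simp; ring
    rw [this]
    have h5 : (2 * Real.pi)⁻¹ ≤ 1 := inv_le_one_of_one_le₀ (by linarith)
    calc |ξ j| * (2 * Real.pi)⁻¹ ≤ ‖ξ‖ * 1 := by gcongr
      _ = ‖ξ‖ := mul_one _
  calc _ = (2 * Real.pi * |ξ j| * (4 * Real.pi ^ 2)⁻¹) * (‖ξ‖ ^ (-2 : ℝ) * ‖fhat f ξ‖) := by ring
    _ ≤ ‖ξ‖ * (‖ξ‖ ^ (-2 : ℝ) * ‖fhat f ξ‖) := by gcongr
    _ = _ := by ring

lemma integrable_gradSymbol (hd : 3 ≤ d) (hm : (d : ℝ) / 2 < m) (j : Fin d) {f : L1 d}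
    (hf : sobolevNorm m f < ∞) : Integrable (gradSymbol j f) := by
  have hd' : (3 : ℝ) ≤ d := by exact_mod_cast hd
  exact (integrable_rpow_mul_fhat (by omega) hm hf (s := 1) (by norm_num)
    (by linarith)).mono' (measurable_gradSymbol j f).aestronglyMeasurable
    (Eventually.of_forall fun ξ => norm_gradSymbol_le j f ξ)

/-- Differentiation under the Fourier integral, permitted because `|ξ|` times the symbol of the
potential is still integrable. -/
lemma ofReal_gradient_potential (hd : 3 ≤ d) (hm : (d : ℝ) / 2 < m) (j : Fin d) {f : L1 d}
    (hf : sobolevNorm m f < ∞) (x : Space d) :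
    ((gradient (potential f) x j : ℝ) : ℂ) = FourierTransform.fourier (gradSymbol j f) (-x) := by
  have hd' : (3 : ℝ) ≤ d := by exact_mod_cast hd
  have hi := integrable_potSymbol hd hm hf
  have hi1 : Integrable fun ξ => ‖ξ‖ * ‖potSymbol f ξ‖ := by
    have h := (integrable_rpow_mul_fhat (by omega) hm hf (s := 1) (by norm_num)
      (by linarith)).const_mul (4 * Real.pi ^ 2)⁻¹
    refine h.congr (Eventually.of_forall fun ξ => ?_)
    simp only [norm_potSymbol]
    rcases eq_or_ne ξ 0 with rfl | hξ
    · simp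
    have hr : 0 < ‖ξ‖ := norm_pos_iff.2 hξ
    rw [Real.rpow_neg hr.le, Real.rpow_neg hr.le, Real.rpow_one, Real.rpow_two]
    field_simp
  set D := FourierTransform.fourier (VectorFourier.fourierSMulRight (innerSL ℝ) (potSymbol f)) (-x)
    with hD
  have h1 : HasFDerivAt (FourierTransform.fourier (potSymbol f)) D (-x) :=
    Real.hasFDerivAt_fourier hi hi1 (-x)
  have h2 : HasFDerivAt (fun y => ((potential f y : ℝ) : ℂ)) (-D) x := by
    have h3 := h1.comp x (hasFDerivAt_id x).neg
    have h4 : (fun y => ((potential f y : ℝ) : ℂ)) =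
        FourierTransform.fourier (potSymbol f) ∘ fun y => -id y :=
      funext fun y => ofReal_potential hd hm hf y
    rw [h4]
    refine h3.congr_fderiv (ContinuousLinearMap.ext fun v => ?_)
    simp
  have h5 : HasFDerivAt (potential f) (Complex.reCLM.comp (-D)) x :=
    (Complex.reCLM.hasFDerivAt.comp x h2).congr_fderiv rfl
  have h6 : HasFDerivAt (fun y => ((potential f y : ℝ) : ℂ))
      (Complex.ofRealCLM.comp (Complex.reCLM.comp (-D))) x :=
    Complex.ofRealCLM.hasFDerivAt.comp x h5
  -- The complexified potential is real valued, so by uniqueness its derivative equals its own real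
  -- part.
  have h7 := h6.unique h2
  set e : Space d := EuclideanSpace.single j 1
  have h8 : gradient (potential f) x j = Complex.reCLM.comp (-D) e := by
    rw [gradient, h5.fderiv, ← InnerProductSpace.toDual_symm_apply, EuclideanSpace.inner_single_right,
      one_mul]
    rfl
  rw [h8]
  have h9 : ((Complex.reCLM.comp (-D) e : ℝ) : ℂ) = -D e := by
    have := congrArg (fun A : Space d →L[ℝ] ℂ => A e) h7
    exact this
  rw [h9, hD, Real.fourier_eq, Real.fourier_eq]
  have hint : Integrable fun v => Real.fourierChar (-inner ℝ v (-x)) •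
      VectorFourier.fourierSMulRight (innerSL ℝ) (potSymbol f) v := by
    refine (Real.fourierIntegral_convergent_iff (-x)).2 ?_
    have := VectorFourier.norm_fourierSMulRight_le (innerSL ℝ) (potSymbol f)
    refine (hi1.const_mul (2 * Real.pi * ‖innerSL ℝ (E := Space d)‖)).mono'
      (measurable_potSymbol f).aestronglyMeasurable.fourierSMulRight
      (Eventually.of_forall fun ξ => ?_)
    rw [← mul_assoc]
    exact this ξ
  rw [ContinuousLinearMap.integral_apply hint, ← integral_neg]
  refine integral_congr_ae (Eventually.of_forall fun ξ => ?_)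
  change -(Real.fourierChar (-inner ℝ ξ (-x)) • (VectorFourier.fourierSMulRight (innerSL ℝ) (potSymbol f) ξ e)) = _
  rw [← smul_neg]
  congr 1
  rw [VectorFourier.fourierSMulRight_apply, innerSL_apply_apply]
  have : inner ℝ ξ e = ξ j := by simp [e, EuclideanSpace.inner_single_right]
  rw [this, gradSymbol, smul_eq_mul, Complex.real_smul]
  ring

/-! ### The product `f ∂_j (g * h)` in `L¹ ∩ H^m` -/

/-- The larger of `|ξ - η|` and `|η|`, called `r`, satisfies `1 + |ξ|² ≤ 4 (1 + r²)`. This lets the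
weight fall on one factor of a product at a time. -/
lemma bracket_le (hm : 0 ≤ m) (ξ η : Space d) :
    bracket m ξ ≤ 4 ^ (m / 2) * (bracket m (ξ - η) + bracket m η) := by
  have h0 : ‖ξ‖ ^ 2 ≤ 2 * ‖ξ - η‖ ^ 2 + 2 * ‖η‖ ^ 2 := by
    have h1 : ‖ξ‖ ≤ ‖ξ - η‖ + ‖η‖ := by simpa using norm_add_le (ξ - η) η
    nlinarith [sq_nonneg (‖ξ - η‖ - ‖η‖), norm_nonneg ξ, norm_nonneg (ξ - η), norm_nonneg η]
  have key : ∀ A : ℝ, 0 ≤ A → 1 + ‖ξ‖ ^ 2 ≤ 4 * A → bracket m ξ ≤ 4 ^ (m / 2) * A ^ (m / 2) := by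
    intro A hA h
    rw [bracket, ← Real.mul_rpow (by norm_num) hA]
    exact Real.rpow_le_rpow (by positivity) h (by positivity)
  have p1 := bracket_pos m (ξ - η)
  have p2 := bracket_pos m η
  have p3 : (0 : ℝ) < 4 ^ (m / 2) := by positivity
  rcases le_total ‖η‖ ‖ξ - η‖ with h | h
  · have h2 : ‖η‖ ^ 2 ≤ ‖ξ - η‖ ^ 2 := by gcongr
    have := key (1 + ‖ξ - η‖ ^ 2) (by positivity) (by nlinarith)
    change _ ≤ 4 ^ (m / 2) * bracket m (ξ - η) at this
    nlinarith
  · have h2 : ‖ξ - η‖ ^ 2 ≤ ‖η‖ ^ 2 := by gcongr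
    have := key (1 + ‖η‖ ^ 2) (by positivity) (by nlinarith)
    change _ ≤ 4 ^ (m / 2) * bracket m η at this
    nlinarith

lemma gradient_potential_eq_re (hd : 3 ≤ d) (hm : (d : ℝ) / 2 < m) (j : Fin d) {g : L1 d}
    (hg : sobolevNorm m g < ∞) (x : Space d) :
    gradient (potential g) x j = (FourierTransform.fourier (gradSymbol j g) (-x)).re := by
  rw [← ofReal_gradient_potential hd hm j hg x, Complex.ofReal_re]

lemma continuous_gradient_potential (hd : 3 ≤ d) (hm : (d : ℝ) / 2 < m) (j : Fin d) {g : L1 d}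
    (hg : sobolevNorm m g < ∞) : Continuous fun x => gradient (potential g) x j := by
  simp only [gradient_potential_eq_re hd hm j hg]
  have : Continuous (FourierTransform.fourier (gradSymbol j g)) :=
    VectorFourier.fourierIntegral_continuous Real.continuous_fourierChar
      (by simpa using (continuous_inner (𝕜 := ℝ) (E := Space d))) (integrable_gradSymbol hd hm j hg)
  exact Complex.continuous_re.comp (this.comp continuous_neg)

lemma abs_gradient_potential_le (hd : 3 ≤ d) (hm : (d : ℝ) / 2 < m) (j : Fin d) {g : L1 d}
    (hg : sobolevNorm m g < ∞) (x : Space d) :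
    |gradient (potential g) x j| ≤ ∫ ξ, ‖gradSymbol j g ξ‖ := by
  rw [← Real.norm_eq_abs, ← Complex.norm_real, ofReal_gradient_potential hd hm j hg x]
  exact VectorFourier.norm_fourierIntegral_le_integral_norm _ _ _ _ _

lemma gradient_potential_sub (hd : 3 ≤ d) (hm : (d : ℝ) / 2 < m) (j : Fin d) {g h : L1 d}
    (hg : sobolevNorm m g < ∞) (hh : sobolevNorm m h < ∞) (hgh : sobolevNorm m (g - h : L1 d) < ∞)
    (x : Space d) : gradient (potential (g - h : L1 d)) x j =
      gradient (potential g) x j - gradient (potential h) x j := by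
  rw [gradient_potential_eq_re hd hm j hg, gradient_potential_eq_re hd hm j hh,
    gradient_potential_eq_re hd hm j hgh, ← Complex.sub_re]
  congr 1
  rw [Real.fourier_eq, Real.fourier_eq, Real.fourier_eq, ← integral_sub
    ((Real.fourierIntegral_convergent_iff (-x)).2 (integrable_gradSymbol hd hm j hg))
    ((Real.fourierIntegral_convergent_iff (-x)).2 (integrable_gradSymbol hd hm j hh))]
  refine integral_congr_ae (Eventually.of_forall fun ξ => ?_)
  beta_reduce
  rw [gradSymbol_sub, smul_sub]

lemma integrable_mul_gradient_potential (hd : 3 ≤ d) (hm : (d : ℝ) / 2 < m) (j : Fin d) (f : L1 d)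
    {g : L1 d} (hg : sobolevNorm m g < ∞) :
    Integrable fun x => f x * gradient (potential g) x j :=
  (L1.integrable_coeFn f).mul_bdd (c := ∫ ξ, ‖gradSymbol j g ξ‖)
    (continuous_gradient_potential hd hm j hg).aestronglyMeasurable
    (Eventually.of_forall fun x => abs_gradient_potential_le hd hm j hg x)

/-- The product `f ∂_j (g * h)` as an element of `L¹`. -/
def prodL1 (hd : 3 ≤ d) (hm : (d : ℝ) / 2 < m) (j : Fin d) (f : L1 d)
    {g : L1 d} (hg : sobolevNorm m g < ∞) : L1 d :=
  (integrable_mul_gradient_potential hd hm j f hg).toL1 _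

lemma prodL1_ae (hd : 3 ≤ d) (hm : (d : ℝ) / 2 < m) (j : Fin d) (f : L1 d)
    {g : L1 d} (hg : sobolevNorm m g < ∞) :
    prodL1 hd hm j f hg =ᵐ[volume] fun x => f x * gradient (potential g) x j :=
  Integrable.coeFn_toL1 _

lemma norm_prodL1_le (hd : 3 ≤ d) (hm : (d : ℝ) / 2 < m) (j : Fin d) (f : L1 d)
    {g : L1 d} (hg : sobolevNorm m g < ∞) :
    ‖prodL1 hd hm j f hg‖ ≤ ‖f‖ * ∫ ξ, ‖gradSymbol j g ξ‖ := by
  rw [L1.norm_eq_integral_norm, L1.norm_eq_integral_norm, ← integral_mul_const]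
  refine integral_mono_ae (L1.integrable_coeFn _).norm
    ((L1.integrable_coeFn f).norm.mul_const _) ?_
  filter_upwards [prodL1_ae hd hm j f hg] with x hx
  rw [hx, norm_mul]
  exact mul_le_mul_of_nonneg_left (abs_gradient_potential_le hd hm j hg x) (norm_nonneg _)

/-- Write the gradient as a Fourier integral of its integrable symbol and exchange the integrals. -/
lemma fhat_prodL1 (hd : 3 ≤ d) (hm : (d : ℝ) / 2 < m) (j : Fin d) (f : L1 d)
    {g : L1 d} (hg : sobolevNorm m g < ∞) (ξ : Space d) :
    fhat (prodL1 hd hm j f hg) ξ = ∫ η, fhat f (ξ - η) * gradSymbol j g η := by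
  have hV := integrable_gradSymbol hd hm j hg
  have hchar : Continuous fun s : ℝ => (Real.fourierChar s : ℂ) :=
    continuous_subtype_val.comp Real.continuous_fourierChar
  set H : Space d × Space d → ℂ := fun p => (Real.fourierChar (-inner ℝ p.1 (ξ - p.2)) : ℂ) *
    ((f p.1 : ℂ) * gradSymbol j g p.2) with hH
  have hHi : Integrable H (volume.prod volume) := by
    refine ((integrable_ofReal f).mul_prod hV).bdd_mul (c := 1) ?_
      (Eventually.of_forall fun p => by rw [Circle.norm_coe])
    exact (hchar.comp (by fun_prop)).aestronglyMeasurable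
  have h1 : fhat (prodL1 hd hm j f hg) ξ = ∫ x, ∫ η, H (x, η) := by
    rw [fhat_apply]
    refine integral_congr_ae ?_
    filter_upwards [prodL1_ae hd hm j f hg] with x hx
    rw [hx, Complex.ofReal_mul, ofReal_gradient_potential hd hm j hg, Real.fourier_eq, ← mul_assoc,
      ← integral_const_mul]
    refine integral_congr_ae (Eventually.of_forall fun η => ?_)
    simp only [hH]
    rw [Circle.smul_def, smul_eq_mul,
      show -inner ℝ x (ξ - η) = -inner ℝ x ξ + -inner ℝ η (-x) by
        rw [inner_sub_right, inner_neg_right, real_inner_comm x η]; ring,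
      AddChar.map_add_eq_mul, Circle.coe_mul]
    ring
  rw [h1, integral_integral_swap (f := fun x η => H (x, η)) hHi]
  refine integral_congr_ae (Eventually.of_forall fun η => ?_)
  beta_reduce
  rw [fhat_apply, ← integral_mul_const]
  refine integral_congr_ae (Eventually.of_forall fun x => ?_)
  simp only [hH]
  ring

/-- A Leibniz-type bound: after `bracket_le`, Young's inequality puts the weighted factor in `L²`
and the other in `L¹`. -/
lemma sobolevNorm_prodL1_le (hd : 3 ≤ d) (hm : (d : ℝ) / 2 < m) (j : Fin d) (f : L1 d)
    {g : L1 d} (hg : sobolevNorm m g < ∞) :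
    sobolevNorm m (prodL1 hd hm j f hg) ≤ ENNReal.ofReal (4 ^ (m / 2)) *
      (sobolevNorm m f * eLpNorm (gradSymbol j g) 1 volume +
        eLpNorm (fun ξ => (bracket m ξ : ℂ) * gradSymbol j g ξ) 2 volume *
          eLpNorm (fhat f) 1 volume) := by
  have hm0 : 0 ≤ m := le_trans (by positivity) hm.le
  have hbm : Measurable fun ξ : Space d => (bracket m ξ : ℂ) :=
    (Complex.continuous_ofReal.comp (continuous_bracket m)).measurable
  set a : Space d → ℝ≥0∞ := fun ξ => ‖(bracket m ξ : ℂ) * fhat f ξ‖ₑ with ha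
  set b : Space d → ℝ≥0∞ := fun ξ => ‖gradSymbol j g ξ‖ₑ with hb
  set a' : Space d → ℝ≥0∞ := fun ξ => ‖fhat f ξ‖ₑ with ha'
  set b' : Space d → ℝ≥0∞ := fun ξ => ‖(bracket m ξ : ℂ) * gradSymbol j g ξ‖ₑ with hb'
  have ham : Measurable a := (hbm.mul (continuous_fhat f).measurable).enorm
  have hbm' : Measurable b := (measurable_gradSymbol j g).enorm
  have ham' : Measurable a' := (continuous_fhat f).measurable.enorm
  have hbm'' : Measurable b' := (hbm.mul (measurable_gradSymbol j g)).enorm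
  set c := ENNReal.ofReal (4 ^ (m / 2)) with hc
  have hpt : ∀ ξ, ‖(bracket m ξ : ℂ) * fhat (prodL1 hd hm j f hg) ξ‖ₑ ≤
      ‖c * ((∫⁻ η, a (ξ - η) * b η) + ∫⁻ η, b' (ξ - η) * a' η)‖ₑ := by
    intro ξ
    rw [enorm_eq_self, fhat_prodL1, ← integral_const_mul]
    refine (enorm_integral_le_lintegral_enorm _).trans ?_
    -- The second convolution is reflected because `eLpNorm_lconvolution_le` wants its `L²` factor
    -- at `ξ - η`.
    have h2 : ∫⁻ η, b' (ξ - η) * a' η = ∫⁻ η, b' η * a' (ξ - η) := by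
      rw [← lintegral_sub_left_eq_self (fun η => b' η * a' (ξ - η)) ξ]
      simp only [sub_sub_cancel]
    rw [h2, ← lintegral_add_left (by fun_prop), ← lintegral_const_mul _ (by fun_prop)]
    refine lintegral_mono fun η => ?_
    have h3 : ‖(bracket m ξ : ℂ)‖ₑ ≤ c * (‖(bracket m (ξ - η) : ℂ)‖ₑ + ‖(bracket m η : ℂ)‖ₑ) := by
      have e : ∀ ζ : Space d, ‖(bracket m ζ : ℂ)‖ₑ = ENNReal.ofReal (bracket m ζ) := fun ζ => by
        rw [← ofReal_norm, Complex.norm_real, Real.norm_of_nonneg (bracket_pos m ζ).le]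
      rw [e, e, e, hc, ← ENNReal.ofReal_add (bracket_pos _ _).le (bracket_pos _ _).le,
        ← ENNReal.ofReal_mul (by positivity)]
      exact ENNReal.ofReal_le_ofReal (bracket_le hm0 ξ η)
    simp only [ha, hb, ha', hb', enorm_mul]
    calc _ ≤ c * (‖(bracket m (ξ - η) : ℂ)‖ₑ + ‖(bracket m η : ℂ)‖ₑ) *
          (‖fhat f (ξ - η)‖ₑ * ‖gradSymbol j g η‖ₑ) := by gcongr
      _ = _ := by ring
  rw [sobolevNorm_eq]
  refine (eLpNorm_mono_enorm hpt).trans ?_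
  have hsm : ∀ F : Space d → ℝ≥0∞, Measurable F →
      eLpNorm (fun ξ => c * F ξ) 2 volume = c * eLpNorm F 2 volume := by
    intro F hF
    rw [eLpNorm_eq_lintegral_rpow_enorm_toReal (by norm_num) (by norm_num),
      eLpNorm_eq_lintegral_rpow_enorm_toReal (by norm_num) (by norm_num)]
    simp only [enorm_eq_self, ENNReal.toReal_ofNat]
    simp only [ENNReal.mul_rpow_of_nonneg _ _ (zero_le_two (α := ℝ))]
    rw [lintegral_const_mul _ (hF.pow_const _), ENNReal.mul_rpow_of_nonneg _ _ (by norm_num),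
      ← ENNReal.rpow_mul]
    norm_num
  have m1 : Measurable fun ξ => ∫⁻ η, a (ξ - η) * b η :=
    Measurable.lintegral_prod_right' (f := fun p : Space d × Space d => a (p.1 - p.2) * b p.2)
      (by fun_prop)
  have m2 : Measurable fun ξ => ∫⁻ η, b' (ξ - η) * a' η :=
    Measurable.lintegral_prod_right' (f := fun p : Space d × Space d => b' (p.1 - p.2) * a' p.2)
      (by fun_prop)
  refine (hsm _ (m1.add m2)).trans_le ?_
  gcongr
  refine (eLpNorm_add_le m1.aestronglyMeasurable m2.aestronglyMeasurable one_le_two).trans ?_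
  have e1 : ∀ (F : Space d → ℂ) (p : ℝ≥0∞), eLpNorm (fun ξ => ‖F ξ‖ₑ) p volume = eLpNorm F p volume :=
    fun F p => eLpNorm_congr_enorm_ae (Eventually.of_forall fun ξ => enorm_eq_self _)
  refine add_le_add ((eLpNorm_lconvolution_le ham hbm').trans (le_of_eq ?_))
    ((eLpNorm_lconvolution_le hbm'' ham').trans (le_of_eq ?_))
  · rw [e1, e1, sobolevNorm_eq]
  · rw [e1, e1]

/-- Collects the three Fourier norms in the product estimate. The constant is a sum, so that each
bound keeps only the summands it needs. -/
lemma exists_eLpNorm_gradSymbol_le (hd : 3 ≤ d) (hm : (d : ℝ) / 2 < m) :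
    ∃ K : ℝ≥0∞, K ≠ ∞ ∧ ∀ (j : Fin d) (v : SobolevL1 d m),
      eLpNorm (gradSymbol j (toL1 v)) 1 volume ≤ K * ‖v‖ₑ ∧
      eLpNorm (fun ξ => (bracket m ξ : ℂ) * gradSymbol j (toL1 v) ξ) 2 volume ≤ K * ‖v‖ₑ ∧
      eLpNorm (fhat (toL1 v)) 1 volume ≤ K * ‖v‖ₑ := by
  have hd' : (3 : ℝ) ≤ d := by exact_mod_cast hd
  have hm0 : 0 ≤ m := le_trans (by positivity) hm.le
  set I : ℝ≥0∞ → ℝ≥0∞ := fun p =>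
    eLpNorm ((Metric.ball (0 : Space d) 1).indicator fun ξ => ‖ξ‖ ^ (-1 : ℝ)) p volume
  have hI1 : I 1 ≠ ∞ := (memLp_indicator_rpow (by omega) (by simp) (by simp)
    (by simp; linarith)).2.ne
  have hI2 : I 2 ≠ ∞ := (memLp_indicator_rpow (by omega) (by simp) (by simp)
    (by simp; linarith)).2.ne
  set Kf := eLpNorm (bracket (-m) : Space d → ℝ) 2 volume
  have hKf : Kf ≠ ∞ := (memLp_bracket_neg hm).2.ne
  have hn1 : ∀ v : SobolevL1 d m, ‖toL1 v‖ₑ ≤ ‖v‖ₑ := fun v => by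
    rw [enorm_eq v]; exact le_max_left _ _
  have hn2 : ∀ v : SobolevL1 d m, sobolevNorm m (toL1 v) ≤ ‖v‖ₑ := fun v => by
    rw [enorm_eq v]; exact le_max_right _ _
  have hfh : ∀ v : SobolevL1 d m, eLpNorm (fhat (toL1 v)) 1 volume ≤ Kf * ‖v‖ₑ := fun v =>
    (eLpNorm_fhat_le (toL1 v)).trans (by gcongr; exact hn2 v)
  refine ⟨I 1 + Kf + ENNReal.ofReal (2 ^ (m / 2)) * I 2 + 1, by finiteness, fun j v => ⟨?_, ?_, ?_⟩⟩
  · have h := eLpNorm_mul_rpow_mul_fhat_le (w := fun _ => 1) continuous_const (K := 1)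
      (fun _ _ => by simp) (s := 1) zero_le_one (p := 1) le_rfl (toL1 v)
    simp only [one_mul, eLpNorm_norm, ENNReal.ofReal_one] at h
    calc eLpNorm (gradSymbol j (toL1 v)) 1 volume ≤ I 1 * ‖toL1 v‖ₑ + eLpNorm (fhat (toL1 v)) 1 volume :=
          (eLpNorm_mono_real fun ξ => norm_gradSymbol_le j _ ξ).trans h
      _ ≤ I 1 * ‖v‖ₑ + Kf * ‖v‖ₑ := by gcongr; exacts [hn1 v, hfh v]
      _ = (I 1 + Kf) * ‖v‖ₑ := by ring
      _ ≤ _ := mul_le_mul' (by rw [add_assoc (I 1 + Kf)]; exact le_self_add) le_rfl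
  · have h := eLpNorm_mul_rpow_mul_fhat_le (w := bracket m) (continuous_bracket m) (K := 2 ^ (m / 2))
      (fun ξ hξ => by
        rw [abs_of_pos (bracket_pos m ξ), bracket]
        have h1 : ‖ξ‖ < 1 := by simpa using hξ
        have h2 : ‖ξ‖ ^ 2 ≤ 1 := by nlinarith [norm_nonneg ξ]
        exact Real.rpow_le_rpow (by positivity) (by linarith) (by positivity))
      (s := 1) zero_le_one (p := 2) one_le_two (toL1 v)
    have h3 : eLpNorm (fun ξ => bracket m ξ * ‖fhat (toL1 v) ξ‖) 2 volume = sobolevNorm m (toL1 v) := by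
      rw [sobolevNorm_eq]
      refine eLpNorm_congr_norm_ae (Eventually.of_forall fun ξ => ?_)
      rw [norm_mul, norm_mul, norm_norm, Complex.norm_real]
    rw [h3] at h
    calc eLpNorm (fun ξ => (bracket m ξ : ℂ) * gradSymbol j (toL1 v) ξ) 2 volume
        ≤ ENNReal.ofReal (2 ^ (m / 2)) * I 2 * ‖toL1 v‖ₑ + sobolevNorm m (toL1 v) := by
          refine (eLpNorm_mono_real fun ξ => ?_).trans h
          rw [norm_mul, Complex.norm_real, Real.norm_of_nonneg (bracket_pos m ξ).le]
          exact mul_le_mul_of_nonneg_left (norm_gradSymbol_le j _ ξ) (bracket_pos m ξ).le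
      _ ≤ ENNReal.ofReal (2 ^ (m / 2)) * I 2 * ‖v‖ₑ + 1 * ‖v‖ₑ := by
          rw [one_mul]; gcongr; exacts [hn1 v, hn2 v]
      _ = (ENNReal.ofReal (2 ^ (m / 2)) * I 2 + 1) * ‖v‖ₑ := by ring
      _ ≤ _ := mul_le_mul' (by rw [add_assoc (I 1 + Kf)]; exact le_add_self) le_rfl
  · refine (hfh v).trans (mul_le_mul' ?_ le_rfl)
    calc Kf ≤ I 1 + Kf := le_add_self
      _ ≤ _ := by rw [add_assoc (I 1 + Kf)]; exact le_self_add

lemma sobolevNorm_prodL1_lt_top (hd : 3 ≤ d) (hm : (d : ℝ) / 2 < m) (j : Fin d)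
    (u v : SobolevL1 d m) :
    sobolevNorm m (prodL1 hd hm j (toL1 u) (sobolevNorm_toL1_lt_top v)) < ∞ := by
  obtain ⟨K, hK, h⟩ := exists_eLpNorm_gradSymbol_le hd hm
  have hu := sobolevNorm_toL1_lt_top u
  have f1 : ∀ w : SobolevL1 d m, K * ‖w‖ₑ < ∞ := fun w => ENNReal.mul_lt_top hK.lt_top enorm_lt_top
  refine (sobolevNorm_prodL1_le hd hm j (toL1 u) (sobolevNorm_toL1_lt_top v)).trans_lt ?_
  refine ENNReal.mul_lt_top ENNReal.ofReal_lt_top (ENNReal.add_lt_top.2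
    ⟨ENNReal.mul_lt_top hu ((h j v).1.trans_lt (f1 v)),
      ENNReal.mul_lt_top ((h j v).2.1.trans_lt (f1 v)) ((h j u).2.2.trans_lt (f1 u))⟩)

/-- The product `u ∂_j (g * v)` in `L¹ ∩ H^m`. -/
def fluxProd (hd : 3 ≤ d) (hm : (d : ℝ) / 2 < m) (j : Fin d) (u v : SobolevL1 d m) :
    SobolevL1 d m :=
  ofL1 (prodL1 hd hm j (toL1 u) (sobolevNorm_toL1_lt_top v)) (sobolevNorm_prodL1_lt_top hd hm j u v)

lemma toL1_fluxProd_ae (hd : 3 ≤ d) (hm : (d : ℝ) / 2 < m) (j : Fin d) (u v : SobolevL1 d m) :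
    toL1 (fluxProd hd hm j u v) =ᵐ[volume]
      fun x => toL1 u x * gradient (potential (toL1 v)) x j :=
  prodL1_ae hd hm j (toL1 u) (sobolevNorm_toL1_lt_top v)

/-- The central estimate. For the `L¹` part the gradient is bounded pointwise by the `L¹` norm of
its symbol, which gives `K`; the Sobolev part gives `c (K + K²)`. -/
lemma exists_norm_fluxProd_le (hd : 3 ≤ d) (hm : (d : ℝ) / 2 < m) :
    ∃ C : ℝ, 0 ≤ C ∧ ∀ (j : Fin d) (u v : SobolevL1 d m),
      ‖fluxProd hd hm j u v‖ ≤ C * ‖u‖ * ‖v‖ := by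
  obtain ⟨K, hK, h⟩ := exists_eLpNorm_gradSymbol_le hd hm
  set c := ENNReal.ofReal (4 ^ (m / 2))
  have hC : K + c * (K + K * K) ≠ ∞ := by finiteness
  refine ⟨(K + c * (K + K * K)).toReal, ENNReal.toReal_nonneg, fun j u v => ?_⟩
  have key : ‖fluxProd hd hm j u v‖ₑ ≤ (K + c * (K + K * K)) * ‖u‖ₑ * ‖v‖ₑ := by
    have hn1 : ‖toL1 u‖ₑ ≤ ‖u‖ₑ := by rw [enorm_eq u]; exact le_max_left _ _
    have hn2 : sobolevNorm m (toL1 u) ≤ ‖u‖ₑ := by rw [enorm_eq u]; exact le_max_right _ _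
    rw [enorm_eq, fluxProd, toL1_ofL1]
    refine max_le ?_ ?_
    · have h1 := norm_prodL1_le hd hm j (toL1 u) (sobolevNorm_toL1_lt_top v)
      have h2 : ‖prodL1 hd hm j (toL1 u) (sobolevNorm_toL1_lt_top v)‖ₑ ≤
          ‖toL1 u‖ₑ * eLpNorm (gradSymbol j (toL1 v)) 1 volume := by
        rw [eLpNorm_one_eq_lintegral_enorm, ← ofReal_integral_norm_eq_lintegral_enorm
          (integrable_gradSymbol hd hm j (sobolevNorm_toL1_lt_top v)), ← ofReal_norm, ← ofReal_norm,
          ← ENNReal.ofReal_mul (norm_nonneg _)]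
        exact ENNReal.ofReal_le_ofReal h1
      calc _ ≤ ‖u‖ₑ * (K * ‖v‖ₑ) := h2.trans (by gcongr; exact (h j v).1)
        _ = K * ‖u‖ₑ * ‖v‖ₑ := by ring
        _ ≤ _ := by gcongr; exact le_self_add
    · refine (sobolevNorm_prodL1_le hd hm j (toL1 u) (sobolevNorm_toL1_lt_top v)).trans ?_
      calc _ ≤ c * (‖u‖ₑ * (K * ‖v‖ₑ) + (K * ‖v‖ₑ) * (K * ‖u‖ₑ)) := by
            gcongr
            exacts [(h j v).1, (h j v).2.1, (h j u).2.2]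
        _ = (c * (K + K * K)) * ‖u‖ₑ * ‖v‖ₑ := by ring
        _ ≤ _ := by gcongr; exact le_add_self
  have := ENNReal.toReal_mono (by finiteness) key
  simpa only [ENNReal.toReal_mul, toReal_enorm] using this

lemma fluxProd_sub_left (hd : 3 ≤ d) (hm : (d : ℝ) / 2 < m) (j : Fin d) (u u' v : SobolevL1 d m) :
    fluxProd hd hm j (u - u') v = fluxProd hd hm j u v - fluxProd hd hm j u' v := by
  refine toL1_injective (Lp.ext ?_)
  rw [map_sub]
  filter_upwards [toL1_fluxProd_ae hd hm j (u - u') v, toL1_fluxProd_ae hd hm j u v,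
    toL1_fluxProd_ae hd hm j u' v, Lp.coeFn_sub (toL1 (fluxProd hd hm j u v))
      (toL1 (fluxProd hd hm j u' v)), Lp.coeFn_sub (toL1 u) (toL1 u')] with x h1 h2 h3 h4 h5
  rw [h1, h4, Pi.sub_apply, h2, h3, map_sub, h5, Pi.sub_apply, sub_mul]

lemma fluxProd_sub_right (hd : 3 ≤ d) (hm : (d : ℝ) / 2 < m) (j : Fin d) (u v v' : SobolevL1 d m) :
    fluxProd hd hm j u (v - v') = fluxProd hd hm j u v - fluxProd hd hm j u v' := by
  refine toL1_injective (Lp.ext ?_)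
  rw [map_sub]
  have hs : sobolevNorm m (toL1 v - toL1 v' : L1 d) < ∞ := by
    rw [← map_sub]; exact sobolevNorm_toL1_lt_top _
  filter_upwards [toL1_fluxProd_ae hd hm j u (v - v'), toL1_fluxProd_ae hd hm j u v,
    toL1_fluxProd_ae hd hm j u v', Lp.coeFn_sub (toL1 (fluxProd hd hm j u v))
      (toL1 (fluxProd hd hm j u v'))] with x h1 h2 h3 h4
  rw [h1, h4, Pi.sub_apply, h2, h3, map_sub, gradient_potential_sub hd hm j
    (sobolevNorm_toL1_lt_top v) (sobolevNorm_toL1_lt_top v') hs, mul_sub]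

/-! ### The nonlinearity as a Volterra kernel. -/

/-- The nonlinearity `e^{tΔ} ∇·(u ∇(g * u))` of the Duhamel formula. -/
def drift (hd : 3 ≤ d) (hm : (d : ℝ) / 2 < m) (t : ℝ) (u : SobolevL1 d m) : SobolevL1 d m :=
  ∑ j, heatDerivOp j t (fluxProd hd hm j u u)

lemma exists_norm_fluxProd_sub_le (hd : 3 ≤ d) (hm : (d : ℝ) / 2 < m) :
    ∃ K : ℝ, 0 ≤ K ∧ ∀ (j : Fin d) (u v : SobolevL1 d m),
      ‖fluxProd hd hm j u u - fluxProd hd hm j v v‖ ≤ K * (‖u‖ + ‖v‖) * ‖u - v‖ := by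
  obtain ⟨K, hK, h⟩ := exists_norm_fluxProd_le hd hm
  refine ⟨K, hK, fun j u v => ?_⟩
  have e : fluxProd hd hm j u u - fluxProd hd hm j v v =
      fluxProd hd hm j (u - v) u + fluxProd hd hm j v (u - v) := by
    rw [fluxProd_sub_left, fluxProd_sub_right]; abel
  rw [e]
  refine (norm_add_le _ _).trans ((add_le_add (h j _ _) (h j _ _)).trans (le_of_eq ?_))
  ring

lemma continuous_fluxProd_self (hd : 3 ≤ d) (hm : (d : ℝ) / 2 < m) (j : Fin d) :
    Continuous fun u : SobolevL1 d m => fluxProd hd hm j u u := by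
  obtain ⟨K, hK, hdiff⟩ := exists_norm_fluxProd_sub_le hd hm
  refine continuous_iff_continuousAt.2 fun v => ?_
  rw [ContinuousAt, tendsto_iff_norm_sub_tendsto_zero]
  refine squeeze_zero (fun _ => norm_nonneg _) (fun u => hdiff j u v) ?_
  have : Continuous fun u : SobolevL1 d m => K * (‖u‖ + ‖v‖) * ‖u - v‖ := by fun_prop
  simpa using this.tendsto v

lemma fluxProd_zero (hd : 3 ≤ d) (hm : (d : ℝ) / 2 < m) (j : Fin d) :
    fluxProd hd hm j 0 0 = (0 : SobolevL1 d m) := by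
  have := fluxProd_sub_left hd hm j (0 : SobolevL1 d m) 0 0
  rwa [sub_self, sub_self] at this

/-- The heat derivative contributes `τ^{-1/2}` and the `L¹` norm of `dKernel`, the quadratic flux
contributes `K (‖u‖ + ‖v‖) ‖u - v‖`. -/
lemma exists_isVolterraKernel_drift (hd : 3 ≤ d) (hm : (d : ℝ) / 2 < m) :
    ∃ C, IsVolterraKernel C (drift hd hm) := by
  obtain ⟨K, hK, hdiff⟩ := exists_norm_fluxProd_sub_le hd hm
  refine ⟨∑ j : Fin d, (∫ z, ‖dKernel j z‖) * K, ?_, fun τ => ?_, fun τ hτ u v => ?_, ?_⟩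
  · exact Finset.sum_nonneg fun j _ => mul_nonneg (integral_nonneg fun _ => norm_nonneg _) hK
  · refine Finset.sum_eq_zero fun j _ => ?_
    rw [fluxProd_zero]
    have := heatDerivOp_sub j τ (0 : SobolevL1 d m) 0
    rwa [sub_self, sub_self] at this
  · rw [drift, drift, ← Finset.sum_sub_distrib, Finset.sum_mul, Finset.sum_mul, Finset.sum_mul]
    refine (norm_sum_le _ _).trans (Finset.sum_le_sum fun j _ => ?_)
    rw [← heatDerivOp_sub]
    refine (norm_heatDerivOp_le j τ _).trans ?_
    rw [Real.rpow_neg hτ.le, ← Real.sqrt_eq_rpow]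
    have h1 : 0 ≤ ∫ z, ‖dKernel j z‖ := integral_nonneg fun _ => norm_nonneg _
    have h2 := hdiff j u v
    calc (√τ)⁻¹ * ((∫ z, ‖dKernel j z‖) * ‖fluxProd hd hm j u u - fluxProd hd hm j v v‖)
        ≤ (√τ)⁻¹ * ((∫ z, ‖dKernel j z‖) * (K * (‖u‖ + ‖v‖) * ‖u - v‖)) := by gcongr
      _ = _ := by ring
  · refine continuousOn_finsetSum _ fun j _ => ?_
    refine (continuousOn_heatDerivOp j).comp
      (f := fun p : ℝ × SobolevL1 d m => (p.1, fluxProd hd hm j p.2 p.2)) ?_ ?_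
    · exact (continuous_fst.prodMk ((continuous_fluxProd_self hd hm j).comp continuous_snd)).continuousOn
    · exact fun p hp => ⟨hp.1, mem_univ _⟩

lemma integral_toL1_drift (hd : 3 ≤ d) (hm : (d : ℝ) / 2 < m) (t : ℝ) (u : SobolevL1 d m) :
    ∫ x, toL1 (drift hd hm t u) x = 0 := by
  have h : ∀ f : L1 d, setIntegralL1 volume univ f = ∫ x, f x := fun f => by
    rw [setIntegralL1_apply, Measure.restrict_univ]
  rw [← h, drift, map_sum, map_sum]
  refine Finset.sum_eq_zero fun j _ => ?_
  rw [h, integral_toL1_heatDerivOp]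

/-! ### Comparison with the pointwise Duhamel formula -/

lemma continuousOn_gradient_heatKernel (j : Fin d) :
    ContinuousOn (fun p : ℝ × Space d => gradient (heatKernel p.1) p.2 j) (Ioi 0 ×ˢ univ) := by
  have h1 : ContinuousOn (fun p : ℝ × Space d => (√p.1)⁻¹) (Ioi 0 ×ˢ univ) :=
    ContinuousOn.inv₀ (Real.continuous_sqrt.comp continuous_fst).continuousOn
      fun p hp => (Real.sqrt_pos.2 hp.1).ne'
  have h2 : ContinuousOn (fun p : ℝ × Space d => (√p.1 ^ d)⁻¹) (Ioi 0 ×ˢ univ) :=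
    ContinuousOn.inv₀ ((Real.continuous_sqrt.comp continuous_fst).pow d).continuousOn
      fun p hp => (pow_pos (Real.sqrt_pos.2 hp.1) d).ne'
  have h3 : ContinuousOn (fun p : ℝ × Space d => dKernel j ((√p.1)⁻¹ • p.2)) (Ioi 0 ×ˢ univ) :=
    (continuous_dKernel j).comp_continuousOn (h1.smul continuous_snd.continuousOn)
  exact (h1.mul (h2.mul h3)).congr fun p hp => gradient_heatKernel_apply hp.1 p.2 j

lemma abs_gradient_heatKernel_le (j : Fin d) {t : ℝ} (ht : 0 < t) (z : Space d) :
    |gradient (heatKernel t) z j| ≤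
      (√t)⁻¹ * ((√t ^ d)⁻¹ * ((4 * Real.pi) ^ (-((d : ℝ) / 2)) * 2)) := by
  rw [gradient_heatKernel_apply ht, abs_mul, abs_mul, abs_of_nonneg (by positivity),
    abs_of_nonneg (by positivity)]
  gcongr
  refine (abs_dKernel_le j _).trans ?_
  have : Real.exp (-(1 / 8) * ‖(√t)⁻¹ • z‖ ^ 2) ≤ 1 :=
    Real.exp_le_one_iff.2 (by nlinarith [sq_nonneg ‖(√t)⁻¹ • z‖])
  have h2 : 0 ≤ (4 * Real.pi) ^ (-((d : ℝ) / 2)) := by positivity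
  nlinarith [mul_le_mul_of_nonneg_left this h2]

lemma integrable_gradient_heatKernel_mul (j : Fin d) {t : ℝ} (ht : 0 < t) (x : Space d) (p : L1 d) :
    Integrable fun y => gradient (heatKernel t) (x - y) j * p y := by
  refine (L1.integrable_coeFn p).bdd_mul (c := (√t)⁻¹ * ((√t ^ d)⁻¹ *
    ((4 * Real.pi) ^ (-((d : ℝ) / 2)) * 2))) ?_
    (Eventually.of_forall fun y => abs_gradient_heatKernel_le j ht _)
  have h : Continuous fun y : Space d => gradient (heatKernel t) (x - y) j :=
    (continuousOn_gradient_heatKernel j).comp_continuous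
      (f := fun y : Space d => (t, x - y)) (by fun_prop) fun y => ⟨ht, mem_univ _⟩
  exact h.aestronglyMeasurable

/-- The convolution of `∂_j P(·,t)` with an integrable function is jointly continuous. -/
lemma continuousOn_integral_gradient_heatKernel (j : Fin d) :
    ContinuousOn (fun q : ℝ × Space d × L1 d =>
      ∫ y, gradient (heatKernel q.1) (q.2.1 - y) j * q.2.2 y) (Ioi 0 ×ˢ univ) := by
  set M : ℝ → ℝ := fun t => (√t)⁻¹ * ((√t ^ d)⁻¹ * ((4 * Real.pi) ^ (-((d : ℝ) / 2)) * 2)) with hM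
  rintro ⟨t₀, x₀, p₀⟩ ⟨ht₀ : 0 < t₀, -⟩
  refine ContinuousAt.continuousWithinAt ?_
  have hMc : ContinuousAt M t₀ := by
    have h1 : ContinuousAt (fun t : ℝ => (√t)⁻¹) t₀ :=
      Real.continuous_sqrt.continuousAt.inv₀ (Real.sqrt_pos.2 ht₀).ne'
    have h2 : ContinuousAt (fun t : ℝ => (√t ^ d)⁻¹) t₀ :=
      (Real.continuous_sqrt.pow d).continuousAt.inv₀ (pow_pos (Real.sqrt_pos.2 ht₀) d).ne'
    exact h1.mul (h2.mul continuousAt_const)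
  have hMe : ∀ᶠ t in 𝓝 t₀, 0 < t ∧ M t ≤ M t₀ + 1 :=
    (eventually_gt_nhds ht₀).and ((hMc.eventually_lt_const (by linarith)).mono fun t h => h.le)
  have hfst : Tendsto (fun q : ℝ × Space d × L1 d => q.1) (𝓝 (t₀, x₀, p₀)) (𝓝 t₀) :=
    continuous_fst.tendsto _
  -- The varying `L¹` function is split as `p₀` plus a small remainder: dominated convergence treats
  -- `p₀`, and the local sup bound on the kernel treats the remainder.
  have h1 : Tendsto (fun q : ℝ × Space d × L1 d =>
      ∫ y, gradient (heatKernel q.1) (q.2.1 - y) j * p₀ y) (𝓝 (t₀, x₀, p₀))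
      (𝓝 (∫ y, gradient (heatKernel t₀) (x₀ - y) j * p₀ y)) := by
    refine tendsto_integral_filter_of_dominated_convergence (fun y => (M t₀ + 1) * ‖p₀ y‖)
      ?_ ?_ ((L1.integrable_coeFn p₀).norm.const_mul _) (Eventually.of_forall fun y => ?_)
    · filter_upwards [hfst.eventually hMe] with q hq
      exact (integrable_gradient_heatKernel_mul j hq.1 _ p₀).1
    · filter_upwards [hfst.eventually hMe] with q hq
      refine Eventually.of_forall fun y => ?_
      rw [norm_mul]
      exact mul_le_mul_of_nonneg_right ((abs_gradient_heatKernel_le j hq.1 _).trans hq.2)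
        (norm_nonneg _)
    · have hc : ContinuousAt (fun p : ℝ × Space d => gradient (heatKernel p.1) p.2 j) (t₀, x₀ - y) :=
        (continuousOn_gradient_heatKernel j).continuousAt
          (prod_mem_nhds (Ioi_mem_nhds ht₀) univ_mem)
      have hc2 : Tendsto (fun q : ℝ × Space d × L1 d => (q.1, q.2.1 - y)) (𝓝 (t₀, x₀, p₀))
          (𝓝 (t₀, x₀ - y)) := by
        have : Continuous fun q : ℝ × Space d × L1 d => (q.1, q.2.1 - y) := by fun_prop
        exact this.tendsto (t₀, x₀, p₀)
      exact (hc.tendsto.comp hc2).mul_const _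
  have h2 : Tendsto (fun q : ℝ × Space d × L1 d =>
      ∫ y, gradient (heatKernel q.1) (q.2.1 - y) j * (q.2.2 - p₀ : L1 d) y) (𝓝 (t₀, x₀, p₀)) (𝓝 0) := by
    have hb : ∀ᶠ q : ℝ × Space d × L1 d in 𝓝 (t₀, x₀, p₀),
        ‖∫ y, gradient (heatKernel q.1) (q.2.1 - y) j * (q.2.2 - p₀ : L1 d) y‖ ≤
          (M t₀ + 1) * ‖q.2.2 - p₀‖ := by
      filter_upwards [hfst.eventually hMe] with q hq
      rw [L1.norm_eq_integral_norm, ← integral_const_mul]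
      refine norm_integral_le_of_norm_le ((L1.integrable_coeFn _).norm.const_mul _)
        (Eventually.of_forall fun y => ?_)
      rw [norm_mul]
      exact mul_le_mul_of_nonneg_right ((abs_gradient_heatKernel_le j hq.1 _).trans hq.2)
        (norm_nonneg _)
    refine squeeze_zero_norm' hb ?_
    have : Continuous fun q : ℝ × Space d × L1 d => (M t₀ + 1) * ‖q.2.2 - p₀‖ := by fun_prop
    simpa using this.tendsto (t₀, x₀, p₀)
  have h3 := h1.add h2
  rw [add_zero] at h3
  refine h3.congr' ?_
  filter_upwards [hfst.eventually hMe] with q hq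
  rw [← integral_add (integrable_gradient_heatKernel_mul j hq.1 _ _)
    (integrable_gradient_heatKernel_mul j hq.1 _ _)]
  refine integral_congr_ae ?_
  filter_upwards [Lp.coeFn_sub q.2.2 p₀] with y hy
  rw [hy, Pi.sub_apply]
  ring

/-- Valid at every `x`, since the flux is known only up to null sets but appears under an integral.
Joint measurability in time and space can thus be read off from the right-hand side. -/
lemma heatDiv_flux (hd : 3 ≤ d) (hm : (d : ℝ) / 2 < m) {t : ℝ} (ht : 0 < t) (u : SobolevL1 d m)
    (x : Space d) : heatDiv t (flux (toL1 u)) x =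
      ∑ j, ∫ y, gradient (heatKernel t) (x - y) j * toL1 (fluxProd hd hm j u u) y := by
  rw [← integral_finsetSum _ fun j _ => integrable_gradient_heatKernel_mul j ht x _, heatDiv]
  refine integral_congr_ae ?_
  have hall : ∀ᵐ y, ∀ j, toL1 (fluxProd hd hm j u u) y =
      toL1 u y * gradient (potential (toL1 u)) y j :=
    ae_all_iff.2 fun j => toL1_fluxProd_ae hd hm j u u
  filter_upwards [hall] with y hy
  rw [PiLp.inner_apply]
  refine Finset.sum_congr rfl fun j _ => ?_
  rw [hy j, flux, PiLp.smul_apply, smul_eq_mul, RCLike.inner_apply, conj_trivial,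
    mul_comm]

lemma toL1_drift_ae (hd : 3 ≤ d) (hm : (d : ℝ) / 2 < m) {t : ℝ} (ht : 0 < t) (u : SobolevL1 d m) :
    toL1 (drift hd hm t u) =ᵐ[volume] heatDiv t (flux (toL1 u)) := by
  rw [drift, map_sum]
  have hall : ∀ᵐ x, ∀ j, toL1 (heatDerivOp j t (fluxProd hd hm j u u)) x =
      ∫ y, gradient (heatKernel t) (x - y) j * toL1 (fluxProd hd hm j u u) y :=
    ae_all_iff.2 fun j => toL1_heatDerivOp_ae j ht _
  filter_upwards [hall, Lp.coeFn_finsetSum Finset.univ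
    fun j => toL1 (heatDerivOp j t (fluxProd hd hm j u u))] with x h1 h2
  rw [h2, heatDiv_flux hd hm ht, Finset.sum_apply]
  exact Finset.sum_congr rfl fun j _ => h1 j

/-- The bridge between the abstract and the pointwise Duhamel terms: joint continuity on `(0,t) ×
ℝ^d` supplies the measurability that `integral_L1_apply_ae` requires. -/
lemma toL1_integral_drift_ae (hd : 3 ≤ d) (hm : (d : ℝ) / 2 < m) {T t : ℝ} {u : ℝ → SobolevL1 d m}
    (hu : ContinuousOn u (Icc 0 T)) (ht : t ∈ Icc 0 T) :
    ∀ᵐ x, IntervalIntegrable (fun s => heatDiv (t - s) (flux (toL1 (u s))) x) volume 0 t ∧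
      toL1 (∫ s in (0 : ℝ)..t, drift hd hm (t - s) (u s)) x =
        ∫ s in (0 : ℝ)..t, heatDiv (t - s) (flux (toL1 (u s))) x := by
  obtain ⟨C, hN⟩ := exists_isVolterraKernel_drift (d := d) (m := m) hd hm
  have hint := hN.intervalIntegrable hu ht.2 le_rfl ht.1 le_rfl
  rw [intervalIntegrable_iff_integrableOn_Ioo_of_le ht.1] at hint
  have hmeas : AEStronglyMeasurable
      (fun p : ℝ × Space d => heatDiv (t - p.1) (flux (toL1 (u p.1))) p.2)
      ((volume.restrict (Ioo 0 t)).prod volume) := by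
    have hprod : (volume.restrict (Ioo 0 t)).prod (volume : Measure (Space d)) =
        (volume.prod volume).restrict (Ioo 0 t ×ˢ univ) := by
      rw [← Measure.prod_restrict, Measure.restrict_univ]
    rw [hprod]
    refine ContinuousOn.aestronglyMeasurable ?_ (measurableSet_Ioo.prod MeasurableSet.univ)
    have hcont : ∀ j : Fin d, ContinuousOn (fun p : ℝ × Space d =>
        ∫ y, gradient (heatKernel (t - p.1)) (p.2 - y) j *
          toL1 (fluxProd hd hm j (u p.1) (u p.1)) y) (Ioo 0 t ×ˢ univ) := by
      intro j
      refine (continuousOn_integral_gradient_heatKernel j).comp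
        (f := fun p : ℝ × Space d => (t - p.1, p.2, toL1 (fluxProd hd hm j (u p.1) (u p.1)))) ?_ ?_
      · have h1 : ContinuousOn (fun p : ℝ × Space d => u p.1) (Ioo 0 t ×ˢ univ) :=
          hu.comp continuous_fst.continuousOn fun p hp => ⟨hp.1.1.le, hp.1.2.le.trans ht.2⟩
        have h2 := (toL1.continuous.comp (continuous_fluxProd_self hd hm j)).comp_continuousOn h1
        exact (continuous_const.sub continuous_fst).continuousOn.prodMk
          (continuous_snd.continuousOn.prodMk h2)
      · exact fun p hp => ⟨sub_pos.2 hp.1.2, mem_univ _⟩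
    refine (continuousOn_finsetSum Finset.univ fun j _ => hcont j).congr fun p hp => ?_
    exact heatDiv_flux hd hm (sub_pos.2 hp.1.2) (u p.1) p.2
  have hF : Integrable (fun s => toL1 (drift hd hm (t - s) (u s))) (volume.restrict (Ioo 0 t)) :=
    toL1.integrable_comp hint
  have hFf : ∀ᵐ s ∂volume.restrict (Ioo 0 t), toL1 (drift hd hm (t - s) (u s)) =ᵐ[volume]
      fun x => heatDiv (t - s) (flux (toL1 (u s))) x := by
    filter_upwards [ae_restrict_mem measurableSet_Ioo] with s hs
    exact toL1_drift_ae hd hm (sub_pos.2 hs.2) (u s)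
  have heq : toL1 (∫ s in (0 : ℝ)..t, drift hd hm (t - s) (u s)) =
      ∫ s in Ioo 0 t, toL1 (drift hd hm (t - s) (u s)) := by
    rw [intervalIntegral.integral_of_le ht.1, integral_Ioc_eq_integral_Ioo,
      ← ContinuousLinearMap.integral_comp_comm _ hint]
  rw [heq]
  filter_upwards [integral_L1_apply_ae hF hmeas hFf] with x hx
  refine ⟨?_, ?_⟩
  · rw [intervalIntegrable_iff_integrableOn_Ioo_of_le ht.1]
    exact hx.1
  · rw [intervalIntegral.integral_of_le ht.1, integral_Ioc_eq_integral_Ioo]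
    exact hx.2

lemma isMildSolution_of_isVolterraSolution (hd : 3 ≤ d) (hm : (d : ℝ) / 2 < m)
    {u₀ : SobolevL1 d m} {T : ℝ} {u : ℝ → SobolevL1 d m}
    (hu : IsVolterraSolution (fun t => heatOp t u₀) (drift hd hm) T u) :
    IsMildSolution m (toL1 u₀) T fun t => toL1 (u t) := by
  have hlim : ∀ t ∈ Icc 0 T, _ := fun t ht => tendsto_iff.1 (hu.continuousOn t ht)
  refine ⟨fun t ht => (hlim t ht).1, fun t _ => sobolevNorm_toL1_lt_top _, fun t ht => (hlim t ht).2,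
    fun t ht => ?_, fun t ht => ?_⟩
  · filter_upwards [toL1_integral_drift_ae hd hm hu.continuousOn ht] with x hx using hx.1
  · have h := congrArg toL1 (hu.eq t ht)
    rw [map_add] at h
    rw [h]
    filter_upwards [toL1_integral_drift_ae hd hm hu.continuousOn ht, toL1_heatOp_ae ht.1 u₀,
      Lp.coeFn_add (toL1 (heatOp t u₀)) (toL1 (∫ s in (0 : ℝ)..t, drift hd hm (t - s) (u s)))]
      with x h1 h2 h3
    rw [h3, Pi.add_apply, h1.2, h2]

lemma exists_isVolterraSolution_of_isMildSolution (hd : 3 ≤ d) (hm : (d : ℝ) / 2 < m)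
    {u₀ : SobolevL1 d m} {T : ℝ} {ρ : ℝ → L1 d} (hρ : IsMildSolution m (toL1 u₀) T ρ) :
    ∃ u, IsVolterraSolution (fun t => heatOp t u₀) (drift hd hm) T u ∧
      EqOn ρ (fun t => toL1 (u t)) (Icc 0 T) := by
  classical
  -- The default 0 is only taken at times outside `[0,T]`.
  set u : ℝ → SobolevL1 d m := fun t =>
    if h : sobolevNorm m (ρ t) < ∞ then ofL1 (ρ t) h else 0 with hu
  have hρu : ∀ t ∈ Icc 0 T, toL1 (u t) = ρ t := fun t ht => by
    simp only [hu]
    rw [dif_pos (hρ.mem_sobolev t ht), toL1_ofL1]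
  have hc : ContinuousOn u (Icc 0 T) := by
    intro t ht
    refine tendsto_iff.2 ⟨?_, ?_⟩
    · rw [hρu t ht]
      refine (hρ.continuousOn_L1 t ht).congr' ?_
      filter_upwards [self_mem_nhdsWithin] with s hs using (hρu s hs).symm
    · rw [hρu t ht]
      refine (hρ.continuousOn_sobolev t ht).congr' ?_
      filter_upwards [self_mem_nhdsWithin] with s hs
      rw [hρu s hs]
  refine ⟨u, ⟨hc, fun t ht => toL1_injective (Lp.ext ?_)⟩, fun t ht => (hρu t ht).symm⟩
  rw [map_add, hρu t ht]
  filter_upwards [hρ.duhamel t ht, toL1_integral_drift_ae hd hm hc ht, toL1_heatOp_ae ht.1 u₀,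
    Lp.coeFn_add (toL1 (heatOp t u₀)) (toL1 (∫ s in (0 : ℝ)..t, drift hd hm (t - s) (u s)))]
    with x h0 h1 h2 h3
  rw [h0, h3, Pi.add_apply, h1.2, h2]
  congr 1
  refine intervalIntegral.integral_congr fun s hs => ?_
  rw [uIcc_of_le ht.1] at hs
  beta_reduce
  rw [hρu s ⟨hs.1, hs.2.trans ht.2⟩]

end CoulombFP

end

/-! ### Existence, uniqueness, blow-up criterion and conservation of mass. -/

open CoulombFP CoulombFP.SobolevL1 in
theorem propositionA2 (d : ℕ) (hd : 3 ≤ d) (m : ℝ) (hm : (d : ℝ) / 2 < m)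
    (ρ₀ : CoulombFP.L1 d) (hρ₀ : CoulombFP.sobolevNorm m ρ₀ < ∞) :
    -- local existence
    (∃ T : ℝ, 0 < T ∧ ∃ ρ, CoulombFP.IsMildSolution m ρ₀ T ρ) ∧
    -- uniqueness on every interval
    (∀ T : ℝ, 0 < T → ∀ ρ₁ ρ₂, CoulombFP.IsMildSolution m ρ₀ T ρ₁ →
      CoulombFP.IsMildSolution m ρ₀ T ρ₂ → EqOn ρ₁ ρ₂ (Icc 0 T)) ∧
    -- the maximal solution on `[0, T_b)` and the blow-up criterion
    (∃ ρ : ℝ → CoulombFP.L1 d,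
      (∀ T : ℝ, 0 < T → (T : EReal) < CoulombFP.maximalTime m ρ₀ →
        CoulombFP.IsMildSolution m ρ₀ T ρ) ∧
      (CoulombFP.maximalTime m ρ₀ < ⊤ →
        limsup (fun t => CoulombFP.sobolevNorm m (ρ t) + ‖ρ t‖ₑ)
          (𝓝[<] (CoulombFP.maximalTime m ρ₀).toReal) = ∞)) ∧
    -- conservation of the integral
    (∀ T : ℝ, 0 < T → ∀ ρ, CoulombFP.IsMildSolution m ρ₀ T ρ →
      ∀ t ∈ Icc 0 T, ∫ x, ρ t x = ∫ x, ρ₀ x) := by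
  obtain ⟨C, hN⟩ := exists_isVolterraKernel_drift (d := d) (m := m) hd hm
  set u₀ : SobolevL1 d m := ofL1 ρ₀ hρ₀ with hu₀
  set h : ℝ → SobolevL1 d m := fun t => heatOp t u₀ with hh
  have hhc : ContinuousOn h (Ici 0) := (continuous_heatOp u₀).continuousOn
  have hR : ∀ t, 0 ≤ t → ‖h t‖ ≤ ‖u₀‖ := fun t _ => norm_heatOp_le t u₀
  have h0 : h 0 = u₀ := by
    rw [hh]
    beta_reduce
    rw [heatOp, Real.sqrt_zero, conv_zero_right, integral_heatKernel one_pos, one_smul]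
  have hto : ∀ {T u}, IsVolterraSolution h (drift hd hm) T u →
      IsMildSolution m ρ₀ T fun t => toL1 (u t) := fun hu =>
    isMildSolution_of_isVolterraSolution hd hm hu
  have hfrom : ∀ {T ρ}, IsMildSolution m ρ₀ T ρ → ∃ u, IsVolterraSolution h (drift hd hm) T u ∧
      EqOn ρ (fun t => toL1 (u t)) (Icc 0 T) := fun hρ =>
    exists_isVolterraSolution_of_isMildSolution hd hm (u₀ := u₀) hρ
  have hex : ∃ T : ℝ, 0 < T ∧ ∃ u, IsVolterraSolution h (drift hd hm) T u := by
    -- Local existence is continuation of the trivial solution on the degenerate interval `[0,0]`.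
    obtain ⟨δ, hδ, hext⟩ := IsVolterraSolution.exists_extension hN hhc hR ‖u₀‖ 0 (norm_nonneg _)
    refine ⟨0 + δ, by simpa using hδ, hext 0 ⟨le_rfl, le_rfl⟩ (fun _ => u₀) ⟨continuousOn_const, ?_⟩
      fun _ _ => le_rfl⟩
    intro t ht
    obtain rfl : t = 0 := le_antisymm ht.2 ht.1
    rw [h0, intervalIntegral.integral_same, add_zero]
  refine ⟨?_, ?_, ?_, ?_⟩
  · obtain ⟨T, hT, u, hu⟩ := hex
    exact ⟨T, hT, _, hto hu⟩
  · intro T hT ρ₁ ρ₂ h1 h2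
    obtain ⟨u₁, hu₁, e₁⟩ := hfrom h1
    obtain ⟨u₂, hu₂, e₂⟩ := hfrom h2
    intro t ht
    rw [e₁ ht, e₂ ht]
    exact congrArg toL1 (hu₁.eqOn hN hu₂ ht)
  · obtain ⟨U, hU⟩ := IsVolterraSolution.exists_maximal (h := h) hN
    have hle : ∀ T : ℝ, 0 < T → ∀ u, IsVolterraSolution h (drift hd hm) T u →
        (T : EReal) ≤ maximalTime m ρ₀ := fun T hT u hu =>
      le_sSup ⟨T, ⟨hT, _, hto hu⟩, rfl⟩
    have hsol : ∀ T : ℝ, (T : EReal) < maximalTime m ρ₀ → IsVolterraSolution h (drift hd hm) T U := by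
      intro T hlt
      obtain ⟨_, ⟨T', ⟨_, ρ, hρ⟩, rfl⟩, hlt'⟩ := lt_sSup_iff.1 hlt
      obtain ⟨u, hu, -⟩ := hfrom hρ
      exact hU T u (hu.mono (EReal.coe_lt_coe_iff.1 hlt').le)
    refine ⟨fun t => toL1 (U t), fun T _ hlt => hto (hsol T hlt), fun htop => ?_⟩
    obtain ⟨T₁, hT₁, u₁, hu₁⟩ := hex
    have hb0 := hle T₁ hT₁ u₁ hu₁
    have hbot : maximalTime m ρ₀ ≠ ⊥ := fun hbot => by
      rw [hbot] at hb0
      exact absurd hb0 (not_le.2 (EReal.bot_lt_coe T₁))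
    obtain ⟨b, hb⟩ : ∃ b : ℝ, maximalTime m ρ₀ = b :=
      ⟨_, (EReal.coe_toReal htop.ne hbot).symm⟩
    rw [hb, EReal.toReal_coe]
    rw [hb, EReal.coe_le_coe_iff] at hb0
    have hbpos : 0 < b := hT₁.trans_le hb0
    simp only [hb, EReal.coe_lt_coe_iff, EReal.coe_le_coe_iff] at hle hsol
    by_contra hne
    -- A finite limsup bounds the norm by `c` on some interval ending at `b`; compactness bounds it
    -- before that.
    obtain ⟨c, hc1, hc2⟩ := exists_between (lt_top_iff_ne_top.2 hne)
    have hev := eventually_lt_of_limsup_lt hc1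
    obtain ⟨a, ha, hab⟩ := (mem_nhdsLT_iff_exists_Ioo_subset).1 hev
    obtain ⟨t₁, ht₁, ht₁b⟩ := exists_between (max_lt ha hbpos)
    obtain ⟨M₁, hM₁⟩ := isCompact_Icc.exists_bound_of_continuousOn (hsol t₁ ht₁b).continuousOn
    set M := max (max M₁ c.toReal) 0
    have hbound : ∀ t, 0 ≤ t → t < b → ‖U t‖ ≤ M := by
      intro t ht htb
      rcases le_or_gt t t₁ with hle | hgt
      · exact (hM₁ t ⟨ht, hle⟩).trans ((le_max_left _ _).trans (le_max_left _ _))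
      · have h1 : sobolevNorm m (toL1 (U t)) + ‖toL1 (U t)‖ₑ < c :=
          hab ⟨(le_max_left _ _).trans_lt (ht₁.trans hgt), htb⟩
        have h2 : ‖U t‖ₑ ≤ c := by
          rw [enorm_eq]
          exact max_le (le_add_self.trans h1.le) (le_self_add.trans h1.le)
        have h3 := ENNReal.toReal_mono hc2.ne h2
        rw [toReal_enorm] at h3
        exact h3.trans ((le_max_right _ _).trans (le_max_left _ _))
    obtain ⟨δ, hδ, hext⟩ := IsVolterraSolution.exists_extension hN hhc hR M b (le_max_right _ _)
    -- Restarting at `t₀ > b - δ` gives a solution up to `t₀ + δ > b`, contrary to the maximality of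
    -- `b`.
    obtain ⟨t₀, ht₀, ht₀b⟩ := exists_between (max_lt (sub_lt_self b hδ) hbpos)
    have ht₀0 : 0 < t₀ := (le_max_right _ _).trans_lt ht₀
    obtain ⟨v, hv⟩ := hext t₀ ⟨ht₀0.le, ht₀b.le⟩ U (hsol t₀ ht₀b)
      fun t ht => hbound t ht.1 (ht.2.trans_lt ht₀b)
    have h4 := hle _ (by linarith) v hv
    have h5 := (le_max_left _ _).trans_lt ht₀
    linarith
  · intro T hT ρ hρ t ht
    obtain ⟨u, hu, e⟩ := hfrom hρ
    have hI : ∀ f : L1 d, setIntegralL1 volume univ f = ∫ x, f x := fun f => by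
      rw [setIntegralL1_apply, Measure.restrict_univ]
    have hint := hN.intervalIntegrable hu.continuousOn ht.2 le_rfl ht.1 le_rfl
    -- Total mass is a continuous functional, so it passes under the Duhamel integral, where it
    -- kills every drift term.
    have hcomm := ((setIntegralL1 volume univ).comp (toL1 (d := d) (m := m))).intervalIntegral_comp_comm hint
    have hzero : ∀ s, ((setIntegralL1 volume univ).comp (toL1 (d := d) (m := m)))
        (drift hd hm (t - s) (u s)) = 0 := fun s => by
      rw [ContinuousLinearMap.comp_apply, hI, integral_toL1_drift]
    simp only [hzero, intervalIntegral.integral_zero] at hcomm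
    rw [ContinuousLinearMap.comp_apply] at hcomm
    rw [e ht]
    beta_reduce
    rw [← hI, hu.eq t ht, map_add, map_add, ← hcomm, add_zero, hI, integral_toL1_heatOp]
    rfl
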